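/- Let $G$ be a real Lie group with finite-dimensional Lie algebra $\mathfrak g$, let $e_a$ be a basis of $\mathfrak g$, and let $C_{bc}{}^a$ be the commutator structure tensor, $[e_b,e_c]=C_{bc}{}^a e_a$. Let $g_{ab}$ be a positive definite metric tensor on $\mathfrak g$ (not necessarily compatible with the commutator), with inverse $g^{ab}$, and let $p_{ab}$ be a skew tensor on $\mathfrak g$. Put $$C^a{}_{bc}=g^{ad}C_{db}{}^e g_{ec},\qquad Q^a{}_{bc}=-\tfrac32\, g^{ad}\,p_{e[d}C_{bc]}{}^e,$$ where $[dbc]$ denotes antisymmetrization with weight one (the signed sum over the permutations, divided by $3!$). Fix real constants $v_t,v_x,v_y$ and a time $t_0$. Let $\lambda\in\mathbb R$ be small in the sense that there is a constant $k>0$ with $$\tfrac1k\,(E^2+H^2)\le E^2+H^2+2\lambda v_t\,p_{ab}H^aE^b\le k\,(E^2+H^2)\quad\text{for all }E,H\in\mathfrak g,\qquad E^2:=g_{ab}E^aE^b .$$ Let $\Sigma=\mathbb R$ or $\Sigma=S^1=\mathbb R/L\mathbb Z$ with $L>0$. Then for all smooth compactly supported functions $\hat E,\hat H,\hat B:\Sigma\to\mathfrak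 g$ satisfying the constraint $\partial_x\hat H^a=-C_{bc}{}^a\hat E^b\hat H^c$, there is exactly one triple of smooth functions $E,H,B:\Sigma\times\mathbb R\to\mathfrak g$ of $(x,t)$ that satisfies, on all of $\Sigma\times\mathbb R$, the evolution equations $$\partial_tE^a=\partial_xB^a-C_{bc}{}^aB^bE^c,\qquad \partial_tH^a=-C_{bc}{}^aB^bH^c,$$ $$\partial_tB^a=\partial_xE^a-C^a{}_{bc}\,(B^bB^c-E^bE^c-H^bH^c)-\lambda\,Q^a{}_{bc}\,(v_yB^bE^c-v_xB^bH^c+v_tE^bH^c)$$ and the initial conditions $E(\cdot,t_0)=\hat E$, $H(\cdot,t_0)=\hat H$, $B(\cdot,t_0)=\hat B$. Moreover, this solution satisfies the constraint $\partial_xH^a=-C_{bc}{}^aE^bH^c$ on all of $\Sigma\times\mathbb R$. -/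

import Mathlib

open scoped ContDiff

/-! ## Constant tensors on the Lie algebra

All tensors are given by their components in a basis indexed by a finite type `ι`. -/

section Tensors

variable {ι : Type*}

/-- The commutator structure tensor `C_{bc}{}^a` of a Lie algebra in the basis `e`:
`[e_b, e_c] = C_{bc}{}^a e_a`. -/
noncomputable def structureTensor {𝔤 : Type*} [LieRing 𝔤] [LieAlgebra ℝ 𝔤] (e : Module.Basis ι ℝ 𝔤)
    (b c a : ι) : ℝ :=
  e.repr ⁅e b, e c⁆ a

/-- Antisymmetrization over three indices, with weight one: `T_{[dbc]}`. -/
noncomputable def antisymmetrize (T : ι → ι → ι → ℝ) (d b c : ι) : ℝ :=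
  (1 / 6) * (T d b c + T b c d + T c d b - T b d c - T d c b - T c b d)

variable [Fintype ι]

/-- The contraction `C_{bc}{}^a X^b Y^c`. -/
def lieTerm (C : ι → ι → ι → ℝ) (X Y : ι → ℝ) (a : ι) : ℝ :=
  ∑ b, ∑ c, C b c a * X b * Y c

/-- The contraction `T^a{}_{bc} X^b Y^c`, where the upper index `a` is the first one of `T`. -/
def contract (T : ι → ι → ι → ℝ) (X Y : ι → ℝ) (a : ι) : ℝ :=
  ∑ b, ∑ c, T a b c * X b * Y c

/-- The quadratic form `S_{ab} X^a Y^b`. -/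
def pairing (S : Matrix ι ι ℝ) (X Y : ι → ℝ) : ℝ :=
  ∑ a, ∑ b, S a b * X a * Y b

variable [DecidableEq ι]

/-- The tensor `C^a{}_{bc} = g^{ad} C_{db}{}^e g_{ec}`. -/
noncomputable def raisedTensor (C : ι → ι → ι → ℝ) (g : Matrix ι ι ℝ) (a b c : ι) : ℝ :=
  ∑ d, ∑ e, g⁻¹ a d * C d b e * g e c

/-- The torsion tensor `Q^a{}_{bc} = -(3/2) g^{ad} p_{e[d} C_{bc]}{}^e`. -/
noncomputable def torsionTensor (C : ι → ι → ι → ℝ) (g p : Matrix ι ι ℝ) (a b c : ι) : ℝ :=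
  -(3 / 2) * ∑ d, g⁻¹ a d * antisymmetrize (fun d' b' c' => ∑ e, p e d' * C b' c' e) d b c

end Tensors

/-! ## Smallness of the coupling constant -/

/-- The coupling constant `lam` is small: for some `k > 0` and all Lie algebra vectors `E`, `H`,
`(1/k) (E² + H²) ≤ E² + H² + 2 lam v_t p_{ab} H^a E^b ≤ k (E² + H²)`, with `E² = g_{ab} E^a E^b`. -/
def SmallCoupling {ι : Type*} [Fintype ι] (g p : Matrix ι ι ℝ) (vt lam : ℝ) : Prop :=
  ∃ k : ℝ, 0 < k ∧ ∀ E H : ι → ℝ,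
    (1 / k) * (pairing g E E + pairing g H H) ≤
        pairing g E E + pairing g H H + 2 * lam * vt * pairing p H E ∧
      pairing g E E + pairing g H H + 2 * lam * vt * pairing p H E ≤
        k * (pairing g E E + pairing g H H)

/-! ## Frame fields, the field equations and the Cauchy problem -/

/-- A triple of Lie algebra valued functions `E^a`, `H^a`, `B^a` on `X`: initial data for `X = ℝ`
(the variable is `x`), space-time fields for `X = ℝ × ℝ` (the variables are `(x, t)`). -/
structure FrameFields (X ι : Type*) where
  /-- the components `E^a` -/
  E : X → ι → ℝ
  /-- the components `H^a` -/
  H : X → ι → ℝ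
  /-- the components `B^a` -/
  B : X → ι → ℝ

namespace FrameFields

variable {ι : Type*}

/-- All components are `C^∞` on `X`. -/
def Smooth {X : Type*} [NormedAddCommGroup X] [NormedSpace ℝ X] [Fintype ι]
    (K : FrameFields X ι) : Prop :=
  ContDiff ℝ ∞ K.E ∧ ContDiff ℝ ∞ K.H ∧ ContDiff ℝ ∞ K.B

/-- All components have compact support. -/
def CompactlySupported (D : FrameFields ℝ ι) : Prop :=
  HasCompactSupport D.E ∧ HasCompactSupport D.H ∧ HasCompactSupport D.B

/-- Data on the circle `ℝ / Lℤ`, as `L`-periodic functions of `x`. -/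
def DataPeriodic (L : ℝ) (D : FrameFields ℝ ι) : Prop :=
  Function.Periodic D.E L ∧ Function.Periodic D.H L ∧ Function.Periodic D.B L

/-- Fields on `(ℝ / Lℤ) × ℝ`, as functions of `(x, t)` that are `L`-periodic in `x`. -/
def SpacePeriodic (L : ℝ) (K : FrameFields (ℝ × ℝ) ι) : Prop :=
  ∀ t : ℝ, Function.Periodic (fun x => K.E (x, t)) L ∧
    Function.Periodic (fun x => K.H (x, t)) L ∧ Function.Periodic (fun x => K.B (x, t)) L

/-- The restriction of the fields to the time `t₀`. -/
def slice (K : FrameFields (ℝ × ℝ) ι) (t₀ : ℝ) : FrameFields ℝ ι where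
  E := fun x => K.E (x, t₀)
  H := fun x => K.H (x, t₀)
  B := fun x => K.B (x, t₀)

variable [Fintype ι]

/-- The constraint `∂_x H^a = - C_{bc}{}^a E^b H^c` on functions of `x`. -/
def Constraint (C : ι → ι → ι → ℝ) (D : FrameFields ℝ ι) : Prop :=
  ∀ (x : ℝ) (a : ι), deriv (fun y => D.H y a) x = -lieTerm C (D.E x) (D.H x) a

/-- The evolution equations
`∂_t E^a = ∂_x B^a - C_{bc}{}^a B^b E^c`, `∂_t H^a = - C_{bc}{}^a B^b H^c`,
`∂_t B^a = ∂_x E^a - C^a{}_{bc} (B^b B^c - E^b E^c - H^b H^c)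
  - lam Q^a{}_{bc} (v_y B^b E^c - v_x B^b H^c + v_t E^b H^c)`. -/
def Evolution [DecidableEq ι] (C : ι → ι → ι → ℝ) (g p : Matrix ι ι ℝ) (vt vx vy lam : ℝ)
    (K : FrameFields (ℝ × ℝ) ι) : Prop :=
  ∀ (x t : ℝ) (a : ι),
    deriv (fun s => K.E (x, s) a) t =
        deriv (fun y => K.B (y, t) a) x - lieTerm C (K.B (x, t)) (K.E (x, t)) a ∧
    deriv (fun s => K.H (x, s) a) t = -lieTerm C (K.B (x, t)) (K.H (x, t)) a ∧
    deriv (fun s => K.B (x, s) a) t =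
        deriv (fun y => K.E (y, t) a) x
        - (contract (raisedTensor C g) (K.B (x, t)) (K.B (x, t)) a
          - contract (raisedTensor C g) (K.E (x, t)) (K.E (x, t)) a
          - contract (raisedTensor C g) (K.H (x, t)) (K.H (x, t)) a)
        - lam * (vy * contract (torsionTensor C g p) (K.B (x, t)) (K.E (x, t)) a
          - vx * contract (torsionTensor C g p) (K.B (x, t)) (K.H (x, t)) a
          + vt * contract (torsionTensor C g p) (K.E (x, t)) (K.H (x, t)) a)

/-- A smooth global solution of the Cauchy problem with data `D` at time `t₀`: smooth fields on
`ℝ × ℝ` satisfying the evolution equations and the initial conditions. -/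
def IsCauchySolution [DecidableEq ι] (C : ι → ι → ι → ℝ) (g p : Matrix ι ι ℝ)
    (vt vx vy lam t₀ : ℝ) (K : FrameFields (ℝ × ℝ) ι) (D : FrameFields ℝ ι) : Prop :=
  K.Smooth ∧ K.Evolution C g p vt vx vy lam ∧ K.slice t₀ = D

end FrameFields

/-! In the variables `B + E`, `B - E`, `H` the evolution equations form a semilinear system with
characteristic speeds -1, 1, 0 and a quadratic nonlinearity. Smooth solutions of such a system are
unique, have finite propagation speed, and continue as long as they stay bounded. A quadratic
nonlinearity alone could cause blow-up, so the heart of the matter is an a priori bound, which rests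
on the algebra of the equations.

The constraint propagates because its defect `Z = ∂_x H + [E, H]` satisfies `∂_t Z = -[B, Z]`, by
the Jacobi identity. Given the constraint, the energy density `e = ½(E² + H² + B²) - ½ λ v_t p(H,
E)` obeys a conservation law `∂_t e = ∂_x f`. Smallness of `λ` yields `|f| ≤ e` and makes `e`
dominate a multiple of `E² + H²`. Hence the energy on the shrinking slices of a light cone does not
grow, and the integral of `E² + H²` is controlled (`integral_slice_le`, `exists_integral_bound`).
The constraint bounds `∂_x H` by the product of `E` and `H`, hence in `L¹`, so `H` is bounded
pointwise (`exists_bound_H`). Finally the squares of `B + E` and `B - E` are transported along light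
rays, and in their equations all terms without `H` cancel (`g_null_add`, `g_null_sub`). What remains
grows at most quadratically in `E` and `B`, so Gronwall's inequality closes the estimate
(`exists_bound_forward`). The reflection `t ↦ -t`, `B ↦ -B` covers negative times.

For existence the nonlinearity is cut off and thus globally Lipschitz. A contraction in an
exponentially weighted norm solves the truncated system for all times (`exists_isMild`), adjoining
the space derivative as a new unknown gives smoothness (`IsMild.contDiffOn`), and the a priori bound
shows that a high enough cutoff is never reached (`exists_solvesOn_slab`). Solutions on growing
diamonds are glued by uniqueness. All estimates live on light cones, so periodic data are solved on
the line as well, and uniqueness makes their solutions periodic. -/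

open Set Filter Topology

/-! ### Gronwall estimates along characteristics -/

/-- Integral bound against an exponential weight. -/
lemma norm_integral_le_exp {E : Type*} [NormedAddCommGroup E] [NormedSpace ℝ E]
    {φ : ℝ → E} {K m b t : ℝ} (hm : 0 ≤ m)
    (h : ∀ s ∈ uIcc 0 t, ‖φ s‖ ≤ b + K * (m * Real.exp (2 * K * |s|))) :
    ‖∫ s in (0 : ℝ)..t, φ s‖ ≤ b * |t| + m / 2 * Real.exp (2 * K * |t|) := by
  have key : ∀ (ψ : ℝ → E) (t : ℝ), 0 ≤ t →
      (∀ s ∈ Icc 0 t, ‖ψ s‖ ≤ b + K * (m * Real.exp (2 * K * |s|))) →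
      ‖∫ s in (0 : ℝ)..t, ψ s‖ ≤ b * |t| + m / 2 * Real.exp (2 * K * |t|) := by
    intro ψ t ht h
    have hcont : Continuous fun s : ℝ => b + K * (m * Real.exp (2 * K * s)) := by fun_prop
    have h1 : ‖∫ s in (0 : ℝ)..t, ψ s‖ ≤ ∫ s in (0 : ℝ)..t, (b + K * (m * Real.exp (2 * K * s))) := by
      refine intervalIntegral.norm_integral_le_of_norm_le ht (Eventually.of_forall ?_)
        (hcont.intervalIntegrable _ _)
      intro s hs
      have := h s ⟨hs.1.le, hs.2⟩
      rwa [abs_of_pos hs.1] at this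
    -- The exponential rate is `2 * K`, twice the growth constant: integrating `K * m * exp (2 * K *
    -- s)` then yields the factor `1 / 2` that drives the contraction and the Gronwall iteration.
    have h2 : ∫ s in (0 : ℝ)..t, (b + K * (m * Real.exp (2 * K * s)))
        = (b * t + m / 2 * Real.exp (2 * K * t)) - (b * 0 + m / 2 * Real.exp (2 * K * 0)) := by
      refine intervalIntegral.integral_eq_sub_of_hasDerivAt
        (f := fun s => b * s + m / 2 * Real.exp (2 * K * s)) ?_ (hcont.intervalIntegrable _ _)
      intro s _
      have h3 : HasDerivAt (fun s : ℝ => 2 * K * s) (2 * K) s := by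
        simpa using (hasDerivAt_id s).const_mul (2 * K)
      have h4 := ((hasDerivAt_id s).const_mul b).add (h3.exp.const_mul (m / 2))
      convert h4 using 1
      · rfl
      · ring
    rw [h2] at h1
    rw [abs_of_nonneg ht]
    simp only [mul_zero, Real.exp_zero] at h1
    linarith
  rcases le_total 0 t with ht | ht
  · exact key φ t ht (by rwa [uIcc_of_le ht] at h)
  · have h1 := key (fun s => φ (-s)) (-t) (by linarith) (by
      intro s hs
      have := h (-s) (by rw [uIcc_of_ge ht]; constructor <;> linarith [hs.1, hs.2])
      rwa [abs_neg] at this)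
    rw [intervalIntegral.integral_comp_neg, neg_neg, neg_zero, intervalIntegral.integral_symm,
      norm_neg, abs_neg] at h1
    exact h1

/-- Gronwall's inequality for finitely many quantities, each of which is controlled by the values
of all of them along its own characteristic. -/
lemma gronwall_along_characteristics {J : Type*} {D : Set (ℝ × ℝ)}
    {f : J → ℝ × ℝ → ℝ} {a K : ℝ} (ha : 0 ≤ a) (hbdd : ∃ M, ∀ z ∈ D, ∀ j, f j z ≤ M)
    (hK : 0 ≤ K)
    (h : ∀ m, 0 ≤ m → (∀ z ∈ D, ∀ j, f j z ≤ m * Real.exp (2 * K * |z.2|)) →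
      ∀ z ∈ D, ∀ j, f j z ≤ a + m / 2 * Real.exp (2 * K * |z.2|)) :
    ∀ z ∈ D, ∀ j, f j z ≤ 2 * a * Real.exp (2 * K * |z.2|) := by
  obtain ⟨M, hM⟩ := hbdd
  have hexp : ∀ z : ℝ × ℝ, 1 ≤ Real.exp (2 * K * |z.2|) := fun z => Real.one_le_exp (by positivity)
  -- Since the exponential is at least 1, the hypothesis replaces a constant `m` by `a + m / 2`.
  -- Iteration from `2 * a + |M|` halves the distance to the fixed point `2 * a` each time.
  have key : ∀ n : ℕ, ∀ z ∈ D, ∀ j, f j z ≤ (2 * a + |M| / 2 ^ n) * Real.exp (2 * K * |z.2|) := by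
    intro n
    induction n with
    | zero =>
      intro z hz j
      have h1 := hM z hz j
      have h2 := hexp z
      have h3 := le_abs_self M
      have h4 : |M| * 1 ≤ |M| * Real.exp (2 * K * |z.2|) := by gcongr
      have h5 : 0 ≤ 2 * a * Real.exp (2 * K * |z.2|) := by positivity
      simp only [pow_zero, div_one]
      nlinarith
    | succ n ih =>
      intro z hz j
      have h1 := h _ (by positivity) ih z hz j
      have h2 : a * 1 ≤ a * Real.exp (2 * K * |z.2|) := by gcongr; exact hexp z
      refine h1.trans ?_
      have : (2 * a + |M| / 2 ^ (n + 1)) = a + (2 * a + |M| / 2 ^ n) / 2 := by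
        rw [pow_succ]; ring
      rw [this, add_mul]
      linarith
  intro z hz j
  have hlim : Tendsto (fun n : ℕ => (2 * a + |M| / 2 ^ n) * Real.exp (2 * K * |z.2|)) atTop
      (𝓝 ((2 * a + 0) * Real.exp (2 * K * |z.2|))) := by
    refine (Tendsto.const_add _ ?_).mul_const _
    exact tendsto_const_nhds.div_atTop (tendsto_pow_atTop_atTop_of_one_lt (by norm_num))
  rw [add_zero] at hlim
  exact ge_of_tendsto' hlim fun n => key n z hz j

/-! ### Global mild solutions for Lipschitz nonlinearities -/

section Mild

/-- A set which contains, with every point, the characteristics from it back to `t = 0`. -/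
def IsCausal {J : Type*} (c : J → ℝ) (D : Set (ℝ × ℝ)) : Prop :=
  ∀ x t, (x, t) ∈ D → ∀ j, ∀ s ∈ uIcc 0 t, (x - c j * (t - s), s) ∈ D

variable {J V : Type*} [Fintype J] [NormedAddCommGroup V] [NormedSpace ℝ V]

/-- Mild solutions on `D` of the diagonal system `∂_t U_j + c_j ∂_x U_j = F_j(x, t, U)` with
data `U₀` at `t = 0`. -/
def IsMild (c : J → ℝ) (F : ℝ × ℝ → (J → V) → J → V) (U₀ : ℝ → J → V) (U : ℝ × ℝ → J → V)
    (D : Set (ℝ × ℝ)) : Prop :=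
  ∀ x t, (x, t) ∈ D → ∀ j, U (x, t) j = U₀ (x - c j * t) j +
    ∫ s in (0 : ℝ)..t, F (x - c j * (t - s), s) (U (x - c j * (t - s), s)) j

/-- Global mild solutions exist if the nonlinearity is globally Lipschitz. -/
theorem exists_isMild [CompleteSpace V] (c : J → ℝ) (F : ℝ × ℝ → (J → V) → J → V) (U₀ : ℝ → J → V)
    (hF : Continuous fun q : (ℝ × ℝ) × (J → V) => F q.1 q.2) {K : ℝ} (hK : 0 < K)
    (hLip : ∀ z a b, ‖F z a - F z b‖ ≤ K * ‖a - b‖) {M : ℝ} (hM : ∀ z, ‖F z 0‖ ≤ M)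
    (hU₀ : Continuous U₀) {B : ℝ} (hB : ∀ x, ‖U₀ x‖ ≤ B) :
    ∃ U : ℝ × ℝ → J → V, Continuous U ∧ IsMild c F U₀ U univ := by
  have hM0 : 0 ≤ M := (norm_nonneg _).trans (hM 0)
  have hB0 : 0 ≤ B := (norm_nonneg _).trans (hB 0)
  let w : ℝ → ℝ := fun t => Real.exp (2 * K * |t|)
  have hw : Continuous w := by fun_prop
  have hwpos : ∀ t, 0 < w t := fun t => Real.exp_pos _
  have hw1 : ∀ t, 1 ≤ w t := fun t => Real.one_le_exp (by positivity)
  -- Duhamel's map conjugated by the weight. The unknown is `W = U / w`, which stays bounded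
  -- although `U` may grow exponentially, and the map contracts the plain sup distance by `1 / 2`
  -- for all times at once.
  let N : (ℝ × ℝ → J → V) → ℝ × ℝ → J → V := fun W z j =>
    (w z.2)⁻¹ • (U₀ (z.1 - c j * z.2) j + ∫ s in (0 : ℝ)..z.2,
      F (z.1 - c j * (z.2 - s), s) (w s • W (z.1 - c j * (z.2 - s), s)) j)
  have hNcont : ∀ W : ℝ × ℝ → J → V, Continuous W → Continuous (N W) := by
    intro W hW
    refine continuous_pi fun j => ?_
    refine Continuous.smul (Continuous.inv₀ (by fun_prop) fun z => (hwpos _).ne') ?_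
    refine Continuous.add ((continuous_apply j).comp (hU₀.comp (by fun_prop))) ?_
    refine intervalIntegral.continuous_parametric_intervalIntegral_of_continuous
      (f := fun (z : ℝ × ℝ) s =>
        F (z.1 - c j * (z.2 - s), s) (w s • W (z.1 - c j * (z.2 - s), s)) j) ?_ continuous_snd
    have hp : Continuous fun q : (ℝ × ℝ) × ℝ => (q.1.1 - c j * (q.1.2 - q.2), q.2) := by fun_prop
    exact (continuous_apply j).comp (hF.comp (hp.prodMk
      ((hw.comp continuous_snd).smul (hW.comp hp))))
  have hNdiff : ∀ W W' : BoundedContinuousFunction (ℝ × ℝ) (J → V), ∀ z,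
      ‖N W z - N W' z‖ ≤ 1 / 2 * dist W W' := by
    intro W W' z
    rw [pi_norm_le_iff_of_nonneg (by positivity)]
    intro j
    have hint : ∀ W : BoundedContinuousFunction (ℝ × ℝ) (J → V), IntervalIntegrable (fun s =>
        F (z.1 - c j * (z.2 - s), s) (w s • W (z.1 - c j * (z.2 - s), s)) j)
        MeasureTheory.volume 0 z.2 := by
      intro W
      refine Continuous.intervalIntegrable ?_ _ _
      have hp : Continuous fun s : ℝ => (z.1 - c j * (z.2 - s), s) := by fun_prop
      exact (continuous_apply j).comp (hF.comp (hp.prodMk (hw.smul (W.continuous.comp hp))))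
    have h1 : (N W z - N W' z) j = (w z.2)⁻¹ • ∫ s in (0 : ℝ)..z.2,
        (F (z.1 - c j * (z.2 - s), s) (w s • W (z.1 - c j * (z.2 - s), s)) j -
          F (z.1 - c j * (z.2 - s), s) (w s • W' (z.1 - c j * (z.2 - s), s)) j) := by
      rw [intervalIntegral.integral_sub (hint W) (hint W')]
      simp only [N, Pi.sub_apply]
      rw [← smul_sub]
      congr 1
      abel
    have h2 := norm_integral_le_exp (E := V) (b := 0) (t := z.2) (dist_nonneg (x := W) (y := W'))
      (φ := fun s => (F (z.1 - c j * (z.2 - s), s) (w s • W (z.1 - c j * (z.2 - s), s)) j -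
          F (z.1 - c j * (z.2 - s), s) (w s • W' (z.1 - c j * (z.2 - s), s)) j)) (by
        intro s _
        rw [zero_add]
        have h3 := norm_le_pi_norm (F (z.1 - c j * (z.2 - s), s)
          (w s • W (z.1 - c j * (z.2 - s), s)) - F (z.1 - c j * (z.2 - s), s)
            (w s • W' (z.1 - c j * (z.2 - s), s))) j
        refine h3.trans ((hLip _ _ _).trans ?_)
        rw [← smul_sub, norm_smul, Real.norm_of_nonneg (hwpos s).le, mul_comm (w s)]
        gcongr
        rw [← dist_eq_norm]
        exact BoundedContinuousFunction.dist_coe_le_dist _)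
    rw [h1, norm_smul, norm_inv, Real.norm_of_nonneg (hwpos _).le, inv_mul_le_iff₀ (hwpos _)]
    refine h2.trans (le_of_eq ?_)
    simp only [w]; ring
  have hN0 : ∀ z, ‖N 0 z‖ ≤ B + M / K / 2 := by
    intro z
    rw [pi_norm_le_iff_of_nonneg (by positivity)]
    intro j
    simp only [N]
    rw [norm_smul, norm_inv, Real.norm_of_nonneg (hwpos _).le, inv_mul_le_iff₀ (hwpos _)]
    refine (norm_add_le _ _).trans ?_
    -- With `m = M / K` the constant bound `M` is at most `K * m` times the weight.
    have h2 := norm_integral_le_exp (E := V) (b := 0) (t := z.2) (m := M / K) (by positivity)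
      (φ := fun s => F (z.1 - c j * (z.2 - s), s)
        (w s • (0 : ℝ × ℝ → J → V) (z.1 - c j * (z.2 - s), s)) j) (by
        intro s _
        simp only [Pi.zero_apply, smul_zero]
        refine (norm_le_pi_norm _ j).trans ((hM _).trans ?_)
        have : K * (M / K * Real.exp (2 * K * |s|)) = M * w s := by
          simp only [w]; field_simp
        rw [this]
        nlinarith [hw1 s])
    have h3 : ‖U₀ (z.1 - c j * z.2) j‖ ≤ B * w z.2 := by
      refine (norm_le_pi_norm _ j).trans ((hB _).trans ?_)
      nlinarith [hw1 z.2]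
    simp only [w] at h3 ⊢
    linarith
  have hNb : ∀ W : BoundedContinuousFunction (ℝ × ℝ) (J → V), ∀ z,
      ‖N W z‖ ≤ B + M / K / 2 + 1 / 2 * dist W 0 := by
    intro W z
    have h1 := hNdiff W 0 z
    have h2 := hN0 z
    have h3 : N W z = N 0 z + (N W z - N (0 : BoundedContinuousFunction (ℝ × ℝ) (J → V)) z) := by
      simp
    rw [h3]
    exact (norm_add_le _ _).trans (add_le_add h2 h1)
  let Φ : BoundedContinuousFunction (ℝ × ℝ) (J → V) → BoundedContinuousFunction (ℝ × ℝ) (J → V) :=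
    fun W => BoundedContinuousFunction.ofNormedAddCommGroup (N W) (hNcont W W.continuous) _ (hNb W)
  have hΦ : ContractingWith (1 / 2 : NNReal) Φ := by
    refine ⟨by rw [← NNReal.coe_lt_coe]; norm_num, LipschitzWith.of_dist_le_mul fun W W' => ?_⟩
    rw [BoundedContinuousFunction.dist_le (by positivity)]
    intro z
    rw [dist_eq_norm]
    have h := hNdiff W W' z
    norm_num at h ⊢
    exact h
  let W := ContractingWith.fixedPoint Φ hΦ
  have hW : N W = W := by
    have := hΦ.fixedPoint_isFixedPt
    exact congrArg (fun f : BoundedContinuousFunction (ℝ × ℝ) (J → V) => (f : ℝ × ℝ → J → V)) this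
  refine ⟨fun z => w z.2 • W z, (by fun_prop : Continuous fun z : ℝ × ℝ => w z.2).smul W.continuous,
    fun x t _ j => ?_⟩
  have h1 : W (x, t) j = N W (x, t) j := by rw [hW]
  simp only [Pi.smul_apply]
  rw [h1]
  simp only [N]
  rw [smul_smul, mul_inv_cancel₀ (hwpos t).ne', one_smul]

end Mild

/-! ### Diamonds and finite propagation speed -/

/-- The closed diamond `|x| + |t| ≤ r`. -/
def diamond (r : ℝ) : Set (ℝ × ℝ) := {z | |z.1| + |z.2| ≤ r}

/-- The open diamond `|x| + |t| < r`. -/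
def openDiamond (r : ℝ) : Set (ℝ × ℝ) := {z | |z.1| + |z.2| < r}

lemma isOpen_openDiamond (r : ℝ) : IsOpen (openDiamond r) :=
  isOpen_lt (by fun_prop) continuous_const

lemma isCompact_diamond (r : ℝ) : IsCompact (diamond r) := by
  refine IsCompact.of_isClosed_subset (isCompact_Icc.prod isCompact_Icc : IsCompact
    (Icc (-r) r ×ˢ Icc (-r) r)) (isClosed_le (by fun_prop) continuous_const) ?_
  intro z hz
  have hz : |z.1| + |z.2| ≤ r := hz
  exact ⟨abs_le.1 (by linarith [abs_nonneg z.2]), abs_le.1 (by linarith [abs_nonneg z.1])⟩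

/-- Going back from time `t` to `s` at speed at most 1 moves `x` by at most `|t - s| = |t| - |s|`.
This makes the diamonds domains of dependence. -/
lemma abs_characteristic_le {c x t s : ℝ} (hc : |c| ≤ 1) (hs : s ∈ uIcc 0 t) :
    |x - c * (t - s)| + |s| ≤ |x| + |t| := by
  have h1 : |c * (t - s)| ≤ |t - s| := by
    rw [abs_mul]; nlinarith [abs_nonneg (t - s)]
  have h2 : |t - s| + |s| = |t| := by
    rcases le_total 0 t with ht | ht
    · rw [uIcc_of_le ht] at hs
      rw [abs_of_nonneg ht, abs_of_nonneg hs.1, abs_of_nonneg (by linarith [hs.2])]; ring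
    · rw [uIcc_of_ge ht] at hs
      rw [abs_of_nonpos ht, abs_of_nonpos hs.2, abs_of_nonpos (by linarith [hs.1])]; ring
  have h3 := abs_sub x (c * (t - s))
  linarith

lemma isCausal_diamond {J : Type*} {c : J → ℝ} (hc : ∀ j, |c j| ≤ 1) (r : ℝ) :
    IsCausal c (diamond r) := fun _ _ h j _ hs => (abs_characteristic_le (hc j) hs).trans h

lemma isCausal_openDiamond {J : Type*} {c : J → ℝ} (hc : ∀ j, |c j| ≤ 1) (r : ℝ) :
    IsCausal c (openDiamond r) := fun _ _ h j _ hs => (abs_characteristic_le (hc j) hs).trans_lt h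

lemma intervalIntegrable_characteristic {J V : Type*} [NormedAddCommGroup V] {c : J → ℝ}
    {Φ : ℝ × ℝ → J → V} (hΦ : Continuous Φ) (x t : ℝ) (j : J) :
    IntervalIntegrable (fun s => Φ (x - c j * (t - s), s) j) MeasureTheory.volume 0 t :=
  ((continuous_apply j).comp (hΦ.comp (by fun_prop))).intervalIntegrable _ _

/-! ### Stability of mild solutions and their space derivative -/

section Mild

variable {J V : Type*} [NormedAddCommGroup V] [NormedSpace ℝ V] {c : J → ℝ}

lemma IsMild.mono {F : ℝ × ℝ → (J → V) → J → V} {U₀ : ℝ → J → V} {U : ℝ × ℝ → J → V}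
    {D D' : Set (ℝ × ℝ)} (h : IsMild c F U₀ U D) (hD : D' ⊆ D) : IsMild c F U₀ U D' :=
  fun x t hz j => h x t (hD hz) j

lemma IsMild.const_smul {Φ : ℝ × ℝ → J → V} {U₀ : ℝ → J → V} {U : ℝ × ℝ → J → V}
    {D : Set (ℝ × ℝ)} (hU : IsMild c (fun z _ => Φ z) U₀ U D) (k : ℝ) :
    IsMild c (fun z _ => k • Φ z) (k • U₀) (k • U) D := by
  intro x t hz j
  simp only [Pi.smul_apply]
  rw [hU x t hz j, intervalIntegral.integral_smul, smul_add]

lemma IsMild.translate {Φ : ℝ × ℝ → J → V} {U₀ : ℝ → J → V} {U : ℝ × ℝ → J → V}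
    {D D' : Set (ℝ × ℝ)} (hU : IsMild c (fun z _ => Φ z) U₀ U D) (h : ℝ)
    (hD : ∀ z ∈ D', z + (h, 0) ∈ D) :
    IsMild c (fun z _ => Φ (z + (h, 0))) (fun x => U₀ (x + h)) (fun z => U (z + (h, 0))) D' := by
  intro x t hz j
  have h1 := hD _ hz
  simp only [Prod.mk_add_mk, add_zero] at h1 ⊢
  rw [hU _ _ h1 j]
  simp only [sub_add_eq_add_sub]

/-- The nonlinear terms enter as frozen functions `Φ`, `Ψ` of the point, so differences of solutions
of nonlinear equations are again mild and fall under `IsMild.norm_le`. -/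
lemma IsMild.sub {Φ Ψ : ℝ × ℝ → J → V} {U₀ W₀ : ℝ → J → V} {U W : ℝ × ℝ → J → V}
    {D : Set (ℝ × ℝ)} (hU : IsMild c (fun z _ => Φ z) U₀ U D)
    (hW : IsMild c (fun z _ => Ψ z) W₀ W D)
    (hΦ : Continuous Φ) (hΨ : Continuous Ψ) :
    IsMild c (fun z _ => Φ z - Ψ z) (U₀ - W₀) (U - W) D := by
  intro x t hz j
  simp only [Pi.sub_apply]
  rw [hU x t hz j, hW x t hz j, intervalIntegral.integral_sub
    (intervalIntegrable_characteristic hΦ x t j) (intervalIntegrable_characteristic hΨ x t j)]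
  abel

variable [Fintype J]

/-- Gronwall's inequality for mild solutions. -/
lemma IsMild.norm_le {Φ : ℝ × ℝ → J → V} {A : ℝ → J → V} {W : ℝ × ℝ → J → V}
    {D : Set (ℝ × ℝ)} (hW : IsMild c (fun z _ => Φ z) A W D) (hD : IsCausal c D) {r a b K : ℝ}
    (ha : 0 ≤ a) (hb : 0 ≤ b) (hK : 0 ≤ K) (hr : ∀ z ∈ D, |z.2| ≤ r) (hr0 : 0 ≤ r)
    (hbdd : ∃ M, ∀ z ∈ D, ‖W z‖ ≤ M) (hA : ∀ x, (x, 0) ∈ D → ‖A x‖ ≤ a)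
    (hΦ : ∀ z ∈ D, ‖Φ z‖ ≤ b + K * ‖W z‖) :
    ∀ z ∈ D, ‖W z‖ ≤ 2 * (a + b * r) * Real.exp (2 * K * |z.2|) := by
  have main : ∀ z ∈ D, ∀ j, ‖W z j‖ ≤ 2 * (a + b * r) * Real.exp (2 * K * |z.2|) := by
    refine gronwall_along_characteristics (f := fun j z => ‖W z j‖) (by positivity)
      ?_ hK ?_
    · obtain ⟨M, hM⟩ := hbdd
      exact ⟨M, fun z hz j => (norm_le_pi_norm _ j).trans (hM z hz)⟩
    · rintro m hm hle ⟨x, t⟩ hz j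
      rw [hW x t hz j]
      have h0 : (x - c j * t, (0 : ℝ)) ∈ D := by simpa using hD x t hz j 0 left_mem_uIcc
      refine (norm_add_le _ _).trans ?_
      have h1 := (norm_le_pi_norm (A (x - c j * t)) j).trans (hA _ h0)
      have h2 := norm_integral_le_exp (φ := fun s => Φ (x - c j * (t - s), s) j) (b := b) (K := K)
        (t := t) hm (by
          intro s hs
          have hs' := hD x t hz j s hs
          refine (norm_le_pi_norm _ j).trans ((hΦ _ hs').trans ?_)
          gcongr
          exact (pi_norm_le_iff_of_nonneg (by positivity)).2 (hle _ hs'))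
      have h3 : b * |t| ≤ b * r := by gcongr; exact hr _ hz
      simp only at h2 ⊢
      linarith
  exact fun z hz => (pi_norm_le_iff_of_nonneg (by positivity)).2 (main z hz)

/-- A `C¹` map is strictly differentiable uniformly on compact sets. -/
lemma eventually_norm_sub_sub_fderiv_le {X Y : Type*} [NormedAddCommGroup X] [NormedSpace ℝ X]
    [NormedAddCommGroup Y] [NormedSpace ℝ Y] {G : X → Y} (hG : ContDiff ℝ 1 G) {S : Set X}
    (hS : IsCompact S) {ε : ℝ} (hε : 0 < ε) :
    ∀ᶠ k in 𝓝 (0 : X), ∀ a ∈ S, ‖G (a + k) - G a - fderiv ℝ G a k‖ ≤ ε * ‖k‖ := by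
  refine hS.eventually_forall_of_forall_eventually fun a₀ _ => ?_
  have h1 : ∀ᶠ q : X × X in 𝓝 (a₀, a₀),
      ‖G q.1 - G q.2 - fderiv ℝ G a₀ (q.1 - q.2)‖ ≤ ε / 2 * ‖q.1 - q.2‖ :=
    Asymptotics.isLittleO_iff.1 (hG.contDiffAt.hasStrictFDerivAt one_ne_zero).isLittleO
      (half_pos hε)
  have h2 : Tendsto (fun q : X × X => (q.2 + q.1, q.2)) (𝓝 (0, a₀)) (𝓝 (a₀, a₀)) := by
    have : Continuous fun q : X × X => (q.2 + q.1, q.2) := by fun_prop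
    simpa using this.tendsto (0, a₀)
  have h3 : Tendsto (fun q : X × X => fderiv ℝ G q.2) (𝓝 (0, a₀)) (𝓝 (fderiv ℝ G a₀)) :=
    ((hG.continuous_fderiv one_ne_zero).comp continuous_snd).tendsto (0, a₀)
  filter_upwards [h2.eventually h1, (Metric.tendsto_nhds.1 h3) (ε / 2) (half_pos hε)] with q hq hq'
  simp only [add_sub_cancel_left] at hq
  rw [dist_eq_norm] at hq'
  have h4 : G (q.2 + q.1) - G q.2 - fderiv ℝ G q.2 q.1 =
      (G (q.2 + q.1) - G q.2 - fderiv ℝ G a₀ q.1) - (fderiv ℝ G q.2 - fderiv ℝ G a₀) q.1 := by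
    simp only [sub_apply]; abel
  rw [h4]
  refine (norm_sub_le _ _).trans ?_
  have h5 := (fderiv ℝ G q.2 - fderiv ℝ G a₀).le_of_opNorm_le hq'.le q.1
  linarith

/-- The solution of the linearized system with data `U₀'` is the space derivative of a mild
solution. -/
theorem IsMild.hasDerivAt_space (hc : ∀ j, |c j| ≤ 1) {F : (J → V) → J → V} (hF : ContDiff ℝ 1 F)
    {U₀ : ℝ → J → V} (hU₀ : ContDiff ℝ 1 U₀) {U U' : ℝ × ℝ → J → V} (hUc : Continuous U)
    (hU'c : Continuous U') {R : ℝ} (hU : IsMild c (fun _ => F) U₀ U (openDiamond R))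
    (hU' : IsMild c (fun z W => fderiv ℝ F (U z) W) (deriv U₀) U' (openDiamond R))
    {z₀ : ℝ × ℝ} (hz₀ : z₀ ∈ openDiamond R) :
    HasDerivAt (fun x => U (x, z₀.2)) (U' z₀) z₀.1 := by
  have hz₀' : |z₀.1| + |z₀.2| < R := hz₀
  set r := |z₀.1| + |z₀.2| with hr
  have hr0 : 0 ≤ r := by positivity
  have hS := isCompact_diamond r
  have hcaus := isCausal_diamond hc r
  have hzS : z₀ ∈ diamond r := le_refl r
  have ht : ∀ z ∈ diamond r, |z.2| ≤ r := fun z hz => by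
    have hz : |z.1| + |z.2| ≤ r := hz
    linarith [abs_nonneg z.1]
  have hx : ∀ x, (x, (0 : ℝ)) ∈ diamond r → x ∈ Icc (-r) r := fun x hx => by
    have hx : |x| + |(0 : ℝ)| ≤ r := hx
    rw [abs_zero, add_zero] at hx
    exact abs_le.1 hx
  have hsub : diamond r ⊆ openDiamond R := fun z hz =>
    lt_of_le_of_lt (show |z.1| + |z.2| ≤ r from hz) hz₀'
  have hF'c := hF.continuous_fderiv one_ne_zero
  obtain ⟨K, hK⟩ := hS.exists_bound_of_continuousOn (hF'c.comp hUc).continuousOn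
  have hK0 : 0 ≤ K := (norm_nonneg _).trans (hK z₀ hzS)
  obtain ⟨L, hL⟩ := (isCompact_Icc (a := -r) (b := r)).exists_bound_of_continuousOn
    (hU₀.continuous_fderiv one_ne_zero).continuousOn
  have hL0 : 0 ≤ L := (norm_nonneg _).trans (hL 0 ⟨by linarith, hr0⟩)
  have hbddU : ∀ W : ℝ × ℝ → J → V, Continuous W → ∃ M, ∀ z ∈ diamond r, ‖W z‖ ≤ M :=
    fun W hW => hS.exists_bound_of_continuousOn hW.continuousOn
  -- uniform first order expansions for small displacements
  have ev0 : ∀ ε, 0 < ε → ∀ᶠ h in 𝓝 (0 : ℝ), ∀ y ∈ Icc (-r) r,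
      ‖U₀ (y + h) - U₀ y - fderiv ℝ U₀ y h‖ ≤ ε * ‖h‖ := fun ε hε =>
    eventually_norm_sub_sub_fderiv_le hU₀ isCompact_Icc hε
  have ev1 : ∀ ε, 0 < ε → ∀ᶠ h in 𝓝 (0 : ℝ), ∀ z ∈ diamond r,
      ‖F (U (z + (h, 0))) - F (U z) - fderiv ℝ F (U z) (U (z + (h, 0)) - U z)‖ ≤
        ε * ‖U (z + (h, 0)) - U z‖ := by
    intro ε hε
    have h1 := eventually_norm_sub_sub_fderiv_le hF (hS.image hUc) hε
    have h2 : ∀ᶠ h in 𝓝 (0 : ℝ), ∀ z ∈ diamond r, U (z + (h, 0)) - U z ∈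
        {k | ∀ a ∈ U '' diamond r, ‖F (a + k) - F a - fderiv ℝ F a k‖ ≤ ε * ‖k‖} := by
      refine hS.eventually_forall_of_forall_eventually fun z _ => ?_
      have h3 : Tendsto (fun q : ℝ × ℝ × ℝ => U (q.2 + (q.1, 0)) - U q.2) (𝓝 (0, z)) (𝓝 0) := by
        have : Continuous fun q : ℝ × ℝ × ℝ => U (q.2 + (q.1, 0)) - U q.2 :=
          (hUc.comp (by fun_prop)).sub (hUc.comp continuous_snd)
        have h4 := this.tendsto (0, z)
        have h5 : z + ((0 : ℝ), (0 : ℝ)) = z := by ext <;> simp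
        simpa [h5] using h4
      exact h3 h1
    filter_upwards [h2] with h hh z hz
    simpa using hh z hz (U z) (mem_image_of_mem _ hz)
  have evR : ∀ᶠ h in 𝓝 (0 : ℝ), ∀ z ∈ diamond r, z + (h, 0) ∈ openDiamond R := by
    have : ∀ᶠ h in 𝓝 (0 : ℝ), |h| < R - r := by
      have := continuous_abs.tendsto (0 : ℝ)
      exact this.eventually (gt_mem_nhds (by rw [abs_zero]; linarith))
    filter_upwards [this] with h hh z hz
    have hz : |z.1| + |z.2| ≤ r := hz
    show |z.1 + h| + |z.2 + 0| < R
    rw [add_zero]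
    linarith [abs_add_le z.1 h]
  -- Gronwall constant for the differences: `L` and `K` bound the derivatives of the data and of `F`
  -- along `U`, and the added 1 is the Taylor error with `ε = 1`.
  set C := 2 * (L + 1) * Real.exp (2 * (K + 1) * r) with hC
  have hC0 : 0 ≤ C := by positivity
  have hdiff : ∀ᶠ h in 𝓝 (0 : ℝ), IsMild c (fun z _ => F (U (z + (h, 0))) - F (U z))
      ((fun x => U₀ (x + h)) - U₀) ((fun z => U (z + (h, 0))) - U) (diamond r) := by
    filter_upwards [evR] with h hR
    have hUm : IsMild c (fun z _ => F (U z)) U₀ U (openDiamond R) := hU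
    exact (hUm.translate h hR).sub (Φ := fun z => F (U (z + (h, 0)))) (Ψ := fun z => F (U z))
      (hUm.mono hsub) (hF.continuous.comp (hUc.comp (by fun_prop))) (hF.continuous.comp hUc)
  -- the difference is of first order
  have hd : ∀ᶠ h in 𝓝 (0 : ℝ), ∀ z ∈ diamond r, ‖U (z + (h, 0)) - U z‖ ≤ C * |h| := by
    filter_upwards [hdiff, ev0 1 one_pos, ev1 1 one_pos] with h hm h0 h1 z hz
    have := hm.norm_le hcaus (a := (L + 1) * |h|) (b := 0) (K := K + 1) (by positivity) le_rfl
      (by positivity) ht hr0 (hbddU _ ((hUc.comp (by fun_prop)).sub hUc)) ?_ ?_ z hz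
    · simp only [Pi.sub_apply, zero_mul, add_zero] at this
      refine this.trans ?_
      rw [hC]
      have h2 : Real.exp (2 * (K + 1) * |z.2|) ≤ Real.exp (2 * (K + 1) * r) := by
        gcongr; exact ht z hz
      have h3 : 0 ≤ 2 * (L + 1) * |h| := by positivity
      nlinarith
    · intro x hx'
      have h2 := h0 x (hx x hx')
      have h3 := (fderiv ℝ U₀ x).le_of_opNorm_le (hL x (hx x hx')) h
      have h4 := norm_add_le (U₀ (x + h) - U₀ x - fderiv ℝ U₀ x h) (fderiv ℝ U₀ x h)
      simp only [sub_add_cancel, Pi.sub_apply] at h4 ⊢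
      rw [Real.norm_eq_abs] at h2 h3
      linarith
    · intro z hz
      have h2 := h1 z hz
      have h3 := (fderiv ℝ F (U z)).le_of_opNorm_le (hK z hz) (U (z + (h, 0)) - U z)
      have h4 := norm_add_le (F (U (z + (h, 0))) - F (U z) -
        fderiv ℝ F (U z) (U (z + (h, 0)) - U z)) (fderiv ℝ F (U z) (U (z + (h, 0)) - U z))
      simp only [sub_add_cancel, Pi.sub_apply] at h4 ⊢
      linarith
  rw [hasDerivAt_iff_isLittleO_nhds_zero, Asymptotics.isLittleO_iff]
  intro ε hε
  -- Gronwall turns relative errors `ε / M` in the data and in the nonlinearity into a total error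
  -- of exactly `ε * |h|`.
  set M := 2 * (1 + C * r) * Real.exp (2 * K * r) with hM
  have hM0 : 0 < M := by positivity
  have hη : 0 < ε / M := by positivity
  filter_upwards [hdiff, hd, ev0 _ hη, ev1 _ hη] with h hm hd h0 h1
  -- The remainder `U (· + h) - U - h • U'` is mild with source `fderiv ℝ F (U z)` applied to the
  -- remainder itself, plus the Taylor error of `F`.
  have hm' := hm.sub (Φ := fun z => F (U (z + (h, 0))) - F (U z))
    (Ψ := fun z => h • fderiv ℝ F (U z) (U' z))
    (IsMild.const_smul (Φ := fun z => fderiv ℝ F (U z) (U' z)) (hU'.mono hsub) h)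
    ((hF.continuous.comp (hUc.comp (by fun_prop))).sub (hF.continuous.comp hUc))
    (((hF'c.comp hUc).clm_apply hU'c).const_smul h)
  have := hm'.norm_le hcaus (a := ε / M * |h|) (b := ε / M * (C * |h|)) (K := K) (by positivity)
    (by positivity) hK0 ht hr0
    (hbddU _ (((hUc.comp (by fun_prop)).sub hUc).sub (hU'c.const_smul h))) ?_ ?_ z₀ hzS
  · simp only [Pi.sub_apply, Pi.smul_apply] at this
    have h2 : z₀ + (h, 0) = (z₀.1 + h, z₀.2) := by ext <;> simp
    rw [h2] at this
    refine this.trans ?_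
    have h3 : Real.exp (2 * K * |z₀.2|) ≤ Real.exp (2 * K * r) := by
      gcongr; exact ht _ hzS
    calc 2 * (ε / M * |h| + ε / M * (C * |h|) * r) * Real.exp (2 * K * |z₀.2|)
        ≤ 2 * (ε / M * |h| + ε / M * (C * |h|) * r) * Real.exp (2 * K * r) := by gcongr
      _ = ε / M * M * |h| := by rw [hM]; ring
      _ = ε * ‖h‖ := by rw [div_mul_cancel₀ _ hM0.ne', Real.norm_eq_abs]
  · intro x hx'
    have h2 := h0 x (hx x hx')
    have h3 : fderiv ℝ U₀ x h = h • deriv U₀ x := by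
      rw [← fderiv_apply_one_eq_deriv, ← map_smul, smul_eq_mul, mul_one]
    rw [h3] at h2
    simpa using h2
  · intro z hz
    have h2 := h1 z hz
    have h3 := (fderiv ℝ F (U z)).le_of_opNorm_le (hK z hz) (U (z + (h, 0)) - U z - h • U' z)
    have h4 := norm_add_le (F (U (z + (h, 0))) - F (U z) -
        fderiv ℝ F (U z) (U (z + (h, 0)) - U z)) (fderiv ℝ F (U z) (U (z + (h, 0)) - U z - h • U' z))
    have h5 := hd z hz
    have h6 : F (U (z + (h, 0))) - F (U z) - fderiv ℝ F (U z) (U (z + (h, 0)) - U z) +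
        fderiv ℝ F (U z) (U (z + (h, 0)) - U z - h • U' z) =
        F (U (z + (h, 0))) - F (U z) - h • fderiv ℝ F (U z) (U' z) := by
      rw [map_sub _ (_ - _), map_smul]; abel
    rw [h6] at h4
    have h7 : ε / M * ‖U (z + (h, 0)) - U z‖ ≤ ε / M * (C * |h|) := by gcongr
    simp only [Pi.sub_apply, Pi.smul_apply]
    linarith

end Mild

/-! ### Smoothness of mild solutions -/

section Regularity

variable {J V : Type*} [Fintype J] [NormedAddCommGroup V] [NormedSpace ℝ V] {c : J → ℝ}

/-- A mild solution has a continuous time derivative along its characteristics. -/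
lemma IsMild.hasDerivAt_characteristic {J V : Type*} [NormedAddCommGroup V] [NormedSpace ℝ V]
    [CompleteSpace V] {c : J → ℝ} {F : (J → V) → J → V} (hF : Continuous F)
    {U₀ : ℝ → J → V} {U : ℝ × ℝ → J → V} (hUc : Continuous U) {D : Set (ℝ × ℝ)} (hD : IsOpen D)
    (hU : IsMild c (fun _ => F) U₀ U D) {y t : ℝ} {j : J} (hz : (y + c j * t, t) ∈ D) :
    HasDerivAt (fun s => U (y + c j * s, s) j) (F (U (y + c j * t, t)) j) t := by
  have hcont : Continuous fun s => F (U (y + c j * s, s)) j :=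
    (continuous_apply j).comp (hF.comp (hUc.comp (by fun_prop)))
  have h1 : HasDerivAt (fun τ => U₀ y j + ∫ s in (0 : ℝ)..τ, F (U (y + c j * s, s)) j)
      (F (U (y + c j * t, t)) j) t :=
    (intervalIntegral.integral_hasDerivAt_right (hcont.intervalIntegrable _ _)
      hcont.stronglyMeasurable.stronglyMeasurableAtFilter hcont.continuousAt).const_add _
  refine h1.congr_of_eventuallyEq ?_
  have h2 : ∀ᶠ τ in 𝓝 t, (y + c j * τ, τ) ∈ D := by
    have : Continuous fun τ : ℝ => (y + c j * τ, τ) := by fun_prop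
    exact this.continuousAt.eventually (hD.mem_nhds hz)
  filter_upwards [h2] with τ hτ
  rw [hU _ _ hτ j]
  have h3 : ∀ s, y + c j * τ - c j * (τ - s) = y + c j * s := fun s => by ring
  simp only [h3, add_sub_cancel_right]

/-- Existence for the linearized system, with coefficients continuous on a diamond. -/
lemma exists_isMild_linearized [CompleteSpace V] (hc : ∀ j, |c j| ≤ 1) {F : (J → V) → J → V}
    (hF : ContDiff ℝ 1 F) {U : ℝ × ℝ → J → V} (hUc : Continuous U) {W₀ : ℝ → J → V}
    (hW₀ : Continuous W₀) (R : ℝ) :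
    ∃ W : ℝ × ℝ → J → V, Continuous W ∧
      IsMild c (fun z w => fderiv ℝ F (U z) w) W₀ W (openDiamond R) := by
  -- Clamping both variables to `[-R, R]` makes the coefficients and the data bounded, as
  -- `exists_isMild` requires, and changes nothing on the diamond.
  let cl : ℝ → ℝ := fun x => max (-R) (min R x)
  have hcl : Continuous cl := by fun_prop
  have hclid : ∀ x, |x| ≤ R → cl x = x := fun x hx => by
    simp only [cl]; rw [min_eq_right (abs_le.1 hx).2, max_eq_right (abs_le.1 hx).1]
  rcases lt_or_ge R 0 with hR | hR
  · refine ⟨0, continuous_const, fun x t hz => absurd hz ?_⟩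
    intro h
    have h : |x| + |t| < R := h
    linarith [abs_nonneg x, abs_nonneg t]
  have hclmem : ∀ x, cl x ∈ Icc (-R) R := fun x =>
    ⟨le_max_left _ _, max_le (by linarith) (min_le_left _ _)⟩
  obtain ⟨K, hK⟩ := ((isCompact_Icc (a := -R) (b := R)).prod (isCompact_Icc (a := -R)
    (b := R))).exists_bound_of_continuousOn
      ((hF.continuous_fderiv one_ne_zero).comp hUc).continuousOn
  obtain ⟨B, hB⟩ := (isCompact_Icc (a := -R) (b := R)).exists_bound_of_continuousOn hW₀.continuousOn
  have hcl2 : Continuous fun z : ℝ × ℝ => (cl z.1, cl z.2) := by fun_prop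
  have hLip : ∀ (z : ℝ × ℝ) (a b : J → V), ‖fderiv ℝ F (U (cl z.1, cl z.2)) a -
      fderiv ℝ F (U (cl z.1, cl z.2)) b‖ ≤ (|K| + 1) * ‖a - b‖ := by
    intro z a b
    rw [← map_sub]
    refine ContinuousLinearMap.le_of_opNorm_le _ ?_ _
    have := hK (cl z.1, cl z.2) ⟨hclmem _, hclmem _⟩
    simp only [Function.comp_apply] at this
    linarith [le_abs_self K]
  obtain ⟨W, hW, hWm⟩ := exists_isMild c
    (fun z w => fderiv ℝ F (U (cl z.1, cl z.2)) w) (fun x => W₀ (cl x))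
    ((((hF.continuous_fderiv one_ne_zero).comp (hUc.comp hcl2)).comp continuous_fst).clm_apply
      continuous_snd) (K := |K| + 1) (by positivity) hLip (M := 0) (by simp) (hW₀.comp hcl) (B := B)
    (fun x => hB _ (hclmem x))
  refine ⟨W, hW, fun x t hz j => ?_⟩
  have hmem : ∀ s ∈ uIcc 0 t, |x - c j * (t - s)| ≤ R ∧ |s| ≤ R := fun s hs => by
    have h := isCausal_openDiamond hc R x t hz j s hs
    have h : |x - c j * (t - s)| + |s| < R := h
    constructor <;> linarith [abs_nonneg (x - c j * (t - s)), abs_nonneg s]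
  rw [hWm x t (mem_univ _) j]
  congr 1
  · have := (hmem 0 left_mem_uIcc).1
    rw [sub_zero] at this
    simp only [hclid _ this]
  · refine intervalIntegral.integral_congr fun s hs => ?_
    simp only [hclid _ (hmem s hs).1, hclid _ (hmem s hs).2]

/-- The Fréchet derivative of a component of a mild solution. -/
lemma IsMild.hasFDerivAt [CompleteSpace V] (hc : ∀ j, |c j| ≤ 1) {F : (J → V) → J → V}
    (hF : ContDiff ℝ 1 F) {U₀ : ℝ → J → V} (hU₀ : ContDiff ℝ 1 U₀) {U U' : ℝ × ℝ → J → V}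
    (hUc : Continuous U) (hU'c : Continuous U') {R : ℝ}
    (hU : IsMild c (fun _ => F) U₀ U (openDiamond R))
    (hU' : IsMild c (fun z W => fderiv ℝ F (U z) W) (deriv U₀) U' (openDiamond R))
    {z : ℝ × ℝ} (hz : z ∈ openDiamond R) (j : J) :
    HasFDerivAt (fun z => U z j) ((ContinuousLinearMap.fst ℝ ℝ ℝ).smulRight (U' z j) +
      (ContinuousLinearMap.snd ℝ ℝ ℝ).smulRight (F (U z) j - c j • U' z j)) z := by
  have hopen := isOpen_openDiamond R
  have hsh : Continuous fun v : ℝ × ℝ => (v.1 + c j * v.2, v.2) := by fun_prop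
  set u : ℝ × ℝ := (z.1 - c j * z.2, z.2) with hu
  have hue : (u.1 + c j * u.2, u.2) = z := by ext <;> simp [hu]
  have hnear : ∀ᶠ v in 𝓝 u, (v.1 + c j * v.2, v.2) ∈ openDiamond R :=
    hsh.continuousAt.eventually (hopen.mem_nhds (by simp only [hue]; exact hz))
  -- In the coordinates `(y, t)` with `x = y + c j * t` both partial derivatives exist and are
  -- continuous: `U'` in `y`, and `F (U)` along the characteristic in `t`. The shear `S` leads back
  -- to `(x, t)`.
  have h1 := hasStrictFDerivAt_uncurry_coprod (𝕜 := ℝ) (u := u)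
    (f := fun y t => U (y + c j * t, t) j)
    (f₁ := fun y t => (ContinuousLinearMap.id ℝ ℝ).smulRight (U' (y + c j * t, t) j))
    (f₂ := fun y t => (ContinuousLinearMap.id ℝ ℝ).smulRight (F (U (y + c j * t, t)) j))
    (by
      filter_upwards [hnear] with v hv
      have h2 := hasDerivAt_pi.1 (hU.hasDerivAt_space hc hF hU₀ hUc hU'c hU' hv) j
      exact (h2.comp_add_const v.1 (c j * v.2)).hasFDerivAt)
    (by
      filter_upwards [hnear] with v hv
      exact (hU.hasDerivAt_characteristic hF.continuous hUc hopen hv).hasFDerivAt)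
    (by
      have : Continuous fun v : ℝ × ℝ => U' (v.1 + c j * v.2, v.2) j :=
        (continuous_apply j).comp (hU'c.comp hsh)
      exact ((ContinuousLinearMap.smulRightL ℝ ℝ V
        (ContinuousLinearMap.id ℝ ℝ)).continuous.comp this).continuousAt)
    (by
      have : Continuous fun v : ℝ × ℝ => F (U (v.1 + c j * v.2, v.2)) j :=
        (continuous_apply j).comp (hF.continuous.comp (hUc.comp hsh))
      exact ((ContinuousLinearMap.smulRightL ℝ ℝ V
        (ContinuousLinearMap.id ℝ ℝ)).continuous.comp this).continuousAt)
  let S : ℝ × ℝ →L[ℝ] ℝ × ℝ := (ContinuousLinearMap.fst ℝ ℝ ℝ -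
    c j • ContinuousLinearMap.snd ℝ ℝ ℝ).prod (ContinuousLinearMap.snd ℝ ℝ ℝ)
  have hSu : S z = u := by ext <;> simp [S, hu]
  have h2 := h1.hasFDerivAt
  rw [← hSu] at h2
  have h3 := h2.comp z S.hasFDerivAt
  have h4 : (Function.HasUncurry.uncurry fun y t => U (y + c j * t, t) j) ∘ S = fun z => U z j := by
    funext w
    simp [S, Function.HasUncurry.uncurry]
  rw [h4] at h3
  refine h3.congr_fderiv ?_
  ext <;> simp [S, Function.HasUncurry.uncurry, sub_eq_neg_add]

/-- Mild solutions with smooth data and smooth nonlinearity are smooth. -/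
theorem IsMild.contDiffOn (n : ℕ) : ∀ {V : Type*} [NormedAddCommGroup V] [NormedSpace ℝ V]
    [CompleteSpace V] (_ : ∀ j, |c j| ≤ 1) {F : (J → V) → J → V} (_ : ContDiff ℝ ∞ F)
    {U₀ : ℝ → J → V} (_ : ContDiff ℝ ∞ U₀) {U : ℝ × ℝ → J → V} (_ : Continuous U) {R : ℝ}
    (_ : IsMild c (fun _ => F) U₀ U (openDiamond R)), ContDiffOn ℝ n U (openDiamond R) := by
  -- The space `V` varies in the induction: the pair `(U, U')` is a mild solution of a smooth system
  -- with values in `V × V`. Once the pair is `C^n`, so is the derivative of `U`, which is built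
  -- from `U'` and `F (U)`.
  induction n with
  | zero =>
    intro V _ _ _ _ F _ U₀ _ U hUc R _
    exact contDiffOn_zero.2 hUc.continuousOn
  | succ n ih =>
    intro V _ _ _ hc F hF U₀ hU₀ U hUc R hU
    have hF1 : ContDiff ℝ 1 F := hF.of_le (by exact_mod_cast le_top)
    have hU1 : ContDiff ℝ 1 U₀ := hU₀.of_le (by exact_mod_cast le_top)
    have hU₀' : ContDiff ℝ ∞ (deriv U₀) := (contDiff_infty_iff_deriv.1 hU₀).2
    obtain ⟨U', hU'c, hU'⟩ := exists_isMild_linearized hc hF1 hUc hU₀'.continuous R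
    -- the extended system satisfied by the solution and its space derivative
    let G : (J → V × V) → J → V × V := fun P j =>
      (F (fun i => (P i).1) j, fderiv ℝ F (fun i => (P i).1) (fun i => (P i).2) j)
    have hG : ContDiff ℝ ∞ G := by
      have h1 : ContDiff ℝ ∞ fun P : J → V × V => fun i => (P i).1 := by fun_prop
      have h2 : ContDiff ℝ ∞ fun P : J → V × V => fun i => (P i).2 := by fun_prop
      have h3 : ContDiff ℝ ∞ (fderiv ℝ F) := hF.fderiv_right (by simp)
      refine contDiff_pi.2 fun j => ContDiff.prodMk ?_ ?_
      · exact contDiff_pi.1 (hF.comp h1) j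
      · exact contDiff_pi.1 ((h3.comp h1).clm_apply h2) j
    have hP := ih (V := V × V) hc hG (U₀ := fun x j => (U₀ x j, deriv U₀ x j))
      (contDiff_pi.2 fun j => (contDiff_pi.1 hU₀ j).prodMk (contDiff_pi.1 hU₀' j))
      (U := fun z j => (U z j, U' z j)) (by fun_prop) (R := R) (by
        intro x t hz j
        have h1 := hU x t hz j
        have h2 := hU' x t hz j
        have i3 : IntervalIntegrable (fun s => G (fun i => (U (x - c j * (t - s), s) i,
            U' (x - c j * (t - s), s) i)) j) MeasureTheory.volume 0 t :=
          intervalIntegrable_characteristic (c := c) (Φ := fun z => G fun i => (U z i, U' z i))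
            (hG.continuous.comp (by fun_prop)) x t j
        have h3 := (ContinuousLinearMap.fst ℝ V V).intervalIntegral_comp_comm i3
        have h4 := (ContinuousLinearMap.snd ℝ V V).intervalIntegral_comp_comm i3
        refine Prod.ext ?_ ?_
        · exact h1.trans (congrArg _ h3)
        · exact h2.trans (congrArg _ h4))
    have hU'n : ∀ j, ContDiffOn ℝ n (fun z => U' z j) (openDiamond R) := fun j =>
      (contDiffOn_pi.1 hP j).snd
    have hUn : ContDiffOn ℝ n U (openDiamond R) :=
      contDiffOn_pi.2 fun j => (contDiffOn_pi.1 hP j).fst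
    have hFU : ∀ j, ContDiffOn ℝ n (fun z => F (U z) j) (openDiamond R) := fun j =>
      contDiffOn_pi.1 ((hF.of_le (by exact_mod_cast le_top)).comp_contDiffOn hUn) j
    refine contDiffOn_pi.2 fun j => ?_
    rw [Nat.cast_succ, contDiffOn_succ_iff_hasFDerivWithinAt_of_uniqueDiffOn
      (isOpen_openDiamond R).uniqueDiffOn]
    refine ⟨fun h => absurd h (by simp), _, ?_, fun z hz =>
      (hU.hasFDerivAt hc hF1 hU1 hUc hU'c hU' hz j).hasFDerivWithinAt⟩
    exact (contDiffOn_const.smulRight (hU'n j)).add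
      (contDiffOn_const.smulRight ((hFU j).sub ((hU'n j).const_smul (c j))))

end Regularity

/-! ### Global solutions from a priori bounds -/

/-- The part `|t| ≤ τ` of the closed diamond of radius `T + 1`. -/
def slab (T τ : ℝ) : Set (ℝ × ℝ) := diamond (T + 1) ∩ {z | |z.2| ≤ τ}

lemma isCompact_slab (T τ : ℝ) : IsCompact (slab T τ) :=
  (isCompact_diamond _).inter_right (isClosed_le (by fun_prop) continuous_const)

lemma diamond_subset_slab (T : ℝ) : diamond T ⊆ slab T T := fun z hz => by
  have hz : |z.1| + |z.2| ≤ T := hz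
  exact ⟨show |z.1| + |z.2| ≤ T + 1 by linarith, show |z.2| ≤ T by linarith [abs_nonneg z.1]⟩

section Global

variable {J V : Type*} [Fintype J] [NormedAddCommGroup V] [NormedSpace ℝ V] {c : J → ℝ}

/-- `U` solves the system `∂_t U_j + c_j ∂_x U_j = F_j(U)` on `D`. -/
def SolvesOn (c : J → ℝ) (F : (J → V) → J → V) (U : ℝ × ℝ → J → V) (D : Set (ℝ × ℝ)) : Prop :=
  ∀ z ∈ D, ∀ j, fderiv ℝ U z (c j, 1) j = F (U z) j

lemma hasDerivAt_along_characteristic {U : ℝ × ℝ → J → V} (hU : Differentiable ℝ U) (y t : ℝ)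
    (j : J) : HasDerivAt (fun s => U (y + c j * s, s) j)
      (fderiv ℝ U (y + c j * t, t) (c j, 1) j) t := by
  have h1 : HasDerivAt (fun s : ℝ => (y + c j * s, s)) (c j, 1) t := by
    refine HasDerivAt.prodMk ?_ (hasDerivAt_id t)
    simpa using ((hasDerivAt_id t).const_mul (c j)).const_add y
  exact hasDerivAt_pi.1 ((hU _).hasFDerivAt.comp_hasDerivAt t h1) j

/-- The equation is integrated along each characteristic. `Φ` may be any continuous function of the
point, so this serves both uniqueness and the estimate of the null components. -/
lemma isMild_of_fderiv_eq [CompleteSpace V] {Φ : ℝ × ℝ → J → V} {U : ℝ × ℝ → J → V}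
    {D : Set (ℝ × ℝ)} (h : ∀ z ∈ D, ∀ j, fderiv ℝ U z (c j, 1) j = Φ z j) (hΦ : Continuous Φ)
    (hU : Differentiable ℝ U) (hD : IsCausal c D) :
    IsMild c (fun z _ => Φ z) (fun x => U (x, 0)) U D := by
  intro x t hz j
  have h1 : ∀ s, x - c j * (t - s) = x - c j * t + c j * s := fun s => by ring
  have h2 := intervalIntegral.integral_eq_sub_of_hasDerivAt (a := 0) (b := t)
    (f := fun s => U (x - c j * t + c j * s, s) j)
    (f' := fun s => Φ (x - c j * (t - s), s) j) (by
      intro s hs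
      have h3 := hasDerivAt_along_characteristic (c := c) hU (x - c j * t) s j
      rwa [← h1, h _ (hD x t hz j s hs) j] at h3)
    (intervalIntegrable_characteristic (c := c) hΦ x t j)
  rw [h2]
  simp

/-- Uniqueness on compact causal sets. -/
theorem SolvesOn.eqOn [FiniteDimensional ℝ V] {F : (J → V) → J → V}
    (hF : ContDiff ℝ 1 F) {U W : ℝ × ℝ → J → V} (hU : Differentiable ℝ U)
    (hW : Differentiable ℝ W) {D : Set (ℝ × ℝ)} (hD : IsCausal c D) (hDc : IsCompact D)
    (hUD : SolvesOn c F U D) (hWD : SolvesOn c F W D)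
    (h0 : ∀ x, (x, 0) ∈ D → U (x, 0) = W (x, 0)) : EqOn U W D := by
  have := FiniteDimensional.complete ℝ V
  obtain ⟨A, hA⟩ := hDc.exists_bound_of_continuousOn hU.continuous.continuousOn
  obtain ⟨B, hB⟩ := hDc.exists_bound_of_continuousOn hW.continuous.continuousOn
  obtain ⟨r, hr⟩ := hDc.exists_bound_of_continuousOn (f := fun z : ℝ × ℝ => z.2)
    continuous_snd.continuousOn
  obtain ⟨K, hK⟩ := (hF.contDiffOn (s := Metric.closedBall 0 (max A B))).exists_lipschitzOnWith
    one_ne_zero (convex_closedBall _ _) (isCompact_closedBall _ _)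
  have hWm : IsMild c (fun z _ => F (W z)) (fun x => W (x, 0)) W D :=
    isMild_of_fderiv_eq hWD (hF.continuous.comp hW.continuous) hW hD
  have hUm : IsMild c (fun z _ => F (U z)) (fun x => U (x, 0)) U D :=
    isMild_of_fderiv_eq hUD (hF.continuous.comp hU.continuous) hU hD
  have hm := hUm.sub hWm (hF.continuous.comp hU.continuous)
    (hF.continuous.comp hW.continuous)
  intro z hz
  have h1 := hm.norm_le hD (r := r) (a := 0) (b := 0) (K := K) le_rfl le_rfl K.2 hr
    ((norm_nonneg _).trans (hr z hz))
    (hDc.exists_bound_of_continuousOn (hU.continuous.sub hW.continuous).continuousOn)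
    (fun x hx => by simp [h0 x hx]) (fun z hz => by
      rw [zero_add]
      refine hK.norm_sub_le ?_ ?_
      · rw [mem_closedBall_zero_iff]; exact (hA z hz).trans (le_max_left _ _)
      · rw [mem_closedBall_zero_iff]; exact (hB z hz).trans (le_max_right _ _)) z hz
  simp only [Pi.sub_apply, zero_mul, add_zero, mul_zero] at h1
  exact sub_eq_zero.1 (norm_le_zero_iff.1 h1)

/-- Global smooth solutions after truncating the data and the nonlinearity. -/
theorem exists_solvesOn_truncated [FiniteDimensional ℝ V] (hc : ∀ j, |c j| ≤ 1)
    {F : (J → V) → J → V} (hF : ContDiff ℝ ∞ F) {U₀ : ℝ → J → V} (hU₀ : ContDiff ℝ ∞ U₀)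
    {R M : ℝ} (hR : 0 < R) (hM : 0 < M) :
    ∃ (F' : (J → V) → J → V) (U : ℝ × ℝ → J → V), (∀ a, ‖a‖ ≤ M → F' a = F a) ∧
      ContDiff ℝ ∞ U ∧ (∀ x, |x| ≤ R → U (x, 0) = U₀ x) ∧ SolvesOn c F' U univ := by
  have := FiniteDimensional.complete ℝ V
  -- Compact support makes the truncated nonlinearity globally Lipschitz and the truncated data
  -- bounded.
  let χ : ContDiffBump (0 : J → V) := ⟨M, 2 * M, hM, by linarith⟩
  let η : ContDiffBump (0 : ℝ) := ⟨R, 2 * R, hR, by linarith⟩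
  let F' : (J → V) → J → V := fun a => χ a • F a
  let W₀ : ℝ → J → V := fun x => η x • U₀ x
  have hF' : ContDiff ℝ ∞ F' := χ.contDiff.smul hF
  have hW₀ : ContDiff ℝ ∞ W₀ := η.contDiff.smul hU₀
  have hF's : HasCompactSupport F' := χ.hasCompactSupport.smul_right
  have hW₀s : HasCompactSupport W₀ := η.hasCompactSupport.smul_right
  obtain ⟨K, hK⟩ := hF'.lipschitzWith_of_hasCompactSupport hF's (by simp)
  obtain ⟨B, hB⟩ := hW₀s.exists_bound_of_continuous hW₀.continuous
  obtain ⟨U, hUc, hU⟩ := exists_isMild c (fun _ => F') W₀ (hF'.continuous.comp continuous_snd)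
    (K := K + 1) (by positivity) (fun _ a b => (hK.norm_sub_le a b).trans (by gcongr; simp))
    (M := ‖F' 0‖) (fun _ => le_rfl) hW₀.continuous hB
  have hUs : ContDiff ℝ ∞ U := by
    refine contDiff_infty.2 fun n => contDiff_iff_contDiffAt.2 fun z => ?_
    have h1 : z ∈ openDiamond (|z.1| + |z.2| + 1) := by simp [openDiamond]
    exact (IsMild.contDiffOn n hc hF' hW₀ hUc (hU.mono (subset_univ _))).contDiffAt
      ((isOpen_openDiamond _).mem_nhds h1)
  refine ⟨F', U, fun a ha => ?_, hUs, fun x hx => ?_, fun z _ j => ?_⟩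
  · simp only [F']
    rw [χ.one_of_mem_closedBall (by simpa [χ] using ha), one_smul]
  · have h1 : W₀ x = U₀ x := by
      simp only [W₀]
      rw [η.one_of_mem_closedBall (by simpa [η] using hx), one_smul]
    rw [← h1]
    funext j
    simpa using hU x 0 (mem_univ _) j
  · have h1 := hU.hasDerivAt_characteristic hF'.continuous hUc isOpen_univ
      (y := z.1 - c j * z.2) (t := z.2) (j := j) (mem_univ _)
    have h2 := hasDerivAt_along_characteristic (c := c) (hUs.differentiable (by simp))
      (z.1 - c j * z.2) z.2 j
    have h3 := h2.unique h1
    simpa using h3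

/-- Existence on a slab, given an a priori bound there. -/
theorem exists_solvesOn_slab [FiniteDimensional ℝ V] (hc : ∀ j, |c j| ≤ 1)
    {F : (J → V) → J → V} (hF : ContDiff ℝ ∞ F) {U₀ : ℝ → J → V} (hU₀ : ContDiff ℝ ∞ U₀)
    {T : ℝ} (hT : 0 ≤ T) {M₀ : ℝ} (hM₀ : ∀ τ, 0 ≤ τ → τ ≤ T → ∀ U : ℝ × ℝ → J → V, ContDiff ℝ ∞ U →
      (∀ x, |x| ≤ T + 1 → U (x, 0) = U₀ x) → SolvesOn c F U (slab T τ) →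
        ∀ z ∈ slab T τ, ‖U z‖ ≤ M₀) :
    ∃ U : ℝ × ℝ → J → V, ContDiff ℝ ∞ U ∧ (∀ x, |x| ≤ T + 1 → U (x, 0) = U₀ x) ∧
      SolvesOn c F U (slab T T) := by
  obtain ⟨B, hB⟩ := (isCompact_Icc (a := -(T + 1)) (b := T + 1)).exists_bound_of_continuousOn
    hU₀.continuous.continuousOn
  have hB' : ∀ x, |x| ≤ T + 1 → ‖U₀ x‖ ≤ B := fun x hx => hB x (abs_le.1 hx)
  have hB0 : 0 ≤ B := (norm_nonneg _).trans (hB' 0 (by rw [abs_zero]; linarith))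
  -- The cutoff lies strictly above the a priori bound and above the data, so it could only be
  -- reached at some `|t| > 0`.
  set M := max M₀ B + 1 with hM
  have hMB : B < M := by rw [hM]; linarith [le_max_right M₀ B]
  have hMM : M₀ < M := by rw [hM]; linarith [le_max_left M₀ B]
  obtain ⟨F', U, hF', hU, hU0, hUs⟩ := exists_solvesOn_truncated hc hF hU₀ (R := T + 1) (M := M)
    (by linarith) (by linarith)
  have hle : ∀ z ∈ slab T T, ‖U z‖ < M := by
    by_contra! hcon
    obtain ⟨w, hw, hwM⟩ := hcon
    have hcpt : IsCompact (slab T T ∩ {z | M ≤ ‖U z‖}) :=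
      (isCompact_slab T T).inter_right (isClosed_le continuous_const hU.continuous.norm)
    -- A point of least `|t|` where the cutoff is reached. For smaller `|t|` the truncation is
    -- inactive, so the a priori bound `M₀ < M` holds there and, by continuity, at `z` too: a
    -- contradiction.
    obtain ⟨z, ⟨hzs, hzM⟩, hmin⟩ := hcpt.exists_isMinOn ⟨w, hw, hwM⟩
      (f := fun z : ℝ × ℝ => |z.2|) (by fun_prop)
    have hzM : M ≤ ‖U z‖ := hzM
    have hz1 : |z.1| + |z.2| ≤ T + 1 := hzs.1
    have hz2 : |z.2| ≤ T := hzs.2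
    have hz0 : 0 < |z.2| := by
      rw [abs_pos]
      intro h0
      have h1 : |z.1| ≤ T + 1 := by linarith [abs_nonneg z.2]
      have h2 : z = (z.1, 0) := Prod.ext rfl h0
      rw [h2, hU0 _ h1] at hzM
      linarith [hB' _ h1]
    have hlt : ∀ r ∈ Ioo (0 : ℝ) 1, ‖U (z.1, r * z.2)‖ ≤ M₀ := by
      intro r hr
      have h1 : |r * z.2| < |z.2| := by rw [abs_mul, abs_of_pos hr.1]; nlinarith [hr.2]
      refine hM₀ |r * z.2| (abs_nonneg _) (by linarith) U hU hU0 ?_ _ ⟨?_, le_refl |r * z.2|⟩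
      · intro y hy j
        have hy1 : |y.1| + |y.2| ≤ T + 1 := hy.1
        have hy2 : |y.2| ≤ |r * z.2| := hy.2
        rw [hUs y (mem_univ _) j, hF' (U y) ?_]
        by_contra! hcon
        have h3 := hmin ⟨⟨hy.1, show |y.2| ≤ T by linarith⟩, show M ≤ ‖U y‖ from hcon.le⟩
        have h3 : |z.2| ≤ |y.2| := h3
        linarith
      · show |z.1| + |r * z.2| ≤ T + 1
        linarith
    have hlim : Tendsto (fun r : ℝ => ‖U (z.1, r * z.2)‖) (𝓝[<] 1) (𝓝 ‖U z‖) := by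
      have : Continuous fun r : ℝ => ‖U (z.1, r * z.2)‖ := (hU.continuous.comp (by fun_prop)).norm
      have h1 := this.tendsto 1
      rw [one_mul] at h1
      exact h1.mono_left nhdsWithin_le_nhds
    have h1 : ‖U z‖ ≤ M₀ := le_of_tendsto hlim (by
      filter_upwards [Ioo_mem_nhdsLT (zero_lt_one' ℝ)] with r hr using hlt r hr)
    linarith
  refine ⟨U, hU, hU0, fun z hz j => ?_⟩
  rw [hUs z (mem_univ _) j, hF' _ (hle z hz).le]

/-- Global existence from a priori bounds on slabs. -/
theorem exists_solvesOn_univ [FiniteDimensional ℝ V] (hc : ∀ j, |c j| ≤ 1)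
    {F : (J → V) → J → V} (hF : ContDiff ℝ ∞ F) {U₀ : ℝ → J → V} (hU₀ : ContDiff ℝ ∞ U₀)
    (hbound : ∀ T, 0 ≤ T → ∃ M₀, ∀ τ, 0 ≤ τ → τ ≤ T → ∀ U : ℝ × ℝ → J → V, ContDiff ℝ ∞ U →
      (∀ x, |x| ≤ T + 1 → U (x, 0) = U₀ x) → SolvesOn c F U (slab T τ) →
        ∀ z ∈ slab T τ, ‖U z‖ ≤ M₀) :
    ∃ U : ℝ × ℝ → J → V, ContDiff ℝ ∞ U ∧ (∀ x, U (x, 0) = U₀ x) ∧ SolvesOn c F U univ := by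
  have hex : ∀ n : ℕ, ∃ U : ℝ × ℝ → J → V, ContDiff ℝ ∞ U ∧
      (∀ x : ℝ, |x| ≤ n + 1 → U (x, 0) = U₀ x) ∧ SolvesOn c F U (slab n n) := fun n => by
    obtain ⟨M₀, hM₀⟩ := hbound n n.cast_nonneg
    exact exists_solvesOn_slab hc hF hU₀ n.cast_nonneg hM₀
  choose W hW hW0 hWs using hex
  -- The smallest natural radius whose closed diamond contains `z`; larger radii give the same value
  -- by uniqueness.
  let N : ℝ × ℝ → ℕ := fun z => ⌈|z.1| + |z.2|⌉₊
  have hN : ∀ (n : ℕ) (z : ℝ × ℝ), z ∈ diamond n → W (N z) z = W n z := by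
    intro n z hz
    have h1 : N z ≤ n := Nat.ceil_le.2 hz
    have h2 : diamond (N z) ⊆ diamond n := fun y hy =>
      le_trans (show |y.1| + |y.2| ≤ N z from hy) (by exact_mod_cast h1)
    refine SolvesOn.eqOn (hF.of_le (by exact_mod_cast le_top))
      ((hW _).differentiable (by simp)) ((hW _).differentiable (by simp))
      (isCausal_diamond hc (N z)) (isCompact_diamond _)
      (fun y hy => hWs _ y (diamond_subset_slab _ hy))
      (fun y hy => hWs _ y (diamond_subset_slab _ (h2 hy))) (fun x hx => ?_)
      (show |z.1| + |z.2| ≤ N z from Nat.le_ceil _)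
    have hx1 : |x| + |(0 : ℝ)| ≤ N z := hx
    rw [abs_zero, add_zero] at hx1
    have h3 : (N z : ℝ) ≤ n := by exact_mod_cast h1
    rw [hW0 _ x (by linarith), hW0 _ x (by linarith)]
  -- `N` jumps across the boundaries of these diamonds, so near `z` the glued function is compared
  -- with the single index `N z + 1`, whose open diamond is a neighbourhood of `z`.
  have hloc : ∀ z, (fun y => W (N y) y) =ᶠ[𝓝 z] W (N z + 1) := by
    intro z
    have h1 : z ∈ openDiamond ((N z + 1 : ℕ) : ℝ) := by
      have := Nat.le_ceil (|z.1| + |z.2|)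
      show |z.1| + |z.2| < _
      push_cast
      linarith
    filter_upwards [(isOpen_openDiamond _).mem_nhds h1] with y hy
    exact hN _ y (show |y.1| + |y.2| ≤ _ from le_of_lt hy)
  refine ⟨fun z => W (N z) z, ?_, fun x => ?_, fun z _ j => ?_⟩
  · exact contDiff_iff_contDiffAt.2 fun z => (hW _).contDiffAt.congr_of_eventuallyEq (hloc z)
  · refine hW0 _ x ?_
    have := Nat.le_ceil (|x| + |(0 : ℝ)|)
    rw [abs_zero, add_zero] at this
    simp only [N, abs_zero, add_zero]
    linarith
  · have h1 := (hloc z).eq_of_nhds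
    simp only at h1 ⊢
    rw [(hloc z).fderiv_eq, h1]
    refine hWs _ z (diamond_subset_slab _ ?_) j
    have := Nat.le_ceil (|z.1| + |z.2|)
    show |z.1| + |z.2| ≤ _
    push_cast
    linarith

end Global

/-! ### Energy on shrinking slices -/

/-- The part `0 ≤ t ≤ τ` of the closed diamond of radius `T + 1`. -/
def forwardSlab (T τ : ℝ) : Set (ℝ × ℝ) := diamond (T + 1) ∩ {z | 0 ≤ z.2 ∧ z.2 ≤ τ}

lemma mem_forwardSlab {T τ x t : ℝ} :
    (x, t) ∈ forwardSlab T τ ↔ |x| + t ≤ T + 1 ∧ 0 ≤ t ∧ t ≤ τ := by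
  constructor
  · rintro ⟨h1, h2, h3⟩
    have h1 : |x| + |t| ≤ T + 1 := h1
    have h2 : 0 ≤ t := h2
    rw [abs_of_nonneg h2] at h1
    exact ⟨h1, h2, h3⟩
  · rintro ⟨h1, h2, h3⟩
    refine ⟨show |x| + |t| ≤ T + 1 by rwa [abs_of_nonneg h2], h2, h3⟩

lemma isCausal_forwardSlab {J : Type*} {c : J → ℝ} (hc : ∀ j, |c j| ≤ 1) (T τ : ℝ) :
    IsCausal c (forwardSlab T τ) := fun x t h j s hs => by
  have ht : 0 ≤ t := h.2.1
  refine ⟨isCausal_diamond hc _ x t h.1 j s hs, ?_⟩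
  rw [uIcc_of_le ht] at hs
  exact ⟨hs.1, hs.2.trans h.2.2⟩

lemma isCompact_forwardSlab (T τ : ℝ) : IsCompact (forwardSlab T τ) :=
  (isCompact_diamond _).inter_right ((isClosed_le continuous_const continuous_snd).inter
    (isClosed_le continuous_snd continuous_const))

/-- Convexity is what the Poincaré lemma in `integral_slice_le` needs. -/
lemma convex_forwardSlab (T τ : ℝ) : Convex ℝ (forwardSlab T τ) := by
  rintro ⟨x, t⟩ hz ⟨y, s⟩ hw a b ha hb hab
  rw [mem_forwardSlab] at hz hw
  simp only [Prod.smul_mk, Prod.mk_add_mk, smul_eq_mul]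
  rw [mem_forwardSlab]
  have h1 : |a * x + b * y| ≤ a * |x| + b * |y| := by
    refine (abs_add_le _ _).trans ?_
    rw [abs_mul, abs_mul, abs_of_nonneg ha, abs_of_nonneg hb]
  have hb' : b = 1 - a := by linarith
  subst hb'
  refine ⟨?_, ?_, ?_⟩ <;> nlinarith [hz.1, hz.2.1, hz.2.2, hw.1, hw.2.1, hw.2.2]

lemma fderiv_prod_apply {Y : Type*} [NormedAddCommGroup Y] [NormedSpace ℝ Y] (L : ℝ × ℝ →L[ℝ] Y)
    (a b : ℝ) : L (a, b) = a • L (1, 0) + b • L (0, 1) := by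
  rw [← map_smul, ← map_smul, ← map_add]
  simp

/-- Energy inequality: if the density `e` and the flux `f` satisfy the conservation law
`∂_t e = ∂_x f` and `|f| ≤ e`, the energy on the shrinking slices of the forward slab does not
increase. -/
theorem integral_slice_le {e f : ℝ × ℝ → ℝ} (he : Differentiable ℝ e) (hf : Differentiable ℝ f)
    {T τ : ℝ} (hτ : τ ≤ T)
    (hcons : ∀ z ∈ forwardSlab T τ, fderiv ℝ e z (0, 1) = fderiv ℝ f z (1, 0))
    (hflux : ∀ z ∈ forwardSlab T τ, |f z| ≤ e z) {t : ℝ} (ht : t ∈ Icc 0 τ) :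
    ∫ x in (-(T + 1 - t))..(T + 1 - t), e (x, t) ≤ ∫ x in (-(T + 1))..(T + 1), e (x, 0) := by
  set S := forwardSlab T τ with hS
  -- By the conservation law the one-form `e dx + f dt` is closed on the slab, hence has a potential
  -- `P`. Slice energies are differences of its boundary values, and along the right and left edges
  -- `P` changes at the rates `f - e ≤ 0` and `f + e ≥ 0`.
  let θ : ℝ × ℝ → ℝ × ℝ →L[ℝ] ℝ := fun z =>
    e z • ContinuousLinearMap.fst ℝ ℝ ℝ + f z • ContinuousLinearMap.snd ℝ ℝ ℝ
  let dθ : ℝ × ℝ → ℝ × ℝ →L[ℝ] ℝ × ℝ →L[ℝ] ℝ := fun z =>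
    (fderiv ℝ e z).smulRight (ContinuousLinearMap.fst ℝ ℝ ℝ) +
      (fderiv ℝ f z).smulRight (ContinuousLinearMap.snd ℝ ℝ ℝ)
  have hθ : ∀ z, HasFDerivAt θ (dθ z) z := fun z => by
    have h1 := (he z).hasFDerivAt.smul_const (ContinuousLinearMap.fst ℝ ℝ ℝ)
    have h2 := (hf z).hasFDerivAt.smul_const (ContinuousLinearMap.snd ℝ ℝ ℝ)
    exact h1.add h2
  obtain ⟨P, hP⟩ := (convex_forwardSlab T τ).exists_forall_hasFDerivWithinAt_of_hasFDerivWithinAt_symmetric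
    (fun z _ => (hθ z).hasFDerivWithinAt) (by
      intro a ha v _ w _
      have h1 := hcons a ha
      obtain ⟨v1, v2⟩ := v
      obtain ⟨w1, w2⟩ := w
      simp only [dθ, add_apply, ContinuousLinearMap.smulRight_apply,
        smul_apply, ContinuousLinearMap.coe_fst', ContinuousLinearMap.coe_snd',
        smul_eq_mul, fderiv_prod_apply (fderiv ℝ e a) v1, fderiv_prod_apply (fderiv ℝ e a) w1,
        fderiv_prod_apply (fderiv ℝ f a) v1, fderiv_prod_apply (fderiv ℝ f a) w1, h1]
      ring)
  have hPc : ContinuousOn P S := fun z hz => (hP z hz).continuousWithinAt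
  -- the energy on a slice as a difference of values of the potential
  have hslice : ∀ t ∈ Icc 0 τ, ∫ x in (-(T + 1 - t))..(T + 1 - t), e (x, t) =
      P (T + 1 - t, t) - P (-(T + 1 - t), t) := by
    intro t ht
    have hr : 0 ≤ T + 1 - t := by linarith [ht.2]
    have hmem : ∀ x ∈ Icc (-(T + 1 - t)) (T + 1 - t), (x, t) ∈ S := fun x hx => by
      rw [hS, mem_forwardSlab]
      exact ⟨by linarith [abs_le.2 hx], ht⟩
    refine intervalIntegral.integral_eq_sub_of_hasDerivAt_of_le (f := fun x => P (x, t))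
      (by linarith) ?_ ?_ ?_
    · exact hPc.comp (by fun_prop) hmem
    · intro x hx
      have h1 : HasDerivAt (fun x : ℝ => (x, t)) ((1 : ℝ), (0 : ℝ)) x :=
        (hasDerivAt_id x).prodMk (hasDerivAt_const x t)
      have h2 := (hP (x, t) (hmem x (Ioo_subset_Icc_self hx))).comp_hasDerivWithinAt x
        h1.hasDerivWithinAt hmem
      have h3 := h2.hasDerivAt (Icc_mem_nhds hx.1 hx.2)
      simpa [θ, Function.comp_def] using h3
    · exact (he.continuous.comp (by fun_prop)).intervalIntegrable _ _
  have hright : AntitoneOn (fun t => P (T + 1 - t, t)) (Icc 0 τ) := by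
    have hmem : ∀ t ∈ Icc 0 τ, (T + 1 - t, t) ∈ S := fun t ht => by
      rw [hS, mem_forwardSlab, abs_of_nonneg (by linarith [ht.2])]
      exact ⟨by linarith, ht⟩
    refine antitoneOn_of_hasDerivWithinAt_nonpos (convex_Icc _ _) (hPc.comp (by fun_prop) hmem)
      (f' := fun t => -e (T + 1 - t, t) + f (T + 1 - t, t)) ?_ ?_
    · intro t ht
      have h1 : HasDerivAt (fun t : ℝ => (T + 1 - t, t)) ((-1 : ℝ), (1 : ℝ)) t :=
        ((hasDerivAt_id t).const_sub (T + 1)).prodMk (hasDerivAt_id t)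
      have h2 := HasFDerivWithinAt.comp_hasDerivWithinAt (f := fun t => (T + 1 - t, t)) t
        (hP _ (hmem t (interior_subset ht))) h1.hasDerivWithinAt hmem
      simpa [θ, Function.comp_def] using h2.mono interior_subset
    · intro t ht
      have := hflux _ (hmem t (interior_subset ht))
      linarith [le_abs_self (f (T + 1 - t, t))]
  have hleft : MonotoneOn (fun t => P (-(T + 1 - t), t)) (Icc 0 τ) := by
    have hmem : ∀ t ∈ Icc 0 τ, (-(T + 1 - t), t) ∈ S := fun t ht => by
      rw [hS, mem_forwardSlab, abs_neg, abs_of_nonneg (by linarith [ht.2])]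
      exact ⟨by linarith, ht⟩
    refine monotoneOn_of_hasDerivWithinAt_nonneg (convex_Icc _ _) (hPc.comp (by fun_prop) hmem)
      (f' := fun t => e (-(T + 1 - t), t) + f (-(T + 1 - t), t)) ?_ ?_
    · intro t ht
      have h1 : HasDerivAt (fun t : ℝ => (-(T + 1 - t), t)) ((1 : ℝ), (1 : ℝ)) t := by
        have := ((hasDerivAt_id t).const_sub (T + 1)).neg.prodMk (hasDerivAt_id t)
        rwa [neg_neg] at this
      have h2 := HasFDerivWithinAt.comp_hasDerivWithinAt (f := fun t => (-(T + 1 - t), t)) t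
        (hP _ (hmem t (interior_subset ht))) h1.hasDerivWithinAt hmem
      simpa [θ, Function.comp_def] using h2.mono interior_subset
    · intro t ht
      have := hflux _ (hmem t (interior_subset ht))
      linarith [neg_abs_le (f (-(T + 1 - t), t))]
  have h0 : (0 : ℝ) ∈ Icc 0 τ := ⟨le_rfl, ht.1.trans ht.2⟩
  have h1 := hright h0 ht ht.1
  have h2 := hleft h0 ht ht.1
  have h3 := hslice 0 h0
  simp only [sub_zero] at h1 h2 h3
  rw [hslice t ht, h3]
  linarith

/-- A pointwise bound from integral bounds on a function and its derivative. -/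
lemma norm_le_of_integral_le {V : Type*} [NormedAddCommGroup V] [NormedSpace ℝ V]
    [CompleteSpace V] {h h' : ℝ → V} {φ : ℝ → ℝ} {r b I : ℝ} (hr : 1 ≤ r) (hb : 0 ≤ b)
    (hh : ∀ x, HasDerivAt h (h' x) x) (hh' : Continuous h') (hφ : Continuous φ)
    (hφ0 : ∀ x, 0 ≤ φ x) (hderiv : ∀ x ∈ Icc (-r) r, ‖h' x‖ ≤ b * φ x)
    (hsq : ∀ x, ‖h x‖ ^ 2 ≤ φ x) (hI : ∫ x in (-r)..r, φ x ≤ I) {x : ℝ} (hx : x ∈ Icc (-r) r) :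
    ‖h x‖ ≤ 1 + (b + 1) * I := by
  have hφi : ∀ a b, IntervalIntegrable φ MeasureTheory.volume a b := fun a b =>
    hφ.intervalIntegrable _ _
  have hhc : Continuous h := continuous_iff_continuousAt.2 fun x => (hh x).continuousAt
  have hosc : ∀ x ∈ Icc (-r) r, ∀ y ∈ Icc (-r) r, y ≤ x → ‖h x - h y‖ ≤ b * I := by
    intro x hx y hy hyx
    rw [← intervalIntegral.integral_eq_sub_of_hasDerivAt (fun x _ => hh x)
      (hh'.intervalIntegrable _ _)]
    have h1 : ‖∫ s in y..x, h' s‖ ≤ ∫ s in y..x, b * φ s := by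
      refine intervalIntegral.norm_integral_le_of_norm_le hyx (Eventually.of_forall fun s hs => ?_)
        ((hφi _ _).const_mul b)
      exact hderiv s ⟨hy.1.trans hs.1.le, hs.2.trans hx.2⟩
    have h2 : ∫ s in y..x, φ s ≤ ∫ s in (-r)..r, φ s :=
      intervalIntegral.integral_mono_interval hy.1 hyx hx.2
        (Eventually.of_forall fun s => hφ0 s) (hφi _ _)
    rw [intervalIntegral.integral_const_mul] at h1
    exact h1.trans (by gcongr; exact h2.trans hI)
  have hosc' : ∀ y ∈ Icc (-r) r, ‖h x - h y‖ ≤ b * I := by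
    intro y hy
    rcases le_total y x with hyx | hxy
    · exact hosc x hx y hy hyx
    · rw [norm_sub_rev]; exact hosc y hy x hx hxy
  -- The oscillation bound gives `‖h x‖ - b * I ≤ ‖h y‖ ≤ 1 + ‖h y‖ ^ 2` for every `y`. Averaging
  -- over an interval of length `2 * r ≥ 2` turns the integral bound into a pointwise one.
  have h1 : ∫ y in (-r)..r, (‖h x‖ - 1 - b * I) ≤ ∫ y in (-r)..r, φ y := by
    refine intervalIntegral.integral_mono_on (by linarith) (by simp) (hφi _ _) fun y hy => ?_
    have h2 := hosc' y hy
    have h3 := norm_sub_norm_le (h x) (h y)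
    nlinarith [hsq y, sq_nonneg (‖h y‖ - 1), norm_nonneg (h y)]
  rw [intervalIntegral.integral_const, smul_eq_mul] at h1
  have hI0 : 0 ≤ I := (intervalIntegral.integral_nonneg (by linarith) fun s _ => hφ0 s).trans hI
  by_contra! hcon
  have h4 : 0 ≤ ‖h x‖ - 1 - b * I := by nlinarith
  nlinarith

/-! ### Partial derivatives in the plane -/

section Calculus

variable {V W Y : Type*} [NormedAddCommGroup V] [NormedSpace ℝ V] [NormedAddCommGroup W]
  [NormedSpace ℝ W] [NormedAddCommGroup Y] [NormedSpace ℝ Y]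

lemma fderiv_bilinear_apply (L : V →L[ℝ] W →L[ℝ] Y) {f : ℝ × ℝ → V} {h : ℝ × ℝ → W}
    (hf : Differentiable ℝ f) (hh : Differentiable ℝ h) (z v : ℝ × ℝ) :
    fderiv ℝ (fun z => L (f z) (h z)) z v = L (f z) (fderiv ℝ h z v) + L (fderiv ℝ f z v) (h z) := by
  rw [L.fderiv_of_bilinear (hf z) (hh z)]
  simp

lemma hasDerivAt_space_slice {f : ℝ × ℝ → V} (hf : Differentiable ℝ f) (x t : ℝ) :
    HasDerivAt (fun y => f (y, t)) (fderiv ℝ f (x, t) (1, 0)) x :=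
  (hf (x, t)).hasFDerivAt.comp_hasDerivAt x ((hasDerivAt_id x).prodMk (hasDerivAt_const x t))

lemma hasDerivAt_time_slice {f : ℝ × ℝ → V} (hf : Differentiable ℝ f) (x t : ℝ) :
    HasDerivAt (fun s => f (x, s)) (fderiv ℝ f (x, t) (0, 1)) t :=
  (hf (x, t)).hasFDerivAt.comp_hasDerivAt t ((hasDerivAt_const t x).prodMk (hasDerivAt_id t))

lemma contDiff_fderiv_apply {f : ℝ × ℝ → V} (hf : ContDiff ℝ ∞ f) (v : ℝ × ℝ) :
    ContDiff ℝ ∞ fun z => fderiv ℝ f z v :=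
  (hf.fderiv_right (m := ∞) (by simp)).clm_apply contDiff_const

lemma fderiv_fderiv_comm {f : ℝ × ℝ → V} (hf : ContDiff ℝ ∞ f) (z v w : ℝ × ℝ) :
    fderiv ℝ (fun z => fderiv ℝ f z v) z w = fderiv ℝ (fun z => fderiv ℝ f z w) z v := by
  have h1 : Differentiable ℝ (fderiv ℝ f) :=
    (hf.fderiv_right (m := ∞) (by simp)).differentiable (by simp)
  have h2 : ∀ v w, fderiv ℝ (fun z => fderiv ℝ f z v) z w = fderiv ℝ (fderiv ℝ f) z w v := by
    intro v w
    rw [fderiv_clm_apply (h1 z) (differentiableAt_const v)]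
    simp
  rw [h2, h2]
  exact (hf.contDiffAt.isSymmSndFDerivAt (by
    rw [minSmoothness_of_isRCLikeNormedField]
    exact WithTop.coe_le_coe.2 (le_top (a := (2 : ℕ∞))))) w v

end Calculus

/-! ### Propagation of the constraint and conservation of energy -/

/-- The algebraic data of the field equations: a bracket `br`, a metric `g`, a skew form `P`, the
raised bracket `R`, the torsion `Q` and three coupling constants, of which `γ` is small. -/
structure FrameSystem (V : Type*) [NormedAddCommGroup V] [NormedSpace ℝ V] where
  br : V →L[ℝ] V →L[ℝ] V
  g : V →L[ℝ] V →L[ℝ] ℝ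
  P : V →L[ℝ] V →L[ℝ] ℝ
  R : V →L[ℝ] V →L[ℝ] V
  Q : V →L[ℝ] V →L[ℝ] V
  α : ℝ
  β : ℝ
  γ : ℝ
  κ : ℝ
  br_skew : ∀ X Y, br X Y = -br Y X
  jacobi : ∀ X Y Z, br X (br Y Z) = br (br X Y) Z + br Y (br X Z)
  g_symm : ∀ X Y, g X Y = g Y X
  P_skew : ∀ X Y, P X Y = -P Y X
  g_R : ∀ X Y Z, g X (R Y Z) = g (br X Y) Z
  g_Q : ∀ X Y Z, g X (Q Y Z) = -(1 / 2) * (P (br Y Z) X + P (br Z X) Y + P (br X Y) Z)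
  κ_pos : 0 < κ
  coercive : ∀ X, κ * ‖X‖ ^ 2 ≤ g X X
  small : ∀ X Y, 0 ≤ g X X + g Y Y + 2 * γ * P Y X

namespace FrameSystem

variable {V : Type*} [NormedAddCommGroup V] [NormedSpace ℝ V] (S : FrameSystem V)

/-- The lower order terms in the equation for `B`. -/
noncomputable def source (E H B : V) : V :=
  (S.R B B - S.R E E - S.R H H) + (S.α • S.Q B E - S.β • S.Q B H + S.γ • S.Q E H)

/-- The evolution equations at a point. -/
structure SolvesAt (E H B : ℝ × ℝ → V) (z : ℝ × ℝ) : Prop where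
  evol_E : fderiv ℝ E z (0, 1) = fderiv ℝ B z (1, 0) - S.br (B z) (E z)
  evol_H : fderiv ℝ H z (0, 1) = -S.br (B z) (H z)
  evol_B : fderiv ℝ B z (0, 1) = fderiv ℝ E z (1, 0) - S.source (E z) (H z) (B z)

lemma br_self (X : V) : S.br X X = 0 := by
  have h := S.br_skew X X
  have h2 : (2 : ℝ) • S.br X X = 0 := by rw [two_smul]; nth_rewrite 1 [h]; simp
  exact (smul_eq_zero.1 h2).resolve_left two_ne_zero

/-- The constraint is propagated by the evolution equations. -/
theorem constraint_of_solvesAt {E H B : ℝ × ℝ → V} (hE : ContDiff ℝ ∞ E) (hH : ContDiff ℝ ∞ H)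
    (hB : ContDiff ℝ ∞ B) {T τ : ℝ} (hsol : ∀ z ∈ forwardSlab T τ, S.SolvesAt E H B z)
    (h0 : ∀ x, |x| ≤ T + 1 → fderiv ℝ H (x, 0) (1, 0) = -S.br (E (x, 0)) (H (x, 0))) {x t : ℝ}
    (hz : |x| + t < T + 1) (ht : t ∈ Icc 0 τ) :
    fderiv ℝ H (x, t) (1, 0) = -S.br (E (x, t)) (H (x, t)) := by
  have hEd := hE.differentiable (by simp)
  have hHd := hH.differentiable (by simp)
  have hBd := hB.differentiable (by simp)
  have hHx := contDiff_fderiv_apply hH (1, 0)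
  have hHt := contDiff_fderiv_apply hH (0, 1)
  have hEH : ContDiff ℝ ∞ fun z => S.br (E z) (H z) := (S.br.contDiff.comp hE).clm_apply hH
  have hBH : ContDiff ℝ ∞ fun z => S.br (B z) (H z) := (S.br.contDiff.comp hB).clm_apply hH
  -- The defect of the constraint: for fixed `x` it solves the linear equation `∂_t Z = -[B, Z]`
  -- with zero initial value.
  let Z : ℝ × ℝ → V := fun z => fderiv ℝ H z (1, 0) + S.br (E z) (H z)
  have hZ : ContDiff ℝ ∞ Z := hHx.add hEH
  have hmem : ∀ s ∈ Icc 0 t, (x, s) ∈ forwardSlab T τ := fun s hs => by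
    rw [mem_forwardSlab]
    exact ⟨by linarith [hs.2], hs.1, hs.2.trans ht.2⟩
  have hderiv : ∀ s ∈ Icc 0 t, fderiv ℝ Z (x, s) (0, 1) = -S.br (B (x, s)) (Z (x, s)) := by
    intro s hs
    have h1 := hsol _ (hmem s hs)
    have h2 : fderiv ℝ (fun z => fderiv ℝ H z (0, 1)) (x, s) (1, 0) =
        -(S.br (B (x, s)) (fderiv ℝ H (x, s) (1, 0)) +
          S.br (fderiv ℝ B (x, s) (1, 0)) (H (x, s))) := by
      have h3 := hasDerivAt_space_slice (hHt.differentiable (by simp)) x s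
      have h4 := (hasDerivAt_space_slice (hBH.differentiable (by simp)) x s).neg
      -- The equation for `H` is differentiated in `x`, so it is needed for all nearby `y`; hence
      -- the strict inequality `|x| + t < T + 1`.
      have h5 : (fun y => fderiv ℝ H (y, s) (0, 1)) =ᶠ[𝓝 x]
          -fun y => S.br (B (y, s)) (H (y, s)) := by
        have h6 : ∀ᶠ y in 𝓝 x, |y| + s < T + 1 := by
          have : Continuous fun y : ℝ => |y| + s := by fun_prop
          exact this.continuousAt.eventually (gt_mem_nhds (by linarith [hs.2]))
        filter_upwards [h6] with y hy
        exact (hsol (y, s) (mem_forwardSlab.2 ⟨hy.le, hs.1, hs.2.trans ht.2⟩)).evol_H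
      rw [h3.unique (h4.congr_of_eventuallyEq h5), fderiv_bilinear_apply S.br hBd hHd]
    have h3 : fderiv ℝ Z (x, s) (0, 1) = fderiv ℝ (fun z => fderiv ℝ H z (1, 0)) (x, s) (0, 1) +
        fderiv ℝ (fun z => S.br (E z) (H z)) (x, s) (0, 1) := by
      rw [show Z = (fun z => fderiv ℝ H z (1, 0)) + fun z => S.br (E z) (H z) from rfl,
        fderiv_add (hHx.differentiable (by simp) _) (hEH.differentiable (by simp) _)]
      rfl
    rw [h3, fderiv_fderiv_comm hH, h2, fderiv_bilinear_apply S.br hEd hHd, h1.evol_E, h1.evol_H]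
    -- The terms `[∂_x B, H]` cancel, and the Jacobi identity combines `[[B, E], H] + [E, [B, H]]`
    -- into `[B, [E, H]]`.
    simp only [Z, map_add, map_neg, map_sub, sub_apply, S.jacobi (B (x, s)) (E (x, s))]
    abel
  have hc : Continuous fun s => S.br (B (x, s)) :=
    S.br.continuous.comp (hB.continuous.comp (by fun_prop))
  obtain ⟨K, hK⟩ := (isCompact_Icc (a := 0) (b := t)).exists_bound_of_continuousOn hc.continuousOn
  have hgr := norm_le_gronwallBound_of_norm_deriv_right_le (f := fun s => Z (x, s))
    (f' := fun s => fderiv ℝ Z (x, s) (0, 1)) (δ := 0) (K := K) (ε := 0) (a := 0) (b := t)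
    (hZ.continuous.comp (by fun_prop)).continuousOn
    (fun s _ => (hasDerivAt_time_slice (hZ.differentiable (by simp)) x s).hasDerivWithinAt)
    (by
      have := h0 x (by linarith [ht.1])
      simp [Z, this])
    (fun s hs => by
      have hs' := Ico_subset_Icc_self hs
      rw [hderiv s hs', norm_neg, add_zero]
      exact ContinuousLinearMap.le_of_opNorm_le _ (hK s hs') _) t ⟨ht.1, le_rfl⟩
  rw [gronwallBound_ε0_δ0] at hgr
  exact eq_neg_of_add_eq_zero_left (norm_le_zero_iff.1 hgr)

/-- The energy density. -/
noncomputable def energy (E H B : V) : ℝ :=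
  1 / 2 * (S.g E E + S.g H H + S.g B B) - 1 / 2 * S.γ * S.P H E

/-- The energy flux. -/
noncomputable def flux (E H B : V) : ℝ := S.g E B - 1 / 2 * S.γ * S.P H B

lemma g_self_nonneg (X : V) : 0 ≤ S.g X X :=
  (mul_nonneg S.κ_pos.le (sq_nonneg _)).trans (S.coercive X)

/-- The mixed term is odd in `X`, so smallness holds with either sign. -/
lemma small_neg (X Y : V) : 0 ≤ S.g X X + S.g Y Y - 2 * S.γ * S.P Y X := by
  have h := S.small (-X) Y
  simp only [map_neg, neg_apply, neg_neg] at h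
  linarith

/-- Energy minus or plus flux is `½ (|X|² + |H|²) - ½ γ P(H, X)` with `X = E - B` or `X = E + B`, so
smallness at the pair `(X, H)` makes it nonnegative. -/
lemma abs_flux_le (E H B : V) : |S.flux E H B| ≤ S.energy E H B := by
  have h1 := S.small_neg (E - B) H
  have h2 := S.small_neg (E + B) H
  have h3 := S.g_self_nonneg (E - B)
  have h4 := S.g_self_nonneg (E + B)
  have h5 := S.g_self_nonneg H
  simp only [map_add, map_sub, add_apply, sub_apply, S.g_symm B E] at h1 h2 h3 h4
  rw [abs_le, flux, energy]
  constructor <;> nlinarith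

/-- Half of `½ (E² + H²)` absorbs the coupling term by smallness; the other half gives the quarter.
-/
lemma le_energy (E H B : V) : S.κ / 4 * (‖E‖ ^ 2 + ‖H‖ ^ 2) ≤ S.energy E H B := by
  have h1 := S.small_neg E H
  have h2 := S.g_self_nonneg B
  have h3 := S.coercive E
  have h4 := S.coercive H
  rw [energy]
  linarith

lemma abs_bilin_le {L : V →L[ℝ] V →L[ℝ] ℝ} {X Y : V} {m : ℝ} (hX : ‖X‖ ≤ m) (hY : ‖Y‖ ≤ m) :
    |L X Y| ≤ ‖L‖ * m ^ 2 := by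
  have h0 := (norm_nonneg X).trans hX
  have := L.le_opNorm₂ X Y
  rw [Real.norm_eq_abs] at this
  refine this.trans ?_
  rw [pow_two, ← mul_assoc]
  gcongr

lemma energy_le {E H B : V} {m : ℝ} (hE : ‖E‖ ≤ m) (hH : ‖H‖ ≤ m) (hB : ‖B‖ ≤ m) :
    S.energy E H B ≤ (2 * ‖S.g‖ + |S.γ| * ‖S.P‖) * m ^ 2 := by
  have h1 := (abs_le.1 (abs_bilin_le (L := S.g) hE hE)).2
  have h2 := (abs_le.1 (abs_bilin_le (L := S.g) hH hH)).2
  have h3 := (abs_le.1 (abs_bilin_le (L := S.g) hB hB)).2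
  have h4 := abs_bilin_le (L := S.P) hH hE
  have h5 : |S.γ * S.P H E| ≤ |S.γ| * (‖S.P‖ * m ^ 2) := by rw [abs_mul]; gcongr
  have h6 := (abs_le.1 h5).1
  have h7 : 0 ≤ ‖S.g‖ * m ^ 2 := by positivity
  have h8 : 0 ≤ |S.γ| * (‖S.P‖ * m ^ 2) := by positivity
  rw [energy]
  linarith

/-- Conservation of energy. -/
lemma fderiv_energy {E H B : ℝ × ℝ → V} (hE : Differentiable ℝ E) (hH : Differentiable ℝ H)
    (hB : Differentiable ℝ B) {z : ℝ × ℝ} (hz : S.SolvesAt E H B z)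
    (hcon : fderiv ℝ H z (1, 0) = -S.br (E z) (H z)) :
    fderiv ℝ (fun z => S.energy (E z) (H z) (B z)) z (0, 1) =
      fderiv ℝ (fun z => S.flux (E z) (H z) (B z)) z (1, 0) := by
  have hd : ∀ (L : V →L[ℝ] V →L[ℝ] ℝ) {f h : ℝ × ℝ → V}, Differentiable ℝ f → Differentiable ℝ h →
      HasFDerivAt (fun z => L (f z) (h z)) (fderiv ℝ (fun z => L (f z) (h z)) z) z := by
    intro L f h hf hh
    have : Differentiable ℝ fun z => L (f z) (h z) := by fun_prop
    exact (this z).hasFDerivAt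
  have h1 := ((((hd S.g hE hE).add (hd S.g hH hH)).add (hd S.g hB hB)).const_mul (1 / 2)).sub
    ((hd S.P hH hE).const_mul (1 / 2 * S.γ))
  have h2 := (hd S.g hE hB).sub ((hd S.P hH hB).const_mul (1 / 2 * S.γ))
  have h1' : fderiv ℝ (fun z => S.energy (E z) (H z) (B z)) z = _ := h1.fderiv
  have h2' : fderiv ℝ (fun z => S.flux (E z) (H z) (B z)) z = _ := h2.fderiv
  rw [h1', h2']
  simp only [add_apply, sub_apply, smul_apply, smul_eq_mul, fderiv_bilinear_apply S.g hE hE,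
    fderiv_bilinear_apply S.g hH hH, fderiv_bilinear_apply S.g hB hB,
    fderiv_bilinear_apply S.g hE hB, fderiv_bilinear_apply S.P hH hE,
    fderiv_bilinear_apply S.P hH hB, hz.evol_E, hz.evol_H, hz.evol_B, hcon, source, map_add,
    map_sub, map_neg, map_smul, neg_apply]
  generalize fderiv ℝ E z (1, 0) = Ex
  generalize fderiv ℝ B z (1, 0) = Bx
  generalize E z = E
  generalize H z = H
  generalize B z = B
  -- By `g_R` the `R` terms cancel `g(E, [B, E])` and `g(H, [B, H])`. By `g_Q` the lowered `Q` is
  -- totally skew, so the `α` and `β` terms vanish against `B`. Through the constraint, `∂_t P(H, E)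
  -- - ∂_x P(H, B) = -2 g(B, Q(E, H))`, which with the factor `-γ / 2` cancels the `γ` term.
  simp only [S.g_symm Ex, S.g_symm Bx, S.g_symm (S.br _ _), S.g_symm (S.R _ _), S.g_symm (S.Q _ _),
    S.g_R, S.g_Q, S.br_self, S.P_skew H (S.br _ _), S.br_skew H B, S.br_skew E B,
    map_zero, map_neg, zero_apply, neg_apply]
  ring

end FrameSystem

/-! ### A priori bounds -/

namespace FrameSystem

variable {V : Type*} [NormedAddCommGroup V] [NormedSpace ℝ V] (S : FrameSystem V)

/-- The constraint on the closed forward slab. -/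
theorem constraint_forwardSlab {E H B : ℝ × ℝ → V} (hE : ContDiff ℝ ∞ E) (hH : ContDiff ℝ ∞ H)
    (hB : ContDiff ℝ ∞ B) {T τ : ℝ} (hτ : τ ≤ T)
    (hsol : ∀ z ∈ forwardSlab T τ, S.SolvesAt E H B z)
    (h0 : ∀ x, |x| ≤ T + 1 → fderiv ℝ H (x, 0) (1, 0) = -S.br (E (x, 0)) (H (x, 0)))
    {z : ℝ × ℝ} (hz : z ∈ forwardSlab T τ) :
    fderiv ℝ H z (1, 0) = -S.br (E z) (H z) := by
  obtain ⟨x, t⟩ := z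
  obtain ⟨hx, ht⟩ := mem_forwardSlab.1 hz
  -- Shrinking `x` moves the point off the slanted edges, also for `x = 0` because `t ≤ τ ≤ T`; the
  -- closed slab follows as `r` tends to 1.
  have hlt : ∀ r ∈ Ioo (0 : ℝ) 1,
      fderiv ℝ H (r * x, t) (1, 0) = -S.br (E (r * x, t)) (H (r * x, t)) := by
    intro r hr
    refine S.constraint_of_solvesAt hE hH hB hsol h0 ?_ ht
    rw [abs_mul, abs_of_pos hr.1]
    nlinarith [hr.1, hr.2, abs_nonneg x, ht.2]
  have hp : Continuous fun r : ℝ => (r * x, t) := by fun_prop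
  have c1 : Continuous fun r : ℝ => fderiv ℝ H (r * x, t) (1, 0) :=
    (contDiff_fderiv_apply hH (1, 0)).continuous.comp hp
  have c2 : Continuous fun r : ℝ => -S.br (E (r * x, t)) (H (r * x, t)) :=
    ((S.br.continuous.comp (hE.continuous.comp hp)).clm_apply (hH.continuous.comp hp)).neg
  have h1 := (c1.tendsto 1).mono_left (nhdsWithin_le_nhds (s := Iio 1))
  have h2 := (c2.tendsto 1).mono_left (nhdsWithin_le_nhds (s := Iio 1))
  have h3 : (fun r : ℝ => fderiv ℝ H (r * x, t) (1, 0)) =ᶠ[𝓝[<] 1]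
      fun r : ℝ => -S.br (E (r * x, t)) (H (r * x, t)) := by
    filter_upwards [Ioo_mem_nhdsLT (zero_lt_one' ℝ)] with r hr using hlt r hr
  have h4 := tendsto_nhds_unique (h1.congr' h3) h2
  simpa using h4

/-- The null derivatives of `B + E`: the terms not containing `H` cancel. -/
lemma g_null_add (E H B : V) : S.g (B + E) (-S.br B E - S.source E H B) =
    S.g (S.br (B + E) H) H + S.β * S.g (B + E) (S.Q B H) - S.γ * S.g (B + E) (S.Q E H) := by
  -- By `g_R`, `g(B + E, R(B, B) - R(E, E)) = -g([B, E], B + E)`, which cancels the bracket term,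
  -- and `g(B + E, Q(B, E)) = 0` by total skewness.
  simp only [source, map_add, map_sub, map_neg, map_smul, add_apply, smul_eq_mul, S.g_R, S.g_Q,
    S.br_self, S.br_skew E B, map_zero, neg_apply, zero_apply, S.g_symm (S.br B E)]
  ring

/-- The null derivatives of `B - E`: the terms not containing `H` cancel. -/
lemma g_null_sub (E H B : V) : S.g (B - E) (S.br B E - S.source E H B) =
    S.g (S.br (B - E) H) H + S.β * S.g (B - E) (S.Q B H) - S.γ * S.g (B - E) (S.Q E H) := by
  simp only [source, map_add, map_sub, map_neg, map_smul, sub_apply, smul_eq_mul, S.g_R, S.g_Q,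
    S.br_self, S.br_skew E B, map_zero, neg_apply, zero_apply, S.g_symm (S.br B E)]
  ring

/-- Every term contains `H`, so a bound `h` on `H` leaves at most quadratic growth in `X`, `B`, `E`,
the same order as `g(X, X)`. This is why Gronwall applies to the null components. -/
lemma abs_null_le {E H B X : V} {h : ℝ} (hH : ‖H‖ ≤ h) :
    |2 * (S.g (S.br X H) H + S.β * S.g X (S.Q B H) - S.γ * S.g X (S.Q E H))| ≤
      2 * (‖S.g‖ * ‖S.br‖ * h ^ 2 + (|S.β| + |S.γ|) * (‖S.g‖ * ‖S.Q‖ * h)) *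
        (1 + ‖X‖ ^ 2 + ‖B‖ ^ 2 + ‖E‖ ^ 2) := by
  have hh0 : 0 ≤ h := (norm_nonneg H).trans hH
  have hg : ∀ X Y : V, |S.g X Y| ≤ ‖S.g‖ * ‖X‖ * ‖Y‖ := fun X Y => by
    simpa using S.g.le_opNorm₂ X Y
  have hQ : ∀ Y : V, |S.g X (S.Q Y H)| ≤ ‖S.g‖ * ‖S.Q‖ * h * (‖X‖ ^ 2 + ‖Y‖ ^ 2) := by
    intro Y
    calc |S.g X (S.Q Y H)| ≤ ‖S.g‖ * ‖X‖ * ‖S.Q Y H‖ := hg _ _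
      _ ≤ ‖S.g‖ * ‖X‖ * (‖S.Q‖ * ‖Y‖ * h) := by
        gcongr
        exact (S.Q.le_opNorm₂ Y H).trans (by gcongr)
      _ = ‖S.g‖ * ‖S.Q‖ * h * (‖X‖ * ‖Y‖) := by ring
      _ ≤ ‖S.g‖ * ‖S.Q‖ * h * (‖X‖ ^ 2 + ‖Y‖ ^ 2) := by
        gcongr
        nlinarith [sq_nonneg (‖X‖ - ‖Y‖), sq_nonneg ‖X‖, sq_nonneg ‖Y‖]
  have hR : |S.g (S.br X H) H| ≤ ‖S.g‖ * ‖S.br‖ * h ^ 2 * (1 + ‖X‖ ^ 2) := by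
    calc |S.g (S.br X H) H| ≤ ‖S.g‖ * ‖S.br X H‖ * ‖H‖ := hg _ _
      _ ≤ ‖S.g‖ * (‖S.br‖ * ‖X‖ * h) * h := by
        gcongr
        exact (S.br.le_opNorm₂ X H).trans (by gcongr)
      _ = ‖S.g‖ * ‖S.br‖ * h ^ 2 * ‖X‖ := by ring
      _ ≤ ‖S.g‖ * ‖S.br‖ * h ^ 2 * (1 + ‖X‖ ^ 2) := by
        gcongr
        nlinarith [sq_nonneg (‖X‖ - 1), sq_nonneg ‖X‖]
  have h1 : |S.β * S.g X (S.Q B H)| ≤ |S.β| * (‖S.g‖ * ‖S.Q‖ * h * (‖X‖ ^ 2 + ‖B‖ ^ 2)) := by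
    rw [abs_mul]; gcongr; exact hQ B
  have h2 : |S.γ * S.g X (S.Q E H)| ≤ |S.γ| * (‖S.g‖ * ‖S.Q‖ * h * (‖X‖ ^ 2 + ‖E‖ ^ 2)) := by
    rw [abs_mul]; gcongr; exact hQ E
  have h3 : |2 * (S.g (S.br X H) H + S.β * S.g X (S.Q B H) - S.γ * S.g X (S.Q E H))| ≤
      2 * (‖S.g‖ * ‖S.br‖ * h ^ 2 * (1 + ‖X‖ ^ 2) +
        |S.β| * (‖S.g‖ * ‖S.Q‖ * h * (‖X‖ ^ 2 + ‖B‖ ^ 2)) +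
        |S.γ| * (‖S.g‖ * ‖S.Q‖ * h * (‖X‖ ^ 2 + ‖E‖ ^ 2))) := by
    rw [abs_mul, abs_two]
    gcongr
    refine (abs_sub _ _).trans (add_le_add ((abs_add_le _ _).trans ?_) h2)
    exact add_le_add hR h1
  refine h3.trans ?_
  have e1 : ‖S.g‖ * ‖S.br‖ * h ^ 2 * (1 + ‖X‖ ^ 2) ≤
      ‖S.g‖ * ‖S.br‖ * h ^ 2 * (1 + ‖X‖ ^ 2 + ‖B‖ ^ 2 + ‖E‖ ^ 2) := by
    exact mul_le_mul_of_nonneg_left (by linarith [sq_nonneg ‖B‖, sq_nonneg ‖E‖]) (by positivity)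
  have e2 : |S.β| * (‖S.g‖ * ‖S.Q‖ * h * (‖X‖ ^ 2 + ‖B‖ ^ 2)) ≤
      |S.β| * (‖S.g‖ * ‖S.Q‖ * h * (1 + ‖X‖ ^ 2 + ‖B‖ ^ 2 + ‖E‖ ^ 2)) := by
    refine mul_le_mul_of_nonneg_left (mul_le_mul_of_nonneg_left ?_ (by positivity)) (abs_nonneg _)
    linarith [sq_nonneg ‖E‖]
  have e3 : |S.γ| * (‖S.g‖ * ‖S.Q‖ * h * (‖X‖ ^ 2 + ‖E‖ ^ 2)) ≤
      |S.γ| * (‖S.g‖ * ‖S.Q‖ * h * (1 + ‖X‖ ^ 2 + ‖B‖ ^ 2 + ‖E‖ ^ 2)) := by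
    refine mul_le_mul_of_nonneg_left (mul_le_mul_of_nonneg_left ?_ (by positivity)) (abs_nonneg _)
    linarith [sq_nonneg ‖B‖]
  linarith

/-- The integral of `E² + H²` over the slices is bounded in terms of the data. -/
theorem exists_integral_bound {T : ℝ} (hT : 0 ≤ T) (m : ℝ) :
    ∃ I : ℝ, ∀ τ ≤ T, ∀ E H B : ℝ × ℝ → V, ContDiff ℝ ∞ E → ContDiff ℝ ∞ H → ContDiff ℝ ∞ B →
      (∀ z ∈ forwardSlab T τ, S.SolvesAt E H B z) →
      (∀ x, |x| ≤ T + 1 → fderiv ℝ H (x, 0) (1, 0) = -S.br (E (x, 0)) (H (x, 0))) →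
      (∀ x, |x| ≤ T + 1 → ‖E (x, 0)‖ ≤ m ∧ ‖H (x, 0)‖ ≤ m ∧ ‖B (x, 0)‖ ≤ m) →
      ∀ t ∈ Icc 0 τ, ∫ x in (-(T + 1 - t))..(T + 1 - t), (‖E (x, t)‖ ^ 2 + ‖H (x, t)‖ ^ 2) ≤ I := by
  -- The factor `4 / κ` inverts `le_energy`; the rest is the bound of `energy_le` on the data times
  -- the length `2 * (T + 1)` of the initial slice.
  refine ⟨4 / S.κ * (((2 * ‖S.g‖ + |S.γ| * ‖S.P‖) * m ^ 2) * (2 * (T + 1))), ?_⟩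
  intro τ hτ E H B hE hH hB hsol h0 hm t ht
  have hEd := hE.differentiable (by simp)
  have hHd := hH.differentiable (by simp)
  have hBd := hB.differentiable (by simp)
  have hed : Differentiable ℝ fun z => S.energy (E z) (H z) (B z) := by
    unfold energy; fun_prop
  have hfd : Differentiable ℝ fun z => S.flux (E z) (H z) (B z) := by
    unfold flux; fun_prop
  have h1 := integral_slice_le hed hfd hτ
    (fun z hz => S.fderiv_energy hEd hHd hBd (hsol z hz)
      (S.constraint_forwardSlab hE hH hB hτ hsol h0 hz))
    (fun z _ => S.abs_flux_le _ _ _) ht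
  have h2 : ∫ x in (-(T + 1))..(T + 1), S.energy (E (x, 0)) (H (x, 0)) (B (x, 0)) ≤
      ∫ _ in (-(T + 1))..(T + 1), (2 * ‖S.g‖ + |S.γ| * ‖S.P‖) * m ^ 2 := by
    refine intervalIntegral.integral_mono_on (by linarith)
      ((hed.continuous.comp (by fun_prop : Continuous fun x : ℝ => (x, (0 : ℝ)))).intervalIntegrable
        _ _) (by simp) fun x hx => ?_
    obtain ⟨m1, m2, m3⟩ := hm x (abs_le.2 hx)
    exact S.energy_le m1 m2 m3
  have hEc : Continuous fun x : ℝ => E (x, t) := hE.continuous.comp (by fun_prop)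
  have hHc : Continuous fun x : ℝ => H (x, t) := hH.continuous.comp (by fun_prop)
  have h3 : ∫ x in (-(T + 1 - t))..(T + 1 - t), S.κ / 4 * (‖E (x, t)‖ ^ 2 + ‖H (x, t)‖ ^ 2) ≤
      ∫ x in (-(T + 1 - t))..(T + 1 - t), S.energy (E (x, t)) (H (x, t)) (B (x, t)) := by
    refine intervalIntegral.integral_mono_on (by linarith [ht.2])
      (Continuous.intervalIntegrable (by fun_prop) _ _)
      ((hed.continuous.comp (by fun_prop : Continuous fun x : ℝ => (x, t))).intervalIntegrable
        _ _) fun x _ => ?_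
    exact S.le_energy _ _ _
  rw [intervalIntegral.integral_const, smul_eq_mul] at h2
  rw [intervalIntegral.integral_const_mul] at h3
  have h4 : S.κ / 4 * ∫ x in (-(T + 1 - t))..(T + 1 - t), (‖E (x, t)‖ ^ 2 + ‖H (x, t)‖ ^ 2) ≤
      ((2 * ‖S.g‖ + |S.γ| * ‖S.P‖) * m ^ 2) * (2 * (T + 1)) := by linarith
  have hκ := S.κ_pos
  rw [div_mul_eq_mul_div, le_div_iff₀ hκ]
  linarith

/-- `H` is bounded on the forward slab in terms of the data. -/
theorem exists_bound_H [CompleteSpace V] {T : ℝ} (hT : 0 ≤ T) (m : ℝ) :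
    ∃ h : ℝ, ∀ τ ≤ T, ∀ E H B : ℝ × ℝ → V, ContDiff ℝ ∞ E → ContDiff ℝ ∞ H → ContDiff ℝ ∞ B →
      (∀ z ∈ forwardSlab T τ, S.SolvesAt E H B z) →
      (∀ x, |x| ≤ T + 1 → fderiv ℝ H (x, 0) (1, 0) = -S.br (E (x, 0)) (H (x, 0))) →
      (∀ x, |x| ≤ T + 1 → ‖E (x, 0)‖ ≤ m ∧ ‖H (x, 0)‖ ≤ m ∧ ‖B (x, 0)‖ ≤ m) →
      ∀ z ∈ forwardSlab T τ, ‖H z‖ ≤ h := by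
  obtain ⟨I, hI⟩ := S.exists_integral_bound hT m
  refine ⟨1 + (‖S.br‖ + 1) * I, ?_⟩
  rintro τ hτ E H B hE hH hB hsol h0 hm ⟨x, t⟩ hz
  obtain ⟨hx, ht⟩ := mem_forwardSlab.1 hz
  have hEc : Continuous fun x : ℝ => E (x, t) := hE.continuous.comp (by fun_prop)
  have hHc : Continuous fun x : ℝ => H (x, t) := hH.continuous.comp (by fun_prop)
  -- The slab has radius `T + 1` so that the half-width `T + 1 - t` of every slice is at least 1.
  refine norm_le_of_integral_le (h := fun x => H (x, t)) (h' := fun x => fderiv ℝ H (x, t) (1, 0))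
    (φ := fun x => ‖E (x, t)‖ ^ 2 + ‖H (x, t)‖ ^ 2) (r := T + 1 - t) (b := ‖S.br‖)
    (by linarith [ht.2]) (norm_nonneg S.br)
    (fun x => hasDerivAt_space_slice (hH.differentiable (by simp)) x t)
    ((contDiff_fderiv_apply hH (1, 0)).continuous.comp (by fun_prop)) (by fun_prop)
    (fun x => by positivity) (fun y hy => ?_) (fun y => by simp)
    (hI τ hτ E H B hE hH hB hsol h0 hm t ht) (abs_le.1 (by linarith))
  have hy' : (y, t) ∈ forwardSlab T τ :=
    mem_forwardSlab.2 ⟨by linarith [abs_le.2 hy], ht⟩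
  -- By the constraint `‖∂_x H‖ ≤ ‖br‖ ‖E‖ ‖H‖`, which is at most `‖br‖` times the controlled
  -- density `‖E‖² + ‖H‖²`.
  rw [S.constraint_forwardSlab hE hH hB hτ hsol h0 hy', norm_neg]
  refine (S.br.le_opNorm₂ _ _).trans ?_
  rw [mul_assoc]
  gcongr
  nlinarith [sq_nonneg (‖E (y, t)‖ - ‖H (y, t)‖), sq_nonneg ‖E (y, t)‖, sq_nonneg ‖H (y, t)‖]

end FrameSystem

lemma fderiv_apply_component {J V : Type*} [Fintype J] [NormedAddCommGroup V] [NormedSpace ℝ V]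
    {U : ℝ × ℝ → J → V} (hU : Differentiable ℝ U) (z v : ℝ × ℝ) (j : J) :
    fderiv ℝ U z v j = fderiv ℝ (fun z => U z j) z v := by
  rw [(hasFDerivAt_pi'.1 (hU z).hasFDerivAt j).fderiv]
  rfl

namespace FrameSystem

variable {V : Type*} [NormedAddCommGroup V] [NormedSpace ℝ V] (S : FrameSystem V)

/-- All fields are bounded on the forward slab in terms of the data. -/
theorem exists_bound_forward [CompleteSpace V] {T : ℝ} (hT : 0 ≤ T) (m : ℝ) :
    ∃ M : ℝ, ∀ τ ≤ T, ∀ E H B : ℝ × ℝ → V, ContDiff ℝ ∞ E → ContDiff ℝ ∞ H → ContDiff ℝ ∞ B →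
      (∀ z ∈ forwardSlab T τ, S.SolvesAt E H B z) →
      (∀ x, |x| ≤ T + 1 → fderiv ℝ H (x, 0) (1, 0) = -S.br (E (x, 0)) (H (x, 0))) →
      (∀ x, |x| ≤ T + 1 → ‖E (x, 0)‖ ≤ m ∧ ‖H (x, 0)‖ ≤ m ∧ ‖B (x, 0)‖ ≤ m) →
      ∀ z ∈ forwardSlab T τ, ‖E z‖ ≤ M ∧ ‖H z‖ ≤ M ∧ ‖B z‖ ≤ M := by
  obtain ⟨h, hh⟩ := S.exists_bound_H hT m
  have hκ := S.κ_pos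
  -- `C` is the coefficient in `abs_null_le`, `a` bounds the null energies of the data since `‖B ±
  -- E‖ ≤ 2 * m`, and `L` is the resulting Gronwall bound divided by `κ`. The rate `4 * C / κ` comes
  -- from `hquad`.
  set C := 2 * (‖S.g‖ * ‖S.br‖ * h ^ 2 + (|S.β| + |S.γ|) * (‖S.g‖ * ‖S.Q‖ * h)) with hC
  set a := ‖S.g‖ * (2 * m) ^ 2 with ha
  set L := 2 * (a + C * T) * Real.exp (2 * (4 * C / S.κ) * T) / S.κ with hL
  refine ⟨max h (1 + L), ?_⟩
  intro τ hτ E H B hE hH hB hsol h0 hm z hz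
  have hHb := hh τ hτ E H B hE hH hB hsol h0 hm
  have hh0 : 0 ≤ h := (norm_nonneg _).trans (hHb z hz)
  have hC0 : 0 ≤ C := by positivity
  have hEd := hE.differentiable (by simp)
  have hHd := hH.differentiable (by simp)
  have hBd := hB.differentiable (by simp)
  let c : Fin 2 → ℝ := ![-1, 1]
  have hc : ∀ j, |c j| ≤ 1 := by intro j; fin_cases j <;> simp [c]
  have hD := isCausal_forwardSlab hc T τ
  have hDc := isCompact_forwardSlab T τ
  -- The squared lengths of `B + E` and `B - E`, followed along their own light rays: the
  -- derivatives of `E` and `B` in `x` drop out.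
  let W : ℝ × ℝ → Fin 2 → ℝ := fun z =>
    ![S.g (B z + E z) (B z + E z), S.g (B z - E z) (B z - E z)]
  have hW : ContDiff ℝ ∞ W := by
    refine contDiff_pi.2 fun j => ?_
    fin_cases j
    · exact (S.g.contDiff.comp (hB.add hE)).clm_apply (hB.add hE)
    · exact (S.g.contDiff.comp (hB.sub hE)).clm_apply (hB.sub hE)
  have hWd := hW.differentiable (by simp)
  let Φ : ℝ × ℝ → Fin 2 → ℝ := fun z j => fderiv ℝ W z (c j, 1) j
  have hΦ : Continuous Φ := continuous_pi fun j =>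
    (continuous_apply j).comp (contDiff_fderiv_apply hW (c j, 1)).continuous
  have hmild : IsMild c (fun z _ => Φ z) (fun x => W (x, 0)) W (forwardSlab T τ) :=
    isMild_of_fderiv_eq (fun _ _ _ => rfl) hΦ hWd hD
  have hadd : ∀ z v, fderiv ℝ (fun z => B z + E z) z v = fderiv ℝ B z v + fderiv ℝ E z v := by
    intro z v
    rw [fderiv_fun_add (hBd z) (hEd z)]; rfl
  have hsub : ∀ z v, fderiv ℝ (fun z => B z - E z) z v = fderiv ℝ B z v - fderiv ℝ E z v := by
    intro z v
    rw [fderiv_fun_sub (hBd z) (hEd z)]; rfl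
  have hΦ0 : ∀ z ∈ forwardSlab T τ, Φ z 0 = 2 * (S.g (S.br (B z + E z) (H z)) (H z) +
      S.β * S.g (B z + E z) (S.Q (B z) (H z)) - S.γ * S.g (B z + E z) (S.Q (E z) (H z))) := by
    intro z hz
    have h1 := hsol z hz
    rw [← S.g_null_add]
    show fderiv ℝ W z (-1, 1) 0 = _
    rw [fderiv_apply_component hWd]
    show fderiv ℝ (fun z => S.g (B z + E z) (B z + E z)) z (-1, 1) = _
    rw [fderiv_bilinear_apply S.g (f := fun z => B z + E z) (h := fun z => B z + E z)
      (hBd.add hEd) (hBd.add hEd), hadd,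
      S.g_symm (fderiv ℝ B z (-1, 1) + _), ← two_mul, fderiv_prod_apply (fderiv ℝ B z),
      fderiv_prod_apply (fderiv ℝ E z), h1.evol_E, h1.evol_B]
    congr 2
    module
  have hΦ1 : ∀ z ∈ forwardSlab T τ, Φ z 1 = 2 * (S.g (S.br (B z - E z) (H z)) (H z) +
      S.β * S.g (B z - E z) (S.Q (B z) (H z)) - S.γ * S.g (B z - E z) (S.Q (E z) (H z))) := by
    intro z hz
    have h1 := hsol z hz
    rw [← S.g_null_sub]
    show fderiv ℝ W z (1, 1) 1 = _
    rw [fderiv_apply_component hWd]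
    show fderiv ℝ (fun z => S.g (B z - E z) (B z - E z)) z (1, 1) = _
    rw [fderiv_bilinear_apply S.g (f := fun z => B z - E z) (h := fun z => B z - E z)
      (hBd.sub hEd) (hBd.sub hEd), hsub,
      S.g_symm (fderiv ℝ B z (1, 1) - _), ← two_mul, fderiv_prod_apply (fderiv ℝ B z),
      fderiv_prod_apply (fderiv ℝ E z), h1.evol_E, h1.evol_B]
    congr 2
    module
  -- the fields in terms of the null components
  have hnull : ∀ z, S.κ * ‖B z + E z‖ ^ 2 ≤ ‖W z‖ ∧ S.κ * ‖B z - E z‖ ^ 2 ≤ ‖W z‖ := by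
    intro z
    exact ⟨(S.coercive _).trans ((le_abs_self _).trans (norm_le_pi_norm (W z) 0)),
      (S.coercive _).trans ((le_abs_self _).trans (norm_le_pi_norm (W z) 1))⟩
  have hB2 : ∀ z, ‖B z‖ ≤ (‖B z + E z‖ + ‖B z - E z‖) / 2 := by
    intro z
    have h1 := norm_add_le (B z + E z) (B z - E z)
    rw [show B z + E z + (B z - E z) = (2 : ℝ) • B z by module, norm_smul, Real.norm_two] at h1
    linarith
  have hE2 : ∀ z, ‖E z‖ ≤ (‖B z + E z‖ + ‖B z - E z‖) / 2 := by
    intro z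
    have h1 := norm_sub_le (B z + E z) (B z - E z)
    rw [show B z + E z - (B z - E z) = (2 : ℝ) • E z by module, norm_smul, Real.norm_two] at h1
    linarith
  have hquad : ∀ z, S.κ * (‖B z + E z‖ ^ 2 + ‖B z‖ ^ 2 + ‖E z‖ ^ 2) ≤ 4 * ‖W z‖ ∧
      S.κ * (‖B z - E z‖ ^ 2 + ‖B z‖ ^ 2 + ‖E z‖ ^ 2) ≤ 4 * ‖W z‖ := by
    intro z
    obtain ⟨n1, n2⟩ := hnull z
    have q : ∀ X : V, ‖X‖ ≤ (‖B z + E z‖ + ‖B z - E z‖) / 2 →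
        S.κ * ‖X‖ ^ 2 ≤ (S.κ * ‖B z + E z‖ ^ 2 + S.κ * ‖B z - E z‖ ^ 2) / 2 := by
      intro X hX
      have h1 : ‖X‖ ^ 2 ≤ ((‖B z + E z‖ + ‖B z - E z‖) / 2) ^ 2 := by gcongr
      have h2 : ‖X‖ ^ 2 ≤ (‖B z + E z‖ ^ 2 + ‖B z - E z‖ ^ 2) / 2 := by
        nlinarith [sq_nonneg (‖B z + E z‖ - ‖B z - E z‖)]
      nlinarith
    have h1 := q _ (hB2 z)
    have h2 := q _ (hE2 z)
    constructor <;> linarith [norm_nonneg (W z)]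
  have hbound := hmild.norm_le hD (r := T) (a := a) (b := C) (K := 4 * C / S.κ) (by positivity) hC0
    (by positivity) (fun z hz => by rw [abs_of_nonneg hz.2.1]; exact hz.2.2.trans hτ) hT
    (hDc.exists_bound_of_continuousOn hW.continuous.continuousOn) (fun x hx => by
      have hx1 : |x| ≤ T + 1 := by have := (mem_forwardSlab.1 hx).1; rwa [add_zero] at this
      obtain ⟨m1, m2, m3⟩ := hm x hx1
      rw [pi_norm_le_iff_of_nonneg (by positivity)]
      intro j
      fin_cases j
      · exact abs_bilin_le ((norm_add_le _ _).trans (by linarith))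
          ((norm_add_le _ _).trans (by linarith))
      · exact abs_bilin_le ((norm_sub_le _ _).trans (by linarith))
          ((norm_sub_le _ _).trans (by linarith))) (fun z hz => by
      have hfac : ∀ q : ℝ, S.κ * q ≤ 4 * ‖W z‖ → C * (1 + q) ≤ C + 4 * C / S.κ * ‖W z‖ := by
        intro q hq
        have h1 : q ≤ 4 * ‖W z‖ / S.κ := by rw [le_div_iff₀ hκ]; linarith
        have h2 : C * q ≤ C * (4 * ‖W z‖ / S.κ) := by gcongr
        have h3 : C * (4 * ‖W z‖ / S.κ) = 4 * C / S.κ * ‖W z‖ := by ring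
        linarith
      rw [pi_norm_le_iff_of_nonneg (by positivity)]
      intro j
      fin_cases j
      · show |Φ z 0| ≤ _
        rw [hΦ0 z hz]
        refine (S.abs_null_le (hHb z hz)).trans (le_trans (le_of_eq ?_) (hfac _ (hquad z).1))
        ring
      · show |Φ z 1| ≤ _
        rw [hΦ1 z hz]
        refine (S.abs_null_le (hHb z hz)).trans (le_trans (le_of_eq ?_) (hfac _ (hquad z).2))
        ring) z hz
  have hWL : ‖W z‖ ≤ S.κ * L := by
    have h1 : Real.exp (2 * (4 * C / S.κ) * |z.2|) ≤ Real.exp (2 * (4 * C / S.κ) * T) := by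
      gcongr
      rw [abs_of_nonneg hz.2.1]
      exact hz.2.2.trans hτ
    have h2 : S.κ * L = 2 * (a + C * T) * Real.exp (2 * (4 * C / S.κ) * T) := by
      rw [hL]; field_simp
    rw [h2]
    exact hbound.trans (by gcongr)
  obtain ⟨n1, n2⟩ := hnull z
  -- The bound `1 + L` replaces a square root, since `‖X‖ ≤ 1 + ‖X‖ ^ 2`.
  have hle : ∀ X : V, S.κ * ‖X‖ ^ 2 ≤ ‖W z‖ → ‖X‖ ≤ 1 + L := by
    intro X hX
    have h1 : ‖X‖ ^ 2 ≤ L := le_of_mul_le_mul_left (hX.trans hWL) hκ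
    nlinarith [sq_nonneg (‖X‖ - 1)]
  have u1 := hle _ n1
  have u2 := hle _ n2
  exact ⟨(hE2 z).trans (by linarith [le_max_right h (1 + L)]),
    (hHb z hz).trans (le_max_left _ _), (hB2 z).trans (by linarith [le_max_right h (1 + L)])⟩

/-! ### Time reflection -/

/-- The system obtained by reversing time and the sign of `B`. -/
def reflect : FrameSystem V := { S with α := -S.α, β := -S.β }

/-- In the equations for `E` and `H` each term is odd under `t ↦ -t`, `B ↦ -B`. In the equation for
`B` the only odd terms are `Q(B, E)` and `Q(B, H)`, compensated by the signs of `α` and `β`. The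
constant `γ`, and with it smallness, is untouched. -/
lemma SolvesAt.reflect {S : FrameSystem V} {E H B : ℝ × ℝ → V} (hE : Differentiable ℝ E)
    (hH : Differentiable ℝ H) (hB : Differentiable ℝ B) {z : ℝ × ℝ}
    (h : S.SolvesAt E H B (z.1, -z.2)) :
    S.reflect.SolvesAt (fun z => E (z.1, -z.2)) (fun z => H (z.1, -z.2))
      (fun z => -B (z.1, -z.2)) z := by
  let ρ : ℝ × ℝ →L[ℝ] ℝ × ℝ :=
    (ContinuousLinearMap.fst ℝ ℝ ℝ).prod (-ContinuousLinearMap.snd ℝ ℝ ℝ)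
  have hρ : ∀ {f : ℝ × ℝ → V}, Differentiable ℝ f → HasFDerivAt (fun z : ℝ × ℝ => f (z.1, -z.2))
      ((fderiv ℝ f (z.1, -z.2)).comp ρ) z := fun hf =>
    (hf (ρ z)).hasFDerivAt.comp z ρ.hasFDerivAt
  have h01 : ρ (0, 1) = -(0, 1) := by ext <;> simp [ρ]
  have h10 : ρ (1, 0) = (1, 0) := by ext <;> simp [ρ]
  constructor
  · rw [(hρ hE).fderiv, (hρ hB).fun_neg.fderiv]
    simp only [ContinuousLinearMap.comp_apply, neg_apply, h01, h10, map_neg, h.evol_E,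
      FrameSystem.reflect]
    abel
  · rw [(hρ hH).fderiv]
    simp only [ContinuousLinearMap.comp_apply, neg_apply, h01, map_neg, h.evol_H,
      FrameSystem.reflect]
  · rw [(hρ hE).fderiv, (hρ hB).fun_neg.fderiv]
    simp only [ContinuousLinearMap.comp_apply, neg_apply, h01, h10, map_neg, h.evol_B,
      FrameSystem.reflect, source]
    module

end FrameSystem

/-! ### Diagonal form and the global Cauchy problem -/

namespace FrameSystem

variable {V : Type*} [NormedAddCommGroup V] [NormedSpace ℝ V] (S : FrameSystem V)

/-- The characteristic speeds of `B + E`, `B - E` and `H`. -/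
def speed : Fin 3 → ℝ := ![-1, 1, 0]

lemma abs_speed_le (j : Fin 3) : |speed j| ≤ 1 := by fin_cases j <;> simp [speed]

/-- The fields in diagonal form. -/
def diagonal (E H B : ℝ × ℝ → V) (z : ℝ × ℝ) : Fin 3 → V := ![B z + E z, B z - E z, H z]

/-- The nonlinearity of the diagonal system. -/
noncomputable def nonlinearity (U : Fin 3 → V) : Fin 3 → V :=
  let B := (2⁻¹ : ℝ) • (U 0 + U 1)
  let E := (2⁻¹ : ℝ) • (U 0 - U 1)
  ![-S.br B E - S.source E (U 2) B, S.br B E - S.source E (U 2) B, -S.br B (U 2)]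

lemma contDiff_nonlinearity : ContDiff ℝ ∞ S.nonlinearity := by
  have hL : ∀ (L : V →L[ℝ] V →L[ℝ] V) {f h : (Fin 3 → V) → V}, ContDiff ℝ ∞ f → ContDiff ℝ ∞ h →
      ContDiff ℝ ∞ fun U => L (f U) (h U) := fun L f h hf hh => (L.contDiff.comp hf).clm_apply hh
  have hB : ContDiff ℝ ∞ fun U : Fin 3 → V => (2⁻¹ : ℝ) • (U 0 + U 1) := by fun_prop
  have hE : ContDiff ℝ ∞ fun U : Fin 3 → V => (2⁻¹ : ℝ) • (U 0 - U 1) := by fun_prop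
  have hH : ContDiff ℝ ∞ fun U : Fin 3 → V => U 2 := by fun_prop
  have hs : ContDiff ℝ ∞ fun U : Fin 3 → V =>
      S.source ((2⁻¹ : ℝ) • (U 0 - U 1)) (U 2) ((2⁻¹ : ℝ) • (U 0 + U 1)) :=
    (((hL S.R hB hB).sub (hL S.R hE hE)).sub (hL S.R hH hH)).add
      ((((hL S.Q hB hE).const_smul _).sub ((hL S.Q hB hH).const_smul _)).add
        ((hL S.Q hE hH).const_smul _))
  refine contDiff_pi.2 fun j => ?_
  fin_cases j
  · exact (hL S.br hB hE).neg.sub hs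
  · exact (hL S.br hB hE).sub hs
  · exact (hL S.br hB hH).neg

lemma nonlinearity_diagonal (E H B : ℝ × ℝ → V) (z : ℝ × ℝ) :
    S.nonlinearity (diagonal E H B z) = ![-S.br (B z) (E z) - S.source (E z) (H z) (B z),
      S.br (B z) (E z) - S.source (E z) (H z) (B z), -S.br (B z) (H z)] := by
  have h1 : (2⁻¹ : ℝ) • (B z + E z + (B z - E z)) = B z := by module
  have h2 : (2⁻¹ : ℝ) • (B z + E z - (B z - E z)) = E z := by module
  have h0 : diagonal E H B z 0 = B z + E z := rfl
  have h3 : diagonal E H B z 1 = B z - E z := rfl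
  have h4 : diagonal E H B z 2 = H z := rfl
  simp only [nonlinearity, h0, h3, h4, h1, h2]

lemma contDiff_diagonal {E H B : ℝ × ℝ → V} (hE : ContDiff ℝ ∞ E) (hH : ContDiff ℝ ∞ H)
    (hB : ContDiff ℝ ∞ B) : ContDiff ℝ ∞ (diagonal E H B) := by
  refine contDiff_pi.2 fun j => ?_
  fin_cases j
  · exact hB.add hE
  · exact hB.sub hE
  · exact hH

/-- The evolution equations in diagonal form. -/
lemma solvesOn_diagonal_iff {E H B : ℝ × ℝ → V} (hE : ContDiff ℝ ∞ E) (hH : ContDiff ℝ ∞ H)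
    (hB : ContDiff ℝ ∞ B) {D : Set (ℝ × ℝ)} :
    SolvesOn speed S.nonlinearity (diagonal E H B) D ↔ ∀ z ∈ D, S.SolvesAt E H B z := by
  have hEd := hE.differentiable (by simp)
  have hHd := hH.differentiable (by simp)
  have hBd := hB.differentiable (by simp)
  have hd := (contDiff_diagonal hE hH hB).differentiable (by simp)
  refine forall₂_congr fun z _ => ?_
  rw [nonlinearity_diagonal]
  have c0 : fderiv ℝ (diagonal E H B) z (speed 0, 1) 0 =
      fderiv ℝ B z (0, 1) + fderiv ℝ E z (0, 1) - fderiv ℝ B z (1, 0) - fderiv ℝ E z (1, 0) := by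
    rw [fderiv_apply_component hd]
    show fderiv ℝ (fun z => B z + E z) z (-1, 1) = _
    rw [fderiv_fun_add (hBd z) (hEd z), add_apply, fderiv_prod_apply (fderiv ℝ B z),
      fderiv_prod_apply (fderiv ℝ E z)]
    module
  have c1 : fderiv ℝ (diagonal E H B) z (speed 1, 1) 1 =
      fderiv ℝ B z (0, 1) - fderiv ℝ E z (0, 1) + fderiv ℝ B z (1, 0) - fderiv ℝ E z (1, 0) := by
    rw [fderiv_apply_component hd]
    show fderiv ℝ (fun z => B z - E z) z (1, 1) = _
    rw [fderiv_fun_sub (hBd z) (hEd z), sub_apply, fderiv_prod_apply (fderiv ℝ B z),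
      fderiv_prod_apply (fderiv ℝ E z)]
    module
  have c2 : fderiv ℝ (diagonal E H B) z (speed 2, 1) 2 = fderiv ℝ H z (0, 1) := by
    rw [fderiv_apply_component hd]
    rfl
  constructor
  · intro h
    have h0 := h 0
    have h1 := h 1
    have h2 := h 2
    rw [c0] at h0
    rw [c1] at h1
    rw [c2] at h2
    simp only [Matrix.cons_val_zero, Matrix.cons_val_one, Matrix.cons_val] at h0 h1 h2
    refine ⟨?_, h2, ?_⟩
    · linear_combination (norm := module) (2⁻¹ : ℝ) • h0 - (2⁻¹ : ℝ) • h1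
    · linear_combination (norm := module) (2⁻¹ : ℝ) • h0 + (2⁻¹ : ℝ) • h1
  · intro h j
    fin_cases j
    · refine c0.trans ?_
      rw [h.evol_E, h.evol_B]
      simp only [Fin.zero_eta, Matrix.cons_val_zero]
      abel
    · refine c1.trans ?_
      rw [h.evol_E, h.evol_B]
      simp only [Fin.mk_one, Matrix.cons_val_one, Matrix.cons_val_zero]
      abel
    · exact c2.trans h.evol_H

lemma fderiv_space_comp_neg_time {f : ℝ × ℝ → V} (hf : Differentiable ℝ f) (x t : ℝ) :
    fderiv ℝ (fun z : ℝ × ℝ => f (z.1, -z.2)) (x, t) (1, 0) = fderiv ℝ f (x, -t) (1, 0) := by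
  have h : Differentiable ℝ fun z : ℝ × ℝ => f (z.1, -z.2) := hf.comp (by fun_prop)
  exact (hasDerivAt_space_slice h x t).unique (hasDerivAt_space_slice hf x (-t))

/-- The constraint holds for global solutions if it holds for the data. -/
theorem constraint_of_solvesAt_univ {E H B : ℝ × ℝ → V} (hE : ContDiff ℝ ∞ E)
    (hH : ContDiff ℝ ∞ H) (hB : ContDiff ℝ ∞ B) (hsol : ∀ z, S.SolvesAt E H B z)
    (h0 : ∀ x, fderiv ℝ H (x, 0) (1, 0) = -S.br (E (x, 0)) (H (x, 0))) (z : ℝ × ℝ) :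
    fderiv ℝ H z (1, 0) = -S.br (E z) (H z) := by
  have hT : |z.2| ≤ |z.1| + |z.2| := by linarith [abs_nonneg z.1]
  rcases le_total 0 z.2 with ht | ht
  · rw [abs_of_nonneg ht] at hT
    exact S.constraint_forwardSlab (T := |z.1| + z.2) (τ := z.2) hE hH hB hT (fun z _ => hsol z)
      (fun x _ => h0 x) (mem_forwardSlab.2 ⟨by linarith, ht, le_rfl⟩)
  · rw [abs_of_nonpos ht] at hT
    have hρ : ContDiff ℝ ∞ fun z : ℝ × ℝ => (z.1, -z.2) := by fun_prop
    have hHd := hH.differentiable (by simp)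
    have h1 := S.reflect.constraint_forwardSlab (T := |z.1| + -z.2) (τ := -z.2)
      (z := (z.1, -z.2)) (hE.comp hρ) (hH.comp hρ) (hB.comp hρ).neg hT
      (fun w _ => SolvesAt.reflect (hE.differentiable (by simp)) hHd
        (hB.differentiable (by simp)) (hsol _))
      (fun x _ => by
        have d := fderiv_space_comp_neg_time hHd x 0
        simp only [neg_zero] at d
        refine d.trans ((h0 x).trans ?_)
        simp [FrameSystem.reflect])
      (mem_forwardSlab.2 ⟨by linarith, by linarith, le_rfl⟩)
    have h2 := fderiv_space_comp_neg_time hHd z.1 (-z.2)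
    rw [neg_neg] at h2
    refine (h2.symm.trans h1).trans ?_
    simp [FrameSystem.reflect]

/-- Bounds for the fields on the two-sided slab. -/
theorem exists_bound_slab [CompleteSpace V] {T : ℝ} (hT : 0 ≤ T) (m : ℝ) :
    ∃ M : ℝ, ∀ τ ≤ T, ∀ E H B : ℝ × ℝ → V, ContDiff ℝ ∞ E → ContDiff ℝ ∞ H → ContDiff ℝ ∞ B →
      (∀ z ∈ slab T τ, S.SolvesAt E H B z) →
      (∀ x, |x| ≤ T + 1 → fderiv ℝ H (x, 0) (1, 0) = -S.br (E (x, 0)) (H (x, 0))) →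
      (∀ x, |x| ≤ T + 1 → ‖E (x, 0)‖ ≤ m ∧ ‖H (x, 0)‖ ≤ m ∧ ‖B (x, 0)‖ ≤ m) →
      ∀ z ∈ slab T τ, ‖E z‖ ≤ M ∧ ‖H z‖ ≤ M ∧ ‖B z‖ ≤ M := by
  obtain ⟨M₁, h₁⟩ := S.exists_bound_forward hT m
  obtain ⟨M₂, h₂⟩ := S.reflect.exists_bound_forward hT m
  refine ⟨max M₁ M₂, ?_⟩
  intro τ hτ E H B hE hH hB hsol h0 hm z hz
  have hz1 : |z.1| + |z.2| ≤ T + 1 := hz.1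
  have hz2 : |z.2| ≤ τ := hz.2
  rcases le_total 0 z.2 with ht | ht
  · rw [abs_of_nonneg ht] at hz1 hz2
    obtain ⟨b1, b2, b3⟩ := h₁ τ hτ E H B hE hH hB
      (fun z hz => hsol z ⟨hz.1, abs_le.2 ⟨by linarith [hz.2.1, hz.2.2], hz.2.2⟩⟩) h0 hm z
      (mem_forwardSlab.2 ⟨hz1, ht, hz2⟩)
    exact ⟨b1.trans (le_max_left _ _), b2.trans (le_max_left _ _), b3.trans (le_max_left _ _)⟩
  · rw [abs_of_nonpos ht] at hz1 hz2
    have hρ : ContDiff ℝ ∞ fun z : ℝ × ℝ => (z.1, -z.2) := by fun_prop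
    obtain ⟨b1, b2, b3⟩ := h₂ τ hτ _ _ _ (hE.comp hρ) (hH.comp hρ) (hB.comp hρ).neg
      (fun w hw => SolvesAt.reflect (hE.differentiable (by simp)) (hH.differentiable (by simp))
        (hB.differentiable (by simp)) (hsol _ (by
          refine ⟨?_, ?_⟩
          · have := hw.1
            show |w.1| + |-w.2| ≤ T + 1
            rwa [abs_neg]
          · show |-w.2| ≤ τ
            rw [abs_neg, abs_of_nonneg hw.2.1]
            exact hw.2.2)))
      (by
        intro x hx
        have d := fderiv_space_comp_neg_time (hH.differentiable (by simp)) x 0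
        simp only [neg_zero] at d
        refine d.trans ((h0 x hx).trans ?_)
        simp [FrameSystem.reflect])
      (by
        intro x hx
        simpa using hm x hx)
      (z.1, -z.2) (mem_forwardSlab.2 ⟨hz1, by linarith, hz2⟩)
    simp only [Function.comp_apply, neg_neg, Prod.mk.eta, norm_neg] at b1 b2 b3
    exact ⟨b1.trans (le_max_right _ _), b2.trans (le_max_right _ _), b3.trans (le_max_right _ _)⟩

/-- Two global smooth solutions with the same data agree. -/
theorem eq_of_solvesAt [FiniteDimensional ℝ V] {E H B E' H' B' : ℝ × ℝ → V} (hE : ContDiff ℝ ∞ E)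
    (hH : ContDiff ℝ ∞ H) (hB : ContDiff ℝ ∞ B) (hE' : ContDiff ℝ ∞ E') (hH' : ContDiff ℝ ∞ H')
    (hB' : ContDiff ℝ ∞ B') (h : ∀ z, S.SolvesAt E H B z) (h' : ∀ z, S.SolvesAt E' H' B' z)
    (h0 : ∀ x, E (x, 0) = E' (x, 0) ∧ H (x, 0) = H' (x, 0) ∧ B (x, 0) = B' (x, 0)) :
    E = E' ∧ H = H' ∧ B = B' := by
  have key : ∀ z, diagonal E H B z = diagonal E' H' B' z := by
    intro z
    refine SolvesOn.eqOn (c := speed) (S.contDiff_nonlinearity.of_le (by exact_mod_cast le_top))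
      ((contDiff_diagonal hE hH hB).differentiable (by simp))
      ((contDiff_diagonal hE' hH' hB').differentiable (by simp))
      (isCausal_diamond abs_speed_le (|z.1| + |z.2|)) (isCompact_diamond _)
      ((S.solvesOn_diagonal_iff hE hH hB).2 fun z _ => h z)
      ((S.solvesOn_diagonal_iff hE' hH' hB').2 fun z _ => h' z) (fun x _ => ?_)
      (show |z.1| + |z.2| ≤ _ from le_rfl)
    obtain ⟨e1, e2, e3⟩ := h0 x
    simp only [diagonal, e1, e2, e3]
  have k : ∀ z, E z = E' z ∧ H z = H' z ∧ B z = B' z := by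
    intro z
    have k0 : B z + E z = B' z + E' z := congrFun (key z) 0
    have k1 : B z - E z = B' z - E' z := congrFun (key z) 1
    have k2 : H z = H' z := congrFun (key z) 2
    refine ⟨?_, k2, ?_⟩
    · linear_combination (norm := module) (2⁻¹ : ℝ) • k0 - (2⁻¹ : ℝ) • k1
    · linear_combination (norm := module) (2⁻¹ : ℝ) • k0 + (2⁻¹ : ℝ) • k1
  exact ⟨funext fun z => (k z).1, funext fun z => (k z).2.1, funext fun z => (k z).2.2⟩

/-- Global existence and propagation of the constraint. -/
theorem exists_global [FiniteDimensional ℝ V] {E₀ H₀ B₀ : ℝ → V} (hE₀ : ContDiff ℝ ∞ E₀)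
    (hH₀ : ContDiff ℝ ∞ H₀) (hB₀ : ContDiff ℝ ∞ B₀)
    (hcon : ∀ x, deriv H₀ x = -S.br (E₀ x) (H₀ x)) :
    ∃ E H B : ℝ × ℝ → V, ContDiff ℝ ∞ E ∧ ContDiff ℝ ∞ H ∧ ContDiff ℝ ∞ B ∧
      (∀ z, S.SolvesAt E H B z) ∧
      (∀ x, E (x, 0) = E₀ x ∧ H (x, 0) = H₀ x ∧ B (x, 0) = B₀ x) ∧
      ∀ z, fderiv ℝ H z (1, 0) = -S.br (E z) (H z) := by
  have := FiniteDimensional.complete ℝ V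
  let U₀ : ℝ → Fin 3 → V := fun x => ![B₀ x + E₀ x, B₀ x - E₀ x, H₀ x]
  have hU₀ : ContDiff ℝ ∞ U₀ := by
    refine contDiff_pi.2 fun j => ?_
    fin_cases j
    · exact hB₀.add hE₀
    · exact hB₀.sub hE₀
    · exact hH₀
  let fE : (ℝ × ℝ → Fin 3 → V) → ℝ × ℝ → V := fun U z => (2⁻¹ : ℝ) • (U z 0 - U z 1)
  let fB : (ℝ × ℝ → Fin 3 → V) → ℝ × ℝ → V := fun U z => (2⁻¹ : ℝ) • (U z 0 + U z 1)
  let fH : (ℝ × ℝ → Fin 3 → V) → ℝ × ℝ → V := fun U z => U z 2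
  have hf : ∀ U : ℝ × ℝ → Fin 3 → V, ContDiff ℝ ∞ U →
      ContDiff ℝ ∞ (fE U) ∧ ContDiff ℝ ∞ (fH U) ∧ ContDiff ℝ ∞ (fB U) := by
    intro U hU
    have hc := contDiff_pi.1 hU
    exact ⟨((hc 0).sub (hc 1)).const_smul _, hc 2, ((hc 0).add (hc 1)).const_smul _⟩
  have hdiag : ∀ U, diagonal (fE U) (fH U) (fB U) = U := by
    intro U
    funext z j
    fin_cases j
    · show (2⁻¹ : ℝ) • (U z 0 + U z 1) + (2⁻¹ : ℝ) • (U z 0 - U z 1) = U z 0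
      module
    · show (2⁻¹ : ℝ) • (U z 0 + U z 1) - (2⁻¹ : ℝ) • (U z 0 - U z 1) = U z 1
      module
    · rfl
  have hinit : ∀ (U : ℝ × ℝ → Fin 3 → V) x, U (x, 0) = U₀ x →
      fE U (x, 0) = E₀ x ∧ fH U (x, 0) = H₀ x ∧ fB U (x, 0) = B₀ x := by
    intro U x hx
    refine ⟨?_, ?_, ?_⟩
    · show (2⁻¹ : ℝ) • (U (x, 0) 0 - U (x, 0) 1) = E₀ x
      rw [hx]
      show (2⁻¹ : ℝ) • ((B₀ x + E₀ x) - (B₀ x - E₀ x)) = E₀ x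
      module
    · show U (x, 0) 2 = H₀ x
      rw [hx]
      rfl
    · show (2⁻¹ : ℝ) • (U (x, 0) 0 + U (x, 0) 1) = B₀ x
      rw [hx]
      show (2⁻¹ : ℝ) • ((B₀ x + E₀ x) + (B₀ x - E₀ x)) = B₀ x
      module
  obtain ⟨U, hU, hU0, hUs⟩ := exists_solvesOn_univ abs_speed_le S.contDiff_nonlinearity hU₀ (by
    intro T hT
    obtain ⟨m1, hm1⟩ := (isCompact_Icc (a := -(T + 1)) (b := T + 1)).exists_bound_of_continuousOn
      hE₀.continuous.continuousOn
    obtain ⟨m2, hm2⟩ := (isCompact_Icc (a := -(T + 1)) (b := T + 1)).exists_bound_of_continuousOn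
      hH₀.continuous.continuousOn
    obtain ⟨m3, hm3⟩ := (isCompact_Icc (a := -(T + 1)) (b := T + 1)).exists_bound_of_continuousOn
      hB₀.continuous.continuousOn
    obtain ⟨M, hM⟩ := S.exists_bound_slab hT (max m1 (max m2 m3))
    refine ⟨2 * M, fun τ hτ0 hτ U hU hU0 hUs => ?_⟩
    obtain ⟨sE, sH, sB⟩ := hf U hU
    have hb := hM τ hτ (fE U) (fH U) (fB U) sE sH sB
      ((S.solvesOn_diagonal_iff sE sH sB).1 (by rwa [hdiag])) (by
        intro x hx
        have hx' := abs_le.1 hx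
        have e : ∀ y ∈ Icc (-(T + 1)) (T + 1), fH U (y, 0) = H₀ y := fun y hy =>
          (hinit U y (hU0 y (abs_le.2 hy))).2.1
        -- The solution has the prescribed data only on `[-(T + 1), T + 1]`, so the derivatives of
        -- `H` are compared within this interval; this covers the endpoints.
        have d1 := (hasDerivAt_space_slice (sH.differentiable (by simp)) x 0).hasDerivWithinAt
          (s := Icc (-(T + 1)) (T + 1))
        have d2 := ((hH₀.differentiable (by simp) x).hasDerivAt.hasDerivWithinAt
          (s := Icc (-(T + 1)) (T + 1))).congr e (e x hx')
        rw [(uniqueDiffOn_Icc (by linarith) x hx').eq_deriv _ d1 d2, hcon,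
          (hinit U x (hU0 x hx)).1, e x hx']) (by
        intro x hx
        obtain ⟨e1, e2, e3⟩ := hinit U x (hU0 x hx)
        rw [e1, e2, e3]
        have hx' := abs_le.1 hx
        exact ⟨(hm1 x hx').trans (le_max_left _ _),
          (hm2 x hx').trans ((le_max_left _ _).trans (le_max_right _ _)),
          (hm3 x hx').trans ((le_max_right _ _).trans (le_max_right _ _))⟩)
    intro z hz
    obtain ⟨b1, b2, b3⟩ := hb z hz
    have hM0 : 0 ≤ M := (norm_nonneg _).trans b1
    rw [← hdiag U, pi_norm_le_iff_of_nonneg (by positivity)]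
    intro j
    fin_cases j
    · exact (norm_add_le _ _).trans (by linarith)
    · exact (norm_sub_le _ _).trans (by linarith)
    · exact b2.trans (by linarith))
  obtain ⟨sE, sH, sB⟩ := hf U hU
  have hsol : ∀ z, S.SolvesAt (fE U) (fH U) (fB U) z := fun z =>
    (S.solvesOn_diagonal_iff sE sH sB).1 (by rwa [hdiag]) z (mem_univ z)
  have hi : ∀ x, fE U (x, 0) = E₀ x ∧ fH U (x, 0) = H₀ x ∧ fB U (x, 0) = B₀ x := fun x =>
    hinit U x (hU0 x)
  refine ⟨fE U, fH U, fB U, sE, sH, sB, hsol, hi,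
    S.constraint_of_solvesAt_univ sE sH sB hsol fun x => ?_⟩
  have d1 := hasDerivAt_space_slice (sH.differentiable (by simp)) x 0
  have d2 := (hH₀.differentiable (by simp) x).hasDerivAt
  rw [show (fun y => fH U (y, 0)) = H₀ from funext fun y => (hi y).2.1] at d1
  rw [d1.unique d2, hcon, (hi x).1, (hi x).2.1]

end FrameSystem

/-! ### From tensor components to a frame system -/

section TensorAlgebra

lemma structureTensor_skew {ι 𝔤 : Type*} [LieRing 𝔤] [LieAlgebra ℝ 𝔤] (e : Module.Basis ι ℝ 𝔤)
    (b c a : ι) : structureTensor e b c a = -structureTensor e c b a := by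
  rw [structureTensor, structureTensor, ← lie_skew, map_neg, Finsupp.neg_apply]

variable {ι : Type*} [Fintype ι]

/-- The contraction with a tensor as a continuous bilinear map. -/
noncomputable def contractCLM (T : ι → ι → ι → ℝ) : (ι → ℝ) →L[ℝ] (ι → ℝ) →L[ℝ] ι → ℝ :=
  LinearMap.toContinuousLinearMap (LinearMap.toContinuousLinearMap.toLinearMap ∘ₗ
    LinearMap.mk₂ ℝ (contract T)
      (fun X X' Y => by
        funext a
        simp only [contract, Pi.add_apply, ← Finset.sum_add_distrib]
        exact Finset.sum_congr rfl fun b _ => Finset.sum_congr rfl fun c _ => by ring)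
      (fun k X Y => by
        funext a
        simp only [contract, Pi.smul_apply, smul_eq_mul, Finset.mul_sum]
        exact Finset.sum_congr rfl fun b _ => Finset.sum_congr rfl fun c _ => by ring)
      (fun X Y Y' => by
        funext a
        simp only [contract, Pi.add_apply, ← Finset.sum_add_distrib]
        exact Finset.sum_congr rfl fun b _ => Finset.sum_congr rfl fun c _ => by ring)
      (fun k X Y => by
        funext a
        simp only [contract, Pi.smul_apply, smul_eq_mul, Finset.mul_sum]
        exact Finset.sum_congr rfl fun b _ => Finset.sum_congr rfl fun c _ => by ring))

lemma contractCLM_apply (T : ι → ι → ι → ℝ) (X Y : ι → ℝ) : contractCLM T X Y = contract T X Y :=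
  rfl

/-- A quadratic form as a continuous bilinear map. -/
noncomputable def pairingCLM (S : Matrix ι ι ℝ) : (ι → ℝ) →L[ℝ] (ι → ℝ) →L[ℝ] ℝ :=
  LinearMap.toContinuousLinearMap (LinearMap.toContinuousLinearMap.toLinearMap ∘ₗ
    LinearMap.mk₂ ℝ (pairing S)
      (fun X X' Y => by
        simp only [pairing, Pi.add_apply, ← Finset.sum_add_distrib]
        exact Finset.sum_congr rfl fun b _ => Finset.sum_congr rfl fun c _ => by ring)
      (fun k X Y => by
        simp only [pairing, Pi.smul_apply, smul_eq_mul, Finset.mul_sum]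
        exact Finset.sum_congr rfl fun b _ => Finset.sum_congr rfl fun c _ => by ring)
      (fun X Y Y' => by
        simp only [pairing, Pi.add_apply, ← Finset.sum_add_distrib]
        exact Finset.sum_congr rfl fun b _ => Finset.sum_congr rfl fun c _ => by ring)
      (fun k X Y => by
        simp only [pairing, Pi.smul_apply, smul_eq_mul, Finset.mul_sum]
        exact Finset.sum_congr rfl fun b _ => Finset.sum_congr rfl fun c _ => by ring))

lemma pairingCLM_apply (S : Matrix ι ι ℝ) (X Y : ι → ℝ) : pairingCLM S X Y = pairing S X Y := rfl

lemma pairing_eq_dotProduct (S : Matrix ι ι ℝ) (X Y : ι → ℝ) :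
    pairing S X Y = X ⬝ᵥ (S.mulVec Y) := by
  simp only [pairing, dotProduct, Matrix.mulVec, Finset.mul_sum]
  exact Finset.sum_congr rfl fun b _ => Finset.sum_congr rfl fun c _ => by ring

lemma pairing_transpose (S : Matrix ι ι ℝ) (X Y : ι → ℝ) :
    pairing S.transpose X Y = pairing S Y X := by
  simp only [pairing, Matrix.transpose_apply]
  rw [Finset.sum_comm]
  exact Finset.sum_congr rfl fun a _ => Finset.sum_congr rfl fun b _ => by ring

/-- Contraction after multiplication of the first index by a matrix. -/
lemma contract_mul (M : Matrix ι ι ℝ) (T : ι → ι → ι → ℝ) (X Y : ι → ℝ) :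
    contract (fun a b c => ∑ d, M a d * T d b c) X Y = M.mulVec (contract T X Y) := by
  funext a
  simp only [contract, Matrix.mulVec, dotProduct, Finset.mul_sum, Finset.sum_mul]
  symm
  rw [Finset.sum_comm]
  refine Finset.sum_congr rfl fun b _ => ?_
  rw [Finset.sum_comm]
  exact Finset.sum_congr rfl fun c _ => Finset.sum_congr rfl fun d _ => by ring

/-- A cyclic relabelling of a trilinear form, which moves a distinguished argument of the raised
tensor and of the torsion to the front. -/
lemma dotProduct_contract_rotate (T : ι → ι → ι → ℝ) (X Y Z : ι → ℝ) :
    X ⬝ᵥ contract (fun d b c => T b c d) Y Z = Y ⬝ᵥ contract T Z X := by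
  simp only [contract, dotProduct, Finset.mul_sum]
  rw [Finset.sum_comm]
  refine Finset.sum_congr rfl fun b _ => ?_
  rw [Finset.sum_comm]
  exact Finset.sum_congr rfl fun c _ => Finset.sum_congr rfl fun d _ => by ring

/-- A positive definite form dominates a multiple of the squared norm. -/
lemma exists_pos_mul_sq_le_pairing {g : Matrix ι ι ℝ} (hg : g.PosDef) :
    ∃ κ : ℝ, 0 < κ ∧ ∀ X : ι → ℝ, κ * ‖X‖ ^ 2 ≤ pairing g X X := by
  have hpos : ∀ X : ι → ℝ, X ≠ 0 → 0 < pairing g X X := by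
    intro X hX
    rw [pairing_eq_dotProduct]
    simpa using hg.dotProduct_mulVec_pos hX
  have hc : Continuous fun X : ι → ℝ => pairing g X X := by
    unfold pairing; fun_prop
  -- An empty sphere means that the space is trivial; otherwise the constant is the minimum of the
  -- form on the sphere.
  rcases (Metric.sphere (0 : ι → ℝ) 1).eq_empty_or_nonempty with h | h
  · refine ⟨1, one_pos, fun X => ?_⟩
    have hX : X = 0 := by
      by_contra hX
      have : ‖X‖⁻¹ • X ∈ Metric.sphere (0 : ι → ℝ) 1 := by
        rw [mem_sphere_zero_iff_norm, norm_smul, norm_inv, norm_norm,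
          inv_mul_cancel₀ (norm_ne_zero_iff.2 hX)]
      rw [h] at this
      exact this
    subst hX
    simp [pairing]
  · obtain ⟨X₀, hX₀, hmin⟩ := (isCompact_sphere (0 : ι → ℝ) 1).exists_isMinOn h hc.continuousOn
    have hX₀' : X₀ ≠ 0 := by
      rintro rfl
      simp at hX₀
    refine ⟨pairing g X₀ X₀, hpos _ hX₀', fun X => ?_⟩
    by_cases hX : X = 0
    · subst hX
      simp [pairing]
    · have hn : ‖X‖ ≠ 0 := norm_ne_zero_iff.2 hX
      have h1 : ‖X‖⁻¹ • X ∈ Metric.sphere (0 : ι → ℝ) 1 := by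
        rw [mem_sphere_zero_iff_norm, norm_smul, norm_inv, norm_norm, inv_mul_cancel₀ hn]
      have h2 : pairing g X₀ X₀ ≤ pairing g (‖X‖⁻¹ • X) (‖X‖⁻¹ • X) := hmin h1
      have h3 : pairing g (‖X‖⁻¹ • X) (‖X‖⁻¹ • X) = ‖X‖⁻¹ * ‖X‖⁻¹ * pairing g X X := by
        simp only [pairing, Pi.smul_apply, smul_eq_mul, Finset.mul_sum]
        exact Finset.sum_congr rfl fun b _ => Finset.sum_congr rfl fun c _ => by ring
      rw [h3] at h2
      calc pairing g X₀ X₀ * ‖X‖ ^ 2 ≤ ‖X‖⁻¹ * ‖X‖⁻¹ * pairing g X X * ‖X‖ ^ 2 := by gcongr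
        _ = pairing g X X := by field_simp

/-- The commutator term computes the Lie bracket in the basis `e`. -/
lemma equivFun_symm_lieTerm {𝔤 : Type*} [LieRing 𝔤] [LieAlgebra ℝ 𝔤] (e : Module.Basis ι ℝ 𝔤)
    (X Y : ι → ℝ) : e.equivFun.symm (lieTerm (structureTensor e) X Y) =
      ⁅e.equivFun.symm X, e.equivFun.symm Y⁆ := by
  apply e.equivFun.injective
  rw [LinearEquiv.apply_symm_apply]
  funext a
  rw [e.equivFun_symm_apply X, e.equivFun_symm_apply Y, sum_lie]
  simp only [lie_sum, smul_lie, lie_smul, map_sum, map_smul, Finset.sum_apply,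
    Pi.smul_apply, smul_eq_mul, Module.Basis.equivFun_apply, lieTerm, structureTensor]
  exact Finset.sum_congr rfl fun b _ => Finset.sum_congr rfl fun c _ => by ring

lemma lieTerm_skew {𝔤 : Type*} [LieRing 𝔤] [LieAlgebra ℝ 𝔤] (e : Module.Basis ι ℝ 𝔤)
    (X Y : ι → ℝ) : lieTerm (structureTensor e) X Y = -lieTerm (structureTensor e) Y X := by
  apply e.equivFun.symm.injective
  rw [map_neg, equivFun_symm_lieTerm, equivFun_symm_lieTerm, lie_skew]

lemma lieTerm_jacobi {𝔤 : Type*} [LieRing 𝔤] [LieAlgebra ℝ 𝔤] (e : Module.Basis ι ℝ 𝔤)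
    (X Y Z : ι → ℝ) : lieTerm (structureTensor e) X (lieTerm (structureTensor e) Y Z) =
      lieTerm (structureTensor e) (lieTerm (structureTensor e) X Y) Z +
        lieTerm (structureTensor e) Y (lieTerm (structureTensor e) X Z) := by
  apply e.equivFun.symm.injective
  simp only [map_add, equivFun_symm_lieTerm]
  exact leibniz_lie _ _ _

variable [DecidableEq ι]

/-- Lowering an index which was raised with `g⁻¹`. -/
lemma pairing_inv_mulVec {g : Matrix ι ι ℝ} (hg : g.PosDef) (X w : ι → ℝ) :
    pairing g X (g⁻¹.mulVec w) = X ⬝ᵥ w := by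
  rw [pairing_eq_dotProduct, Matrix.mulVec_mulVec,
    Matrix.mul_nonsing_inv _ ((Matrix.isUnit_iff_isUnit_det _).1 hg.isUnit), Matrix.one_mulVec]

/-- Lowering the first index cancels `g⁻¹` and leaves `C_{db}{}^e g_{ec} X^d Y^b Z^c`. -/
lemma pairing_contract_raisedTensor (C : ι → ι → ι → ℝ) {g : Matrix ι ι ℝ} (hg : g.PosDef)
    (X Y Z : ι → ℝ) :
    pairing g X (contract (raisedTensor C g) Y Z) = pairing g (lieTerm C X Y) Z := by
  have h1 : raisedTensor C g = fun a b c => ∑ d, g⁻¹ a d * ∑ e, C d b e * g e c := by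
    funext a b c
    simp only [raisedTensor, Finset.mul_sum, mul_assoc]
  have h2 : (fun c d b => ∑ e, C d b e * g e c) =
      fun c d b => ∑ e, g.transpose c e * (fun e d b => C d b e) e d b := by
    funext c d b
    exact Finset.sum_congr rfl fun e _ => mul_comm _ _
  rw [h1, contract_mul, pairing_inv_mulVec hg,
    ← dotProduct_contract_rotate (fun d b c => ∑ e, C d b e * g e c) Z X Y, h2, contract_mul,
    ← pairing_eq_dotProduct, pairing_transpose]
  rfl

/-- Skewness of `C` makes the six terms of the antisymmetrization coincide in pairs, leaving the
cyclic sum with weight `1 / 3`; the factor `-3 / 2` turns this into `-1 / 2`. -/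
lemma pairing_contract_torsionTensor {C : ι → ι → ι → ℝ} (hC : ∀ b c a, C b c a = -C c b a)
    {g : Matrix ι ι ℝ} (hg : g.PosDef) (p : Matrix ι ι ℝ) (X Y Z : ι → ℝ) :
    pairing g X (contract (torsionTensor C g p) Y Z) = -(1 / 2) * (pairing p (lieTerm C Y Z) X +
      pairing p (lieTerm C Z X) Y + pairing p (lieTerm C X Y) Z) := by
  set T : ι → ι → ι → ℝ := fun d b c => ∑ e, p e d * C b c e with hT
  have hskew : ∀ d b c, T d c b = -T d b c := by
    intro d b c
    simp only [hT, ← Finset.sum_neg_distrib]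
    exact Finset.sum_congr rfl fun e _ => by rw [hC c b]; ring
  have hTp : ∀ X Y Z, X ⬝ᵥ contract T Y Z = pairing p (lieTerm C Y Z) X := by
    intro X Y Z
    rw [show T = fun d b c => ∑ e, p.transpose d e * (fun e b c => C b c e) e b c from rfl,
      contract_mul, ← pairing_eq_dotProduct, pairing_transpose]
    rfl
  have h1 : torsionTensor C g p = fun a b c => ∑ d, g⁻¹ a d *
      (-(1 / 2) * (T d b c + T b c d + T c d b)) := by
    funext a b c
    simp only [torsionTensor, antisymmetrize, Finset.mul_sum]
    refine Finset.sum_congr rfl fun d _ => ?_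
    rw [show (∑ e, p e d * C b c e) = T d b c from rfl, show (∑ e, p e b * C c d e) = T b c d from rfl,
      show (∑ e, p e c * C d b e) = T c d b from rfl, show (∑ e, p e b * C d c e) = T b d c from rfl,
      show (∑ e, p e d * C c b e) = T d c b from rfl, show (∑ e, p e c * C b d e) = T c b d from rfl,
      hskew d b c, hskew b c d, hskew c d b]
    ring
  have h2 : contract (fun d b c => -(1 / 2) * (T d b c + T b c d + T c d b)) Y Z =
      (-(1 / 2) : ℝ) • (contract T Y Z + contract (fun d b c => T b c d) Y Z +
        contract (fun d b c => T c d b) Y Z) := by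
    funext a
    simp only [contract, Pi.smul_apply, Pi.add_apply, smul_eq_mul, ← Finset.sum_add_distrib,
      Finset.mul_sum]
    exact Finset.sum_congr rfl fun b _ => Finset.sum_congr rfl fun c _ => by ring
  rw [h1, contract_mul, pairing_inv_mulVec hg, h2, dotProduct_smul, dotProduct_add, dotProduct_add,
    hTp, dotProduct_contract_rotate T, hTp,
    dotProduct_contract_rotate (fun d b c => T b c d), dotProduct_contract_rotate T, hTp,
    smul_eq_mul]

/-- The frame system of the field equations. -/
noncomputable def frameSystem {𝔤 : Type*} [LieRing 𝔤] [LieAlgebra ℝ 𝔤] (e : Module.Basis ι ℝ 𝔤)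
    {g : Matrix ι ι ℝ} (hg : g.PosDef) {p : Matrix ι ι ℝ} (hp : p.transpose = -p)
    (vt vx vy lam : ℝ) (hlam : SmallCoupling g p vt lam) : FrameSystem (ι → ℝ) where
  br := contractCLM fun a b c => structureTensor e b c a
  g := pairingCLM g
  P := pairingCLM p
  R := contractCLM (raisedTensor (structureTensor e) g)
  Q := contractCLM (torsionTensor (structureTensor e) g p)
  α := lam * vy
  β := lam * vx
  γ := lam * vt
  κ := (exists_pos_mul_sq_le_pairing hg).choose
  br_skew X Y := lieTerm_skew e X Y
  jacobi X Y Z := lieTerm_jacobi e X Y Z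
  g_symm X Y := by
    have h := hg.isHermitian
    rw [Matrix.IsHermitian, Matrix.conjTranspose_eq_transpose_of_trivial] at h
    simp only [pairingCLM_apply]
    rw [← pairing_transpose, h]
  P_skew X Y := by
    simp only [pairingCLM_apply]
    rw [← pairing_transpose, hp]
    simp [pairing]
  g_R X Y Z := pairing_contract_raisedTensor _ hg X Y Z
  g_Q X Y Z := pairing_contract_torsionTensor (structureTensor_skew e) hg p X Y Z
  κ_pos := (exists_pos_mul_sq_le_pairing hg).choose_spec.1
  coercive := (exists_pos_mul_sq_le_pairing hg).choose_spec.2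
  small X Y := by
    obtain ⟨k, hk, h⟩ := hlam
    obtain ⟨κ, hκ, hc⟩ := exists_pos_mul_sq_le_pairing hg
    have h1 := (h X Y).1
    have hX := (mul_nonneg hκ.le (sq_nonneg _)).trans (hc X)
    have hY := (mul_nonneg hκ.le (sq_nonneg _)).trans (hc Y)
    have h2 : 0 ≤ 1 / k * (pairing g X X + pairing g Y Y) := by positivity
    simp only [pairingCLM_apply]
    linarith

end TensorAlgebra

/-- The equations have constant coefficients. Time shifts reduce `t₀` to 0, and shifts by the period
give periodicity. -/
lemma FrameSystem.SolvesAt.translate {V : Type*} [NormedAddCommGroup V] [NormedSpace ℝ V]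
    {S : FrameSystem V} {E H B : ℝ × ℝ → V} {z v : ℝ × ℝ} (h : S.SolvesAt E H B (z + v)) :
    S.SolvesAt (fun w => E (w + v)) (fun w => H (w + v)) (fun w => B (w + v)) z := by
  constructor
  · simp only [fderiv_comp_add_right]
    exact h.evol_E
  · simp only [fderiv_comp_add_right]
    exact h.evol_H
  · simp only [fderiv_comp_add_right]
    exact h.evol_B

/-! ### The Cauchy problem in components, on the line and on the circle -/

namespace FrameFields

variable {ι : Type*}

/-- The fields translated by a vector of the plane. -/
def translate (K : FrameFields (ℝ × ℝ) ι) (v : ℝ × ℝ) : FrameFields (ℝ × ℝ) ι where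
  E := fun z => K.E (z + v)
  H := fun z => K.H (z + v)
  B := fun z => K.B (z + v)

lemma eq_iff {X : Type*} {K K' : FrameFields X ι} :
    K = K' ↔ K.E = K'.E ∧ K.H = K'.H ∧ K.B = K'.B := by
  cases K; cases K'; simp

variable [Fintype ι]

lemma Smooth.translate {K : FrameFields (ℝ × ℝ) ι} (h : K.Smooth) (v : ℝ × ℝ) :
    (K.translate v).Smooth := by
  have hv : ContDiff ℝ ∞ fun z : ℝ × ℝ => z + v := by fun_prop
  exact ⟨h.1.comp hv, h.2.1.comp hv, h.2.2.comp hv⟩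

lemma deriv_space_component {f : ℝ × ℝ → ι → ℝ} (hf : ContDiff ℝ ∞ f) (x t : ℝ) (a : ι) :
    deriv (fun y => f (y, t) a) x = fderiv ℝ f (x, t) (1, 0) a :=
  (hasDerivAt_pi.1 (hasDerivAt_space_slice (hf.differentiable (by simp)) x t) a).deriv

lemma deriv_time_component {f : ℝ × ℝ → ι → ℝ} (hf : ContDiff ℝ ∞ f) (x t : ℝ) (a : ι) :
    deriv (fun s => f (x, s) a) t = fderiv ℝ f (x, t) (0, 1) a :=
  (hasDerivAt_pi.1 (hasDerivAt_time_slice (hf.differentiable (by simp)) x t) a).deriv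

variable [DecidableEq ι] {𝔤 : Type*} [LieRing 𝔤] [LieAlgebra ℝ 𝔤] (e : Module.Basis ι ℝ 𝔤)
  {g : Matrix ι ι ℝ} (hg : g.PosDef) {p : Matrix ι ι ℝ} (hp : p.transpose = -p)
  {vt vx vy lam : ℝ} (hlam : SmallCoupling g p vt lam)

/-- For smooth fields the componentwise partial derivatives are the components of Fréchet
derivatives in the coordinate directions, so both forms of the equations agree. -/
lemma evolution_iff {K : FrameFields (ℝ × ℝ) ι} (hK : K.Smooth) :
    K.Evolution (structureTensor e) g p vt vx vy lam ↔
      ∀ z, (frameSystem e hg hp vt vx vy lam hlam).SolvesAt K.E K.H K.B z := by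
  obtain ⟨hE, hH, hB⟩ := hK
  have hsource : ∀ (z : ℝ × ℝ) (a : ι),
      (frameSystem e hg hp vt vx vy lam hlam).source (K.E z) (K.H z) (K.B z) a =
      (contract (raisedTensor (structureTensor e) g) (K.B z) (K.B z) a
        - contract (raisedTensor (structureTensor e) g) (K.E z) (K.E z) a
        - contract (raisedTensor (structureTensor e) g) (K.H z) (K.H z) a)
      + lam * (vy * contract (torsionTensor (structureTensor e) g p) (K.B z) (K.E z) a
        - vx * contract (torsionTensor (structureTensor e) g p) (K.B z) (K.H z) a
        + vt * contract (torsionTensor (structureTensor e) g p) (K.E z) (K.H z) a) := by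
    intro z a
    simp only [FrameSystem.source, frameSystem, contractCLM_apply, Pi.add_apply, Pi.sub_apply,
      Pi.smul_apply, smul_eq_mul]
    ring
  simp only [Evolution, deriv_space_component hE, deriv_space_component hB,
    deriv_time_component hE, deriv_time_component hH, deriv_time_component hB]
  constructor
  · rintro h ⟨x, t⟩
    refine ⟨funext fun a => (h x t a).1, funext fun a => (h x t a).2.1, funext fun a => ?_⟩
    rw [(h x t a).2.2, Pi.sub_apply, hsource]
    ring
  · intro h x t a
    refine ⟨congrFun (h (x, t)).evol_E a, congrFun (h (x, t)).evol_H a, ?_⟩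
    rw [(h (x, t)).evol_B, Pi.sub_apply, hsource]
    ring

-- A time shift moves the initial time to 0, where `eq_of_solvesAt` applies; shifting back loses
-- nothing.
include hg hp hlam in
lemma IsCauchySolution.unique {t₀ : ℝ} {K K' : FrameFields (ℝ × ℝ) ι} {D : FrameFields ℝ ι}
    (hK : K.IsCauchySolution (structureTensor e) g p vt vx vy lam t₀ D)
    (hK' : K'.IsCauchySolution (structureTensor e) g p vt vx vy lam t₀ D) : K = K' := by
  obtain ⟨hs, he, h0⟩ := hK
  obtain ⟨hs', he', h0'⟩ := hK'
  have hev := (evolution_iff e hg hp hlam hs).1 he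
  have hev' := (evolution_iff e hg hp hlam hs').1 he'
  have hst := hs.translate (0, t₀)
  have hst' := hs'.translate (0, t₀)
  have hslice : K.slice t₀ = K'.slice t₀ := h0.trans h0'.symm
  obtain ⟨q1, q2, q3⟩ := eq_iff.1 hslice
  obtain ⟨e1, e2, e3⟩ := (frameSystem e hg hp vt vx vy lam hlam).eq_of_solvesAt hst.1 hst.2.1
    hst.2.2 hst'.1 hst'.2.1 hst'.2.2 (fun z => (hev (z + (0, t₀))).translate)
    (fun z => (hev' (z + (0, t₀))).translate) (fun x => by
      have k1 := congrFun q1 x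
      have k2 := congrFun q2 x
      have k3 := congrFun q3 x
      simp only [slice] at k1 k2 k3
      simp [translate, k1, k2, k3])
  have hback : ∀ (f f' : ℝ × ℝ → ι → ℝ), (fun z => f (z + (0, t₀))) = (fun z => f' (z + (0, t₀))) →
      f = f' := by
    intro f f' h
    funext z
    have h1 := congrFun h (z - (0, t₀))
    simpa only [sub_add_cancel] using h1
  exact eq_iff.2 ⟨hback _ _ e1, hback _ _ e2, hback _ _ e3⟩

include hg hp hlam in
/-- The Cauchy problem for arbitrary smooth data on the line. -/
theorem exists_isCauchySolution (t₀ : ℝ) {D : FrameFields ℝ ι} (hD : D.Smooth)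
    (hcon : D.Constraint (structureTensor e)) :
    ∃ K : FrameFields (ℝ × ℝ) ι, K.IsCauchySolution (structureTensor e) g p vt vx vy lam t₀ D ∧
      ∀ t : ℝ, (K.slice t).Constraint (structureTensor e) := by
  obtain ⟨hE₀, hH₀, hB₀⟩ := hD
  obtain ⟨E, H, B, hE, hH, hB, hsol, hinit, hc⟩ :=
    (frameSystem e hg hp vt vx vy lam hlam).exists_global hE₀ hH₀ hB₀ (fun x => by
      funext a
      have h1 := hasDerivAt_pi.1 (hH₀.differentiable (by simp) x).hasDerivAt a
      rw [← h1.deriv]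
      exact hcon x a)
  have hs : FrameFields.Smooth ⟨E, H, B⟩ := ⟨hE, hH, hB⟩
  have hst := hs.translate (0, -t₀)
  refine ⟨translate ⟨E, H, B⟩ (0, -t₀), ⟨hst, ?_, ?_⟩, ?_⟩
  · exact (evolution_iff e hg hp hlam hst).2 fun z => (hsol (z + (0, -t₀))).translate
  · refine eq_iff.2 ⟨?_, ?_, ?_⟩ <;> funext x
    · simpa [translate, slice] using (hinit x).1
    · simpa [translate, slice] using (hinit x).2.1
    · simpa [translate, slice] using (hinit x).2.2
  · intro t x a
    simp only [translate, slice, Prod.mk_add_mk, add_zero]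
    rw [deriv_space_component hH x (t + -t₀) a, hc]
    rfl

include hg hp hlam in
/-- Solutions with periodic data are periodic. -/
lemma IsCauchySolution.spacePeriodic {t₀ L : ℝ} {K : FrameFields (ℝ × ℝ) ι} {D : FrameFields ℝ ι}
    (hK : K.IsCauchySolution (structureTensor e) g p vt vx vy lam t₀ D) (hD : D.DataPeriodic L) :
    K.SpacePeriodic L := by
  have hK' := hK
  obtain ⟨hs, he, h0⟩ := hK'
  have hev := (evolution_iff e hg hp hlam hs).1 he
  have hst := hs.translate (L, 0)
  -- The shift by a period solves the same Cauchy problem, so uniqueness identifies it with `K`.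
  have hcs : (K.translate (L, 0)).IsCauchySolution (structureTensor e) g p vt vx vy lam t₀ D := by
    refine ⟨hst, (evolution_iff e hg hp hlam hst).2 fun z => (hev (z + (L, 0))).translate, ?_⟩
    subst h0
    refine eq_iff.2 ⟨funext fun x => ?_, funext fun x => ?_, funext fun x => ?_⟩
    · simpa [translate, slice] using hD.1 x
    · simpa [translate, slice] using hD.2.1 x
    · simpa [translate, slice] using hD.2.2 x
  obtain ⟨e1, e2, e3⟩ := eq_iff.1 (hcs.unique e hg hp hlam hK)
  intro t
  refine ⟨fun x => ?_, fun x => ?_, fun x => ?_⟩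
  · simpa [translate] using congrFun e1 (x, t)
  · simpa [translate] using congrFun e2 (x, t)
  · simpa [translate] using congrFun e3 (x, t)

end FrameFields

theorem theorem2 {ι 𝔤 : Type*} [Fintype ι] [DecidableEq ι] [LieRing 𝔤] [LieAlgebra ℝ 𝔤]
    (e : Module.Basis ι ℝ 𝔤) (C : ι → ι → ι → ℝ) (hC : C = structureTensor e)
    (g : Matrix ι ι ℝ) (hg : g.PosDef) (p : Matrix ι ι ℝ) (hp : p.transpose = -p)
    (vt vx vy lam : ℝ) (hlam : SmallCoupling g p vt lam) (t₀ : ℝ) :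
    -- space is the line
    (∀ D : FrameFields ℝ ι, D.Smooth → D.CompactlySupported → D.Constraint C →
      ∃ K : FrameFields (ℝ × ℝ) ι,
        K.IsCauchySolution C g p vt vx vy lam t₀ D ∧
        (∀ t : ℝ, (K.slice t).Constraint C) ∧
        ∀ K' : FrameFields (ℝ × ℝ) ι, K'.IsCauchySolution C g p vt vx vy lam t₀ D → K' = K) ∧
    -- space is a circle of length `L`, where every function has compact support
    (∀ L : ℝ, 0 < L → ∀ D : FrameFields ℝ ι, D.Smooth → D.DataPeriodic L → D.Constraint C →
      ∃ K : FrameFields (ℝ × ℝ) ι,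
        (K.IsCauchySolution C g p vt vx vy lam t₀ D ∧ K.SpacePeriodic L) ∧
        (∀ t : ℝ, (K.slice t).Constraint C) ∧
        ∀ K' : FrameFields (ℝ × ℝ) ι,
          K'.IsCauchySolution C g p vt vx vy lam t₀ D → K'.SpacePeriodic L → K' = K) := by
  subst hC
  refine ⟨fun D hD _ hcon => ?_, fun L _ D hD hper hcon => ?_⟩
  · obtain ⟨K, hK, hKc⟩ := FrameFields.exists_isCauchySolution e hg hp hlam t₀ hD hcon
    exact ⟨K, hK, hKc, fun K' hK' => hK'.unique e hg hp hlam hK⟩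
  -- The circle needs no separate existence proof: the periodic data are solved on the line and the
  -- solution inherits the period.
  · obtain ⟨K, hK, hKc⟩ := FrameFields.exists_isCauchySolution e hg hp hlam t₀ hD hcon
    exact ⟨K, ⟨hK, hK.spacePeriodic e hg hp hlam hper⟩, hKc,
      fun K' hK' _ => hK'.unique e hg hp hlam hK⟩
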